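/- A Boolean function $F$ over $n\ge 0$ variables $X_1,\dots,X_n$ is given by a propositional formula built from these variables (not all of which have to occur) and the constants $0,1$ with the connectors $\wedge,\vee,\neg$. For $T\subseteq[n]$ let $F[T]\in\{0,1\}$ be the value of $F$ when exactly the variables $X_i$, $i\in T$, are set to $1$. Put $\#F=\sum_{T\subseteq[n]}F[T]$, $\#_kF=\sum_{T\subseteq[n],|T|=k}F[T]$, and $$\mathrm{Shap}(F,X_i)=\frac1{n!}\sum_{\Pi\in S_n}\bigl(F[\Pi^{<i}\cup\{i\}]-F[\Pi^{<i}]\bigr),$$ where $\Pi^{<i}$ is the set of indices that come before $i$ in the permutation $\Pi$. For a class $\mathcal C$ of Boolean functions let $\widetilde{\mathcal C}$ be the class of all functions that arise from some $F\in\mathcal C$ by substituting each variable $X_i$ by a disjunction $Z_i^1\vee\dots\vee Z_i^{m_i}$ of $m_i\ge 0$ fresh variables (by the constant $0$ if $m_i=0$); the result is a function over the $\sum_i m_i$ fresh variables, which may be named arbitrarily. Consider the problems, each with input $F\in\mathcal C$ (the list of its $n$ variables and its formula): $\#\mathcal C$ (compute $\#F$), $\#_*\mathcal C$ (compute $(\#_0F,\dots,\#_nF)$),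 and $\mathrm{Shap}(\mathcal C)$ (compute $(\mathrm{Shap}(F,X_1),\dots,\mathrm{Shap}(F,X_n))$). Write $A\equiv^P B$ if each of the problems $A$ and $B$ can be solved by a polynomial-time algorithm with access to an oracle for the other. (1) For every class $\mathcal C$ of Boolean functions with $\mathcal C=\widetilde{\mathcal C}$, the three problems are pairwise polynomial-time equivalent: $$\mathrm{Shap}(\mathcal C)\equiv^P\#_*\mathcal C\equiv^P\#\mathcal C .$$ (2) Let $\mathcal C$ be the class of positive $\beta$-acyclic CNFs, that is, of conjunctions of disjunctions of non-negated variables such that there are no $k\ge 3$, clauses $S_0,\dots,S_{k-1}$ and variables $x_0,\dots,x_{k-1}$ such that, with indices modulo $k$, each $x_i$ occurs in $S_i$ and $S_{i+1}$ and in no other $S_j$. Then $\mathrm{Shap}(\mathcal C)$ is in FP, that is, it can be solved in polynomial time. -/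

import Mathlib

namespace ShapMC

/-! ## Boolean functions, given by formulas -/

/-- Propositional formulas over a set `V` of variables, with the connectors "and", "or", "not";
the constants are needed because a variable may be substituted by the empty disjunction. -/
inductive Form (V : Type) : Type
  | const (b : Bool) : Form V
  | var (x : V) : Form V
  | neg (A : Form V) : Form V
  | and (A B : Form V) : Form V
  | or (A B : Form V) : Form V

namespace Form

/-- The truth value of a formula under a valuation. -/
def eval {V : Type} (v : V → Bool) : Form V → Bool
  | const b => b
  | var x => v x
  | neg A => !(A.eval v)
  | and A B => A.eval v && B.eval v
  | or A B => A.eval v || B.eval v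

/-- The result `A[θ]` of applying the substitution `θ` to `A`. -/
def subst {V W : Type} (θ : V → Form W) : Form V → Form W
  | const b => const b
  | var x => θ x
  | neg A => neg (A.subst θ)
  | and A B => and (A.subst θ) (B.subst θ)
  | or A B => or (A.subst θ) (B.subst θ)

/-- The disjunction `A₁ ∨ (A₂ ∨ (⋯ ∨ Aₘ))`; it is the constant `0` if `m = 0` and `A₁` if
`m = 1`. -/
def disj {V : Type} : List (Form V) → Form V
  | [] => const false
  | [A] => A
  | A :: B :: L => or A (disj (B :: L))

end Form

/-- A Boolean function over the variables `X₀, …, Xₙ₋₁` (not all of which have to occur). -/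
structure BoolFun : Type where
  /-- the number of variables -/
  n : ℕ
  /-- the formula -/
  form : Form (Fin n)

namespace BoolFun

/-- `F[T]`: the value (0 or 1) of `F` under the valuation that sets to 1 exactly the variables
in `T`. -/
def val (F : BoolFun) (T : Finset (Fin F.n)) : ℕ :=
  (F.form.eval fun i => decide (i ∈ T)).toNat

/-- The model count `#F`. -/
def count (F : BoolFun) : ℕ := ∑ T : Finset (Fin F.n), F.val T

/-- The number `#ₖF` of models of size `k`. -/
def countSize (F : BoolFun) (k : ℕ) : ℕ :=
  ∑ T ∈ (Finset.univ : Finset (Fin F.n)).powersetCard k, F.val T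

/-- The set of the indices that come before `i` in the permutation `π`, where `π p` is the index
at position `p`. -/
def before {n : ℕ} (π : Equiv.Perm (Fin n)) (i : Fin n) : Finset (Fin n) :=
  Finset.univ.filter fun j => π.symm j < π.symm i

/-- The Shapley value of the variable `Xᵢ` in `F`. -/
def shapley (F : BoolFun) (i : Fin F.n) : ℚ :=
  1 / (F.n.factorial : ℚ) * ∑ π : Equiv.Perm (Fin F.n),
    ((F.val (before π i ∪ {i}) : ℚ) - (F.val (before π i) : ℚ))

/-- `F` admits an OR-substitution into `G`: `G` is obtained from `F` by substituting each variable
`Xᵢ` by a disjunction of `m i ≥ 0` fresh variables. The variables of `G` are exactly the fresh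
variables; the bijection `e` names them (functions are identified up to renaming of variables). -/
def OrSubst (F G : BoolFun) : Prop :=
  ∃ (m : Fin F.n → ℕ) (e : (Σ i : Fin F.n, Fin (m i)) ≃ Fin G.n),
    G.form = F.form.subst fun i => Form.disj (List.ofFn fun j : Fin (m i) => Form.var (e ⟨i, j⟩))

end BoolFun

/-- The class of all functions into which functions of `C` admit an OR-substitution. -/
def orClosure (C : Set BoolFun) : Set BoolFun := {G | ∃ F ∈ C, F.OrSubst G}

/-! ## Positive β-acyclic CNFs -/

namespace Form

/-- Disjunctions of variables (the empty disjunction is the constant 0). -/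
inductive IsPosClause {V : Type} : Form V → Prop
  | empty : IsPosClause (const false)
  | var (x : V) : IsPosClause (var x)
  | or {A B : Form V} : IsPosClause A → IsPosClause B → IsPosClause (or A B)

/-- Conjunctions of positive clauses (the empty conjunction is the constant 1). -/
inductive IsPosCNF {V : Type} : Form V → Prop
  | empty : IsPosCNF (const true)
  | clause {A : Form V} : IsPosClause A → IsPosCNF A
  | and {A B : Form V} : IsPosCNF A → IsPosCNF B → IsPosCNF (and A B)

/-- The set of variables that occur in a formula. -/
def vars {V : Type} [DecidableEq V] : Form V → Finset V
  | const _ => ∅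
  | var x => {x}
  | neg A => A.vars
  | and A B => A.vars ∪ B.vars
  | or A B => A.vars ∪ B.vars

/-- The hyperedges of the hypergraph of a CNF: the variable sets of its clauses. -/
def edges {V : Type} [DecidableEq V] : Form V → Finset (Finset V)
  | and A B => A.edges ∪ B.edges
  | const true => ∅
  | A => {A.vars}

end Form

/-- The hypergraph with edge set `E` is β-acyclic: neither it nor any sub-hypergraph (subset of the
edges) is a cycle, that is, there are no edges `S₀, …, Sₖ₋₁` and vertices `x₀, …, xₖ₋₁` with
`k ≥ 3` such that, cyclically, each `xᵢ` lies in `Sᵢ` and `Sᵢ₊₁` and in no other of the `Sⱼ`.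
(The edges, and the vertices, are then automatically distinct.) -/
def BetaAcyclic {V : Type} (E : Finset (Finset V)) : Prop :=
  ¬ ∃ (m : ℕ) (S : Fin (m + 3) → Finset V) (x : Fin (m + 3) → V),
    (∀ i, S i ∈ E) ∧ ∀ i j, x i ∈ S j ↔ (j = i ∨ j = i + 1)

/-- The class of positive β-acyclic CNF functions. -/
def posBetaAcyclicCNF : Set BoolFun := {F | F.form.IsPosCNF ∧ BetaAcyclic F.form.edges}

/-! ## A model of computation with time and oracles

Data are binary trees whose leaves are natural numbers; the size of a number is its bit length.
Programs work on one datum. Every elementary step is charged at least the size of all data that it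
reads and copies, arithmetic is charged quadratically in the bit length, and an oracle call is
charged for its question and its answer. So a Turing machine simulates a program with polynomial
overhead, and conversely. -/

/-- Data. -/
inductive Val : Type
  | nat (a : ℕ) : Val
  | pair (u v : Val) : Val

namespace Val

/-- The size of a datum. -/
def size : Val → ℕ
  | nat a => 1 + Nat.size a
  | pair u v => 1 + u.size + v.size

/-- Lists as data. -/
def list : List Val → Val
  | [] => nat 0
  | v :: l => pair v (list l)

/-- Integers as data: sign and absolute value. -/
def int (z : ℤ) : Val := pair (nat (if z < 0 then 1 else 0)) (nat z.natAbs)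

/-- Rational numbers as data: the reduced fraction. -/
def rat (q : ℚ) : Val := pair (int q.num) (nat q.den)

/-- Formulas as data. -/
def form {n : ℕ} : Form (Fin n) → Val
  | .const b => pair (nat 0) (nat b.toNat)
  | .var i => pair (nat 1) (nat i)
  | .neg A => pair (nat 2) (form A)
  | .and A B => pair (nat 3) (pair (form A) (form B))
  | .or A B => pair (nat 4) (pair (form A) (form B))

/-- Boolean functions as data: the list of the variables and the formula. -/
def boolFun (F : BoolFun) : Val :=
  pair (list (List.ofFn fun i : Fin F.n => nat i)) (form F.form)

end Val

/-- Elementary operations. -/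
inductive Prim : Type
  | id : Prim
  | const (c : Val) : Prim
  | fst : Prim
  | snd : Prim
  | isPair : Prim
  | add : Prim
  | sub : Prim
  | mul : Prim
  | div : Prim
  | le : Prim

/-- The result of an elementary operation; it is `0` on data on which the operation makes no sense.
Subtraction is truncated and division is integer division, with `a / 0 = 0`. -/
def Prim.run : Prim → Val → Val
  | id, v => v
  | const c, _ => c
  | fst, .pair u _ => u
  | snd, .pair _ v => v
  | isPair, .pair _ _ => .nat 1
  | add, .pair (.nat a) (.nat b) => .nat (a + b)
  | sub, .pair (.nat a) (.nat b) => .nat (a - b)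
  | mul, .pair (.nat a) (.nat b) => .nat (a * b)
  | div, .pair (.nat a) (.nat b) => .nat (a / b)
  | le, .pair (.nat a) (.nat b) => .nat (if a ≤ b then 1 else 0)
  | _, _ => .nat 0

/-- Programs. `pair p q` maps `v` to the pair of `p v` and `q v`; `comp p q` runs `q` and then `p`;
`ite c p q` runs `p` if the test `c` does not give `0`, and `q` otherwise; `loop c p` repeats `p`
as long as the test `c` does not give `0`; `oracle` asks the oracle. -/
inductive Prog : Type
  | prim (o : Prim) : Prog
  | oracle : Prog
  | pair (p q : Prog) : Prog
  | comp (p q : Prog) : Prog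
  | ite (c p q : Prog) : Prog
  | loop (c p : Prog) : Prog

/-- `Eval O p v w t`: with oracle `O`, the program `p` halts on input `v` with output `w` after
time `t`. -/
inductive Eval (O : Val → Val) : Prog → Val → Val → ℕ → Prop
  | prim (o : Prim) (v : Val) : Eval O (.prim o) v (o.run v) ((1 + v.size) ^ 2)
  | oracle (v : Val) : Eval O .oracle v (O v) (1 + v.size + (O v).size)
  | pair {p q : Prog} {v u w : Val} {s t : ℕ} (hp : Eval O p v u s) (hq : Eval O q v w t) :
      Eval O (.pair p q) v (.pair u w) (1 + v.size + s + t)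
  | comp {p q : Prog} {v u w : Val} {s t : ℕ} (hq : Eval O q v u s) (hp : Eval O p u w t) :
      Eval O (.comp p q) v w (1 + s + t)
  | iteTrue {c p q : Prog} {v b w : Val} {s t : ℕ} (hc : Eval O c v b s) (hb : b ≠ .nat 0)
      (hp : Eval O p v w t) : Eval O (.ite c p q) v w (1 + v.size + s + t)
  | iteFalse {c p q : Prog} {v w : Val} {s t : ℕ} (hc : Eval O c v (.nat 0) s)
      (hq : Eval O q v w t) : Eval O (.ite c p q) v w (1 + v.size + s + t)
  | loopStop {c p : Prog} {v : Val} {s : ℕ} (hc : Eval O c v (.nat 0) s) :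
      Eval O (.loop c p) v v (1 + v.size + s)
  | loopStep {c p : Prog} {v b u w : Val} {r s t : ℕ} (hc : Eval O c v b r) (hb : b ≠ .nat 0)
      (hp : Eval O p v u s) (hl : Eval O (.loop c p) u w t) :
      Eval O (.loop c p) v w (1 + v.size + r + s + t)

/-- Programs are deterministic: output and running time are determined by the input. -/
theorem Eval.unique {O : Val → Val} {p : Prog} {v w w' : Val} {t t' : ℕ}
    (h : Eval O p v w t) (h' : Eval O p v w' t') : w = w' ∧ t = t' := by
  induction h generalizing w' t' with
  | prim o v => cases h'; exact ⟨rfl, rfl⟩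
  | oracle v => cases h'; exact ⟨rfl, rfl⟩
  | pair _ _ ih₁ ih₂ =>
    cases h' with
    | pair h₁ h₂ =>
      obtain ⟨rfl, rfl⟩ := ih₁ h₁
      obtain ⟨rfl, rfl⟩ := ih₂ h₂
      exact ⟨rfl, rfl⟩
  | comp _ _ ih₁ ih₂ =>
    cases h' with
    | comp h₁ h₂ =>
      obtain ⟨rfl, rfl⟩ := ih₁ h₁
      obtain ⟨rfl, rfl⟩ := ih₂ h₂
      exact ⟨rfl, rfl⟩
  | iteTrue _ hb _ ih₁ ih₂ =>
    cases h' with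
    | iteTrue h₁ _ h₂ =>
      obtain ⟨rfl, rfl⟩ := ih₁ h₁
      obtain ⟨rfl, rfl⟩ := ih₂ h₂
      exact ⟨rfl, rfl⟩
    | iteFalse h₁ _ => exact absurd (ih₁ h₁).1 hb
  | iteFalse _ _ ih₁ ih₂ =>
    cases h' with
    | iteTrue h₁ hb _ => exact absurd (ih₁ h₁).1.symm hb
    | iteFalse h₁ h₂ =>
      obtain ⟨-, rfl⟩ := ih₁ h₁
      obtain ⟨rfl, rfl⟩ := ih₂ h₂
      exact ⟨rfl, rfl⟩
  | loopStop _ ih =>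
    cases h' with
    | loopStop h₁ =>
      obtain ⟨-, rfl⟩ := ih h₁
      exact ⟨rfl, rfl⟩
    | loopStep h₁ hb _ _ => exact absurd (ih h₁).1.symm hb
  | loopStep _ hb _ _ ih₁ ih₂ ih₃ =>
    cases h' with
    | loopStop h₁ => exact absurd (ih₁ h₁).1 hb
    | loopStep h₁ _ h₂ h₃ =>
      obtain ⟨rfl, rfl⟩ := ih₁ h₁
      obtain ⟨rfl, rfl⟩ := ih₂ h₂
      obtain ⟨rfl, rfl⟩ := ih₃ h₃
      exact ⟨rfl, rfl⟩

/-- The program makes no use of the oracle. -/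
def Prog.OracleFree : Prog → Prop
  | prim _ => True
  | oracle => False
  | pair p q => p.OracleFree ∧ q.OracleFree
  | comp p q => p.OracleFree ∧ q.OracleFree
  | ite c p q => c.OracleFree ∧ p.OracleFree ∧ q.OracleFree
  | loop c p => c.OracleFree ∧ p.OracleFree

/-- A computational problem: for each instance, compute the answer. -/
structure Problem : Type 1 where
  /-- the instances -/
  Inst : Type
  /-- an instance as input datum -/
  input : Inst → Val
  /-- the datum to compute -/
  output : Inst → Val

/-- `O` is an oracle for the problem `B`: it answers every instance of `B` correctly. On other data
its answers are arbitrary. -/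
def Problem.IsOracle (B : Problem) (O : Val → Val) : Prop := ∀ x : B.Inst, O (B.input x) = B.output x

/-- With oracle `O`, the program `p` solves every instance of `A` within the time bound `P`. -/
def Problem.SolvedBy (A : Problem) (O : Val → Val) (p : Prog) (P : Polynomial ℕ) : Prop :=
  ∀ x : A.Inst, ∃ t : ℕ, Eval O p (A.input x) (A.output x) t ∧ t ≤ P.eval (A.input x).size

/-- Polynomial-time (Cook) reduction from `A` to `B`. -/
def PolyReduces (A B : Problem) : Prop :=
  ∃ (p : Prog) (P : Polynomial ℕ), ∀ O : Val → Val, B.IsOracle O → A.SolvedBy O p P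

/-- Polynomial-time equivalence. -/
def PolyEquiv (A B : Problem) : Prop := PolyReduces A B ∧ PolyReduces B A

/-- The problem `A` is in FP: solvable in polynomial time without oracle. -/
def InFP (A : Problem) : Prop :=
  ∃ (p : Prog) (P : Polynomial ℕ), p.OracleFree ∧ ∀ O : Val → Val, A.SolvedBy O p P

/-! ## The three problems -/

/-- Model counting over `C`: given `F ∈ C`, compute `#F`. -/
def countProblem (C : Set BoolFun) : Problem where
  Inst := C
  input F := Val.boolFun F.1
  output F := Val.nat F.1.count

/-- Fixed-size model counting over `C`: given `F ∈ C` over `n` variables, compute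
`(#₀F, …, #ₙF)`. -/
def fixedSizeCountProblem (C : Set BoolFun) : Problem where
  Inst := C
  input F := Val.boolFun F.1
  output F := Val.list (List.ofFn fun k : Fin (F.1.n + 1) => Val.nat (F.1.countSize k))

/-- Shapley value computation over `C`: given `F ∈ C`, compute the vector of the Shapley values of
all variables. -/
def shapleyProblem (C : Set BoolFun) : Problem where
  Inst := C
  input F := Val.boolFun F.1
  output F := Val.list (List.ofFn fun i : Fin F.1.n => Val.rat (F.1.shapley i))

end ShapMC

namespace ShapMC

/-! ## Polynomial-time functions between encoded types -/

/-! All reductions are non-adaptive: a list of substituted functions is queried, and the answers are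
combined by exact arithmetic. They are stated as `Transfers`, which turns any polynomial-time
algorithm for one problem into one for the other. So the same reductions give part (1), with the
oracle as algorithm, and part (2), with an oracle-free counting algorithm. Closure under
OR-substitution makes the queries instances of the class.

Size counts from counts: if every variable is replaced by `M` copies, a set of `k` variables is the
image of `(2 ^ M - 1) ^ k` sets of copies, so the count is `∑ k, #ₖF * (2 ^ M - 1) ^ k`. For `M = n
+ 2` the base exceeds all coefficients, which are therefore its digits (`digit_of_sum`).

Shapley values from size counts: grouping the permutations by the set before `i` gives the weights
`k! (n - 1 - k)! / n!`. The models without `Xᵢ` are counted by substituting `0` for `Xᵢ`, those with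
`Xᵢ` by subtraction.

Size counts from Shapley values: replace `Xᵢ` by `a + 1` copies. A copy contributes nothing once
another copy is present, so only the weights change, to `k! (n + a - 1 - k)! / (n + a)!`
(`BoolFun.shapley_subOr`). Summation over `i` turns the value into a combination of the differences
`(k + 1) #ₖ₊₁F - (n - k) #ₖF`. Multiplied by `(n + a)! / a!`, it is the value at `a + 1` of a
polynomial of degree less than `n`, expanded in rising factorials. The arguments `a < n` determine
this polynomial; its values at `-j` and binomial inversion yield the coefficients (`recover_coeff`),
and these telescope to the counts, starting from `#₀F = F[∅]` (`recover_counts`).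

Part (2): the class is closed under OR-substitution, so a polynomial-time algorithm for counting
suffices. In a doubly lexical order of the incidence matrix, rows `r < r'` and columns `c < c'` with
the entries 1, 1 above 1, 0 would start an induced path that either closes to a cycle or grows
forever (`row_subset_of_lexical`). Hence the vertex of the first column is a nest point. Removing
nest points one by one gives an elimination order. If the clauses are sorted lexicographically along
it, then among the clauses that contain `y`, those that contain a variable eliminated after `y` come
last (`ElimOrder.follows`). Each clause carries a rational weight, initially 0. Eliminating `x`
multiplies weights by quotients whose telescoping product averages the cases `x = 0` and `x = 1`, so
that in the end `2 ^ n` times the product of the weights is the count (`two_pow_mul_prod_weight`).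
The weights have linear bit length, because products of them are ratios of such counts
(`exists_weight_eq`). -/

theorem Val.size_pos (v : Val) : 0 < v.size := by
  cases v <;> simp only [Val.size] <;> omega

theorem poly_eval_mono (P : Polynomial ℕ) {a b : ℕ} (h : a ≤ b) : P.eval a ≤ P.eval b := by
  induction P using Polynomial.induction_on' with
  | add p q hp hq => simpa using Nat.add_le_add hp hq
  | monomial n c => simpa using Nat.mul_le_mul_left c (Nat.pow_le_pow_left h n)

theorem size_add_le (a b : ℕ) : (a + b).size ≤ a.size + b.size + 1 := by
  rw [Nat.size_le]
  calc a + b < 2 ^ a.size + 2 ^ b.size := Nat.add_lt_add (Nat.lt_size_self a) (Nat.lt_size_self b)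
    _ ≤ 2 ^ (a.size + b.size) + 2 ^ (a.size + b.size) := by gcongr <;> simp
    _ = _ := by ring

theorem size_mul_le (a b : ℕ) : (a * b).size ≤ a.size + b.size := by
  rw [Nat.size_le, pow_add]
  exact Nat.mul_lt_mul'' (Nat.lt_size_self a) (Nat.lt_size_self b)

theorem Prim.size_run_le (o : Prim) :
    ∃ K, ∀ v, (o.run v).size ≤ K * (1 + v.size) ^ 2 := by
  have key : ∀ v : Val, 1 + v.size ≤ (1 + v.size) ^ 2 := fun v => Nat.le_self_pow (by simp) _
  have nat0 : ∀ (v : Val) (K : ℕ), 1 ≤ K → (Val.nat 0).size ≤ K * (1 + v.size) ^ 2 := fun v K hK =>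
    le_trans (by simp [Val.size]) (Nat.mul_le_mul hK (Nat.one_le_pow 2 _ (by omega)))
  cases o with
  | const c =>
    refine ⟨c.size, fun v => ?_⟩
    exact Nat.le_mul_of_pos_right _ (Nat.pow_pos (by omega))
  | id => exact ⟨1, fun v => by have := key v; simp only [Prim.run]; omega⟩
  | fst | snd | isPair =>
    refine ⟨2, fun v => ?_⟩
    have := key v
    cases v with
    | nat a => exact nat0 _ _ (by simp)
    | pair u w =>
      simp only [Prim.run, Val.size, Nat.size_one] at *
      omega
  | add | sub | mul | div | le =>
    refine ⟨2, fun v => ?_⟩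
    have hk := key v
    match v with
    | .nat a => exact nat0 _ _ (by simp)
    | .pair (.pair _ _) _ => exact nat0 _ _ (by simp)
    | .pair (.nat _) (.pair _ _) => exact nat0 _ _ (by simp)
    | .pair (.nat a) (.nat b) =>
      simp only [Prim.run, Val.size] at *
      have h1 := size_add_le a b
      have h2 := size_mul_le a b
      have h3 : (a - b).size ≤ a.size := Nat.size_le_size (Nat.sub_le _ _)
      have h4 : (a / b).size ≤ a.size := Nat.size_le_size (Nat.div_le_self _ _)
      have h5 : (if a ≤ b then 1 else 0 : ℕ).size ≤ 1 := by split_ifs <;> simp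
      omega

/-- Every rule charges for the data it produces, a loop through the failing test on its final state;
`K` absorbs the constants written in the program. Hence a time bound is also a bound on the size of
the output, which is what composition needs. -/
theorem Eval.size_le (p : Prog) :
    ∃ K, 1 ≤ K ∧ ∀ O v w t, Eval O p v w t → w.size ≤ K * t := by
  induction p with
  | prim o =>
    obtain ⟨K, hK⟩ := o.size_run_le
    refine ⟨K + 1, by omega, fun O v w t h => ?_⟩
    cases h
    exact (hK v).trans (Nat.mul_le_mul_right _ (by omega))
  | oracle =>
    refine ⟨1, le_rfl, fun O v w t h => ?_⟩
    cases h
    omega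
  | pair p q hp hq =>
    obtain ⟨K, hK1, hK⟩ := hp
    obtain ⟨L, hL1, hL⟩ := hq
    refine ⟨K + L, by omega, fun O v w t h => ?_⟩
    cases h with
    | pair h1 h2 =>
      have := hK _ _ _ _ h1
      have := hL _ _ _ _ h2
      simp only [Val.size]
      nlinarith
  | comp p q hp hq =>
    obtain ⟨K, hK1, hK⟩ := hp
    refine ⟨K, hK1, fun O v w t h => ?_⟩
    cases h with
    | comp h1 h2 => exact (hK _ _ _ _ h2).trans (Nat.mul_le_mul_left _ (by omega))
  | ite c p q _ hp hq =>
    obtain ⟨K, hK1, hK⟩ := hp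
    obtain ⟨L, hL1, hL⟩ := hq
    refine ⟨K + L, by omega, fun O v w t h => ?_⟩
    cases h with
    | iteTrue h1 hb h2 => exact (hK _ _ _ _ h2).trans (Nat.mul_le_mul (by omega) (by omega))
    | iteFalse h1 h2 => exact (hL _ _ _ _ h2).trans (Nat.mul_le_mul (by omega) (by omega))
  | loop c p _ _ =>
    refine ⟨1, le_rfl, fun O v w t h => ?_⟩
    generalize hq : Prog.loop c p = q at h
    induction h with
    | loopStop => omega
    | loopStep _ _ _ _ _ _ ih => have := ih hq; omega
    | _ => cases hq

/-- An encoding of the elements of a type as data. -/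
class Enc (α : Type) where
  /-- the datum that represents an element -/
  enc : α → Val

open Enc

/-- The size of the encoding of an element. -/
def sz {α : Type} [Enc α] (a : α) : ℕ := (enc a).size

instance : Enc Val := ⟨fun v => v⟩
instance : Enc ℕ := ⟨Val.nat⟩
instance : Enc Bool := ⟨fun b => Val.nat b.toNat⟩
instance {α β : Type} [Enc α] [Enc β] : Enc (α × β) := ⟨fun x => Val.pair (enc x.1) (enc x.2)⟩
instance {α : Type} [Enc α] : Enc (List α) := ⟨fun l => Val.list (l.map enc)⟩

section PolyTime

variable {α β γ δ : Type} [Enc α] [Enc β] [Enc γ] [Enc δ]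

/-- The function `f` is computed on encoded data by an oracle-free program in polynomial time. -/
@[fun_prop]
def PolyTime (f : α → β) : Prop :=
  ∃ p : Prog, p.OracleFree ∧ ∃ P : Polynomial ℕ, ∀ O a, ∃ t,
    Eval O p (enc a) (enc (f a)) t ∧ t ≤ P.eval (sz a)

/-- The size of the result is bounded by a polynomial in the size of the argument. -/
def PolySize (f : α → β) : Prop := ∃ P : Polynomial ℕ, ∀ a, sz (f a) ≤ P.eval (sz a)

theorem PolyTime.polySize {f : α → β} (hf : PolyTime f) : PolySize f := by
  obtain ⟨p, -, P, h⟩ := hf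
  obtain ⟨K, -, hK⟩ := Eval.size_le p
  refine ⟨Polynomial.C K * P, fun a => ?_⟩
  obtain ⟨t, ht, hle⟩ := h (fun v => v) a
  simpa [sz] using (hK _ _ _ _ ht).trans (Nat.mul_le_mul_left K hle)

theorem PolyTime.of_prim (o : Prim) {f : α → β} (h : ∀ a, o.run (enc a) = enc (f a)) :
    PolyTime f :=
  ⟨.prim o, trivial, (1 + Polynomial.X) ^ 2, fun O a =>
    ⟨(1 + sz a) ^ 2, h a ▸ Eval.prim o (enc a), by simp⟩⟩

/-- A function with the same encodings as a polynomial-time function. -/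
theorem PolyTime.of_enc_eq {α' β' : Type} [Enc α'] [Enc β'] {f : α → β} {g : α' → β'}
    (hg : PolyTime g) (φ : α → α') (h1 : ∀ a, enc a = enc (φ a))
    (h2 : ∀ a, enc (f a) = enc (g (φ a))) : PolyTime f := by
  obtain ⟨p, hp, P, h⟩ := hg
  refine ⟨p, hp, P, fun O a => ?_⟩
  obtain ⟨t, ht, hle⟩ := h O (φ a)
  refine ⟨t, ?_, ?_⟩
  · rw [h1, h2]; exact ht
  · simpa only [sz, h1] using hle

theorem PolyTime.congr {f g : α → β} (hg : PolyTime g) (h : ∀ a, f a = g a) : PolyTime f :=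
  (funext h : f = g) ▸ hg

@[fun_prop]
theorem PolyTime.id : PolyTime (fun a : α => a) := .of_prim .id fun _ => rfl

@[fun_prop]
theorem PolyTime.const (b : β) : PolyTime (fun _ : α => b) := .of_prim (.const (enc b)) fun _ => rfl

@[fun_prop]
theorem PolyTime.comp {f : β → γ} {g : α → β} (hf : PolyTime f) (hg : PolyTime g) :
    PolyTime (fun a => f (g a)) := by
  obtain ⟨Q, hQ⟩ := hg.polySize
  obtain ⟨p, hp, P, h⟩ := hf
  obtain ⟨q, hq, R, k⟩ := hg
  refine ⟨.comp p q, ⟨hp, hq⟩, 1 + R + P.comp Q, fun O a => ?_⟩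
  obtain ⟨s, hs, hsle⟩ := k O a
  obtain ⟨t, ht, htle⟩ := h O (g a)
  refine ⟨1 + s + t, hs.comp ht, ?_⟩
  have := htle.trans (poly_eval_mono P (hQ a))
  simp
  omega

@[fun_prop]
theorem PolyTime.prodMk {f : α → β} {g : α → γ} (hf : PolyTime f) (hg : PolyTime g) :
    PolyTime (fun a => (f a, g a)) := by
  obtain ⟨p, hp, P, h⟩ := hf
  obtain ⟨q, hq, R, k⟩ := hg
  refine ⟨.pair p q, ⟨hp, hq⟩, 1 + Polynomial.X + P + R, fun O a => ?_⟩
  obtain ⟨s, hs, hsle⟩ := h O a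
  obtain ⟨t, ht, htle⟩ := k O a
  refine ⟨_, hs.pair ht, ?_⟩
  simp
  change 1 + sz a + s + t ≤ _
  omega

@[fun_prop]
theorem PolyTime.fst {f : α → β × γ} (hf : PolyTime f) : PolyTime (fun a => (f a).1) :=
  PolyTime.comp (f := fun x : β × γ => x.1) (.of_prim .fst fun _ => rfl) hf

@[fun_prop]
theorem PolyTime.snd {f : α → β × γ} (hf : PolyTime f) : PolyTime (fun a => (f a).2) :=
  PolyTime.comp (f := fun x : β × γ => x.2) (.of_prim .snd fun _ => rfl) hf

@[fun_prop]
theorem PolyTime.cond {c : α → Bool} {f g : α → β} (hc : PolyTime c) (hf : PolyTime f)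
    (hg : PolyTime g) : PolyTime (fun a => bif c a then f a else g a) := by
  obtain ⟨b, hb, B, l⟩ := hc
  obtain ⟨p, hp, P, h⟩ := hf
  obtain ⟨q, hq, R, k⟩ := hg
  refine ⟨.ite b p q, ⟨hb, hp, hq⟩, 1 + Polynomial.X + B + P + R, fun O a => ?_⟩
  obtain ⟨r, hr, hrle⟩ := l O a
  obtain ⟨s, hs, hsle⟩ := h O a
  obtain ⟨t, ht, htle⟩ := k O a
  cases hca : c a
  · rw [hca] at hr
    refine ⟨_, by simpa only [hca, cond_false, cond_true] using Eval.iteFalse (p := p) hr ht, ?_⟩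
    simp
    change 1 + sz a + r + t ≤ _
    omega
  · rw [hca] at hr
    refine ⟨_, by simpa only [hca, cond_false, cond_true] using Eval.iteTrue (q := q) hr (by simp [enc]) hs, ?_⟩
    simp
    change 1 + sz a + r + s ≤ _
    omega

@[fun_prop]
theorem PolyTime.ite {c : α → Prop} [∀ a, Decidable (c a)] {f g : α → β}
    (hc : PolyTime fun a => decide (c a)) (hf : PolyTime f) (hg : PolyTime g) :
    PolyTime (fun a => if c a then f a else g a) :=
  (PolyTime.cond hc hf hg).congr fun a => by by_cases h : c a <;> simp [h]

/-! ### Loops -/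

/-- The state, the test and the body each cost at most `T` per round, and the failing test at the
end accounts for the additional round. -/
theorem Eval.loop_of_seq {O : Val → Val} {c p : Prog} (n T : ℕ) (a : ℕ → Val)
    (hc : ∀ k < n, ∃ b t, Eval O c (a k) b t ∧ b ≠ .nat 0 ∧ t ≤ T)
    (hhalt : ∃ t, Eval O c (a n) (.nat 0) t ∧ t ≤ T)
    (hp : ∀ k < n, ∃ t, Eval O p (a k) (a (k + 1)) t ∧ t ≤ T)
    (hs : ∀ k ≤ n, (a k).size ≤ T) :
    ∃ t, Eval O (.loop c p) (a 0) (a n) t ∧ t ≤ (n + 1) * (1 + 3 * T) := by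
  induction n generalizing a with
  | zero =>
    obtain ⟨t, ht, hle⟩ := hhalt
    refine ⟨_, Eval.loopStop ht, ?_⟩
    have := hs 0 le_rfl
    omega
  | succ n ih =>
    obtain ⟨t, ht, hle⟩ := ih (fun k => a (k + 1)) (fun k hk => hc _ (by omega)) hhalt
      (fun k hk => hp _ (by omega)) (fun k hk => hs _ (by omega))
    obtain ⟨b, r, hr, hb, hrle⟩ := hc 0 (by omega)
    obtain ⟨s, hs', hsle⟩ := hp 0 (by omega)
    refine ⟨_, Eval.loopStep hr hb hs' ht, ?_⟩
    have := hs 0 (by omega)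
    linarith

/-- A loop runs in polynomial time if the number of its rounds and the sizes of its states are
polynomially bounded. -/
theorem PolyTime.iterate_while {init : α → β} {c : β → Bool} {step : β → β} (N : α → ℕ)
    (hinit : PolyTime init) (hc : PolyTime c) (hstep : PolyTime step)
    (hrun : ∀ a, ∀ k < N a, c (step^[k] (init a)) = true)
    (hhalt : ∀ a, c (step^[N a] (init a)) = false)
    (hN : ∃ P : Polynomial ℕ, ∀ a, N a ≤ P.eval (sz a))
    (hsize : ∃ P : Polynomial ℕ, ∀ a, ∀ k ≤ N a, sz (step^[k] (init a)) ≤ P.eval (sz a)) :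
    PolyTime (fun a => step^[N a] (init a)) := by
  obtain ⟨i, hi, I, h0⟩ := hinit
  obtain ⟨c', hc', C, h1⟩ := hc
  obtain ⟨s', hs', S, h2⟩ := hstep
  obtain ⟨P, hP⟩ := hN
  obtain ⟨Q, hQ⟩ := hsize
  refine ⟨.comp (.loop c' s') i, ⟨⟨hc', hs'⟩, hi⟩,
    1 + I + (P + 1) * (1 + 3 * (C.comp Q + S.comp Q + Q)), fun O a => ?_⟩
  have hT := Eval.loop_of_seq (O := O) (c := c') (p := s') (N a)
    ((C.comp Q + S.comp Q + Q).eval (sz a)) (fun k => enc (step^[k] (init a))) ?_ ?_ ?_ ?_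
  · obtain ⟨t, ht, hle⟩ := hT
    obtain ⟨r, hr, hrle⟩ := h0 O a
    refine ⟨_, hr.comp ht, ?_⟩
    have h3 := Nat.mul_le_mul_right (1 + 3 * (C.comp Q + S.comp Q + Q).eval (sz a))
      (Nat.add_le_add_right (hP a) 1)
    simp only [Polynomial.eval_add, Polynomial.eval_mul, Polynomial.eval_one] at *
    simp only [Polynomial.eval_ofNat] at *
    omega
  · intro k hk
    obtain ⟨t, ht, hle⟩ := h1 O (step^[k] (init a))
    refine ⟨_, t, ht, by simp [hrun a k hk, enc], hle.trans ?_⟩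
    have := poly_eval_mono C (hQ a k hk.le)
    simp
    omega
  · obtain ⟨t, ht, hle⟩ := h1 O (step^[N a] (init a))
    rw [hhalt] at ht
    refine ⟨t, ht, hle.trans ?_⟩
    have := poly_eval_mono C (hQ a _ le_rfl)
    simp
    omega
  · intro k hk
    obtain ⟨t, ht, hle⟩ := h2 O (step^[k] (init a))
    refine ⟨t, ?_, hle.trans ?_⟩
    · rw [Function.iterate_succ_apply']; exact ht
    have := poly_eval_mono S (hQ a k hk.le)
    simp
    omega
  · intro k hk
    have := hQ a k hk
    simp
    change sz _ ≤ _
    omega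

/-! ### Natural numbers and truth values -/

@[fun_prop]
theorem PolyTime.natAdd {f g : α → ℕ} (hf : PolyTime f) (hg : PolyTime g) :
    PolyTime (fun a => f a + g a) :=
  PolyTime.comp (f := fun x : ℕ × ℕ => x.1 + x.2) (.of_prim .add fun _ => rfl) (hf.prodMk hg)

@[fun_prop]
theorem PolyTime.natSub {f g : α → ℕ} (hf : PolyTime f) (hg : PolyTime g) :
    PolyTime (fun a => f a - g a) :=
  PolyTime.comp (f := fun x : ℕ × ℕ => x.1 - x.2) (.of_prim .sub fun _ => rfl) (hf.prodMk hg)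

@[fun_prop]
theorem PolyTime.natMul {f g : α → ℕ} (hf : PolyTime f) (hg : PolyTime g) :
    PolyTime (fun a => f a * g a) :=
  PolyTime.comp (f := fun x : ℕ × ℕ => x.1 * x.2) (.of_prim .mul fun _ => rfl) (hf.prodMk hg)

@[fun_prop]
theorem PolyTime.natDiv {f g : α → ℕ} (hf : PolyTime f) (hg : PolyTime g) :
    PolyTime (fun a => f a / g a) :=
  PolyTime.comp (f := fun x : ℕ × ℕ => x.1 / x.2) (.of_prim .div fun _ => rfl) (hf.prodMk hg)

@[fun_prop]
theorem PolyTime.natMod {f g : α → ℕ} (hf : PolyTime f) (hg : PolyTime g) :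
    PolyTime (fun a => f a % g a) := by
  have : PolyTime (fun a => f a - g a * (f a / g a)) := by fun_prop
  exact this.congr fun a => Nat.mod_eq_sub_mul_div

@[fun_prop]
theorem PolyTime.natLe {f g : α → ℕ} (hf : PolyTime f) (hg : PolyTime g) :
    PolyTime (fun a => decide (f a ≤ g a)) :=
  PolyTime.comp (f := fun x : ℕ × ℕ => decide (x.1 ≤ x.2))
    (.of_prim .le fun x => by by_cases h : x.1 ≤ x.2 <;> simp [enc, Prim.run, h]) (hf.prodMk hg)

@[fun_prop]
theorem PolyTime.not {f : α → Bool} (hf : PolyTime f) : PolyTime (fun a => !f a) := by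
  have : PolyTime (fun a => bif f a then false else true) := by fun_prop
  exact this.congr fun a => by cases f a <;> rfl

@[fun_prop]
theorem PolyTime.and {f g : α → Bool} (hf : PolyTime f) (hg : PolyTime g) :
    PolyTime (fun a => f a && g a) := by
  have : PolyTime (fun a => bif f a then g a else false) := by fun_prop
  exact this.congr fun a => by cases f a <;> rfl

@[fun_prop]
theorem PolyTime.or {f g : α → Bool} (hf : PolyTime f) (hg : PolyTime g) :
    PolyTime (fun a => f a || g a) := by
  have : PolyTime (fun a => bif f a then true else g a) := by fun_prop
  exact this.congr fun a => by cases f a <;> rfl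

@[fun_prop]
theorem PolyTime.natLt {f g : α → ℕ} (hf : PolyTime f) (hg : PolyTime g) :
    PolyTime (fun a => decide (f a < g a)) := by
  have : PolyTime (fun a => decide (f a + 1 ≤ g a)) := by fun_prop
  exact this.congr fun a => rfl

@[fun_prop]
theorem PolyTime.natEq {f g : α → ℕ} (hf : PolyTime f) (hg : PolyTime g) :
    PolyTime (fun a => decide (f a = g a)) := by
  have : PolyTime (fun a => decide (f a ≤ g a) && decide (g a ≤ f a)) := by fun_prop
  exact this.congr fun a => by
    rw [← Bool.decide_and]; exact decide_eq_decide.2 (by omega)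

end PolyTime

/-! ### Lists -/

section Lists

variable {α β γ δ : Type} [Enc α] [Enc β] [Enc γ] [Enc δ]

theorem sz_pos (a : α) : 0 < sz a := Val.size_pos _

theorem sz_prod (x : α × β) : sz x = 1 + sz x.1 + sz x.2 := rfl

theorem sz_nil : sz ([] : List α) = 1 := rfl

theorem sz_cons (a : α) (l : List α) : sz (a :: l) = 1 + sz a + sz l := rfl

theorem sz_bool_le (b : Bool) : sz b ≤ 2 := by cases b <;> decide

theorem sz_nat (n : ℕ) : sz n = 1 + n.size := rfl

theorem length_lt_sz (l : List α) : l.length < sz l := by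
  induction l with
  | nil => simp [sz_nil]
  | cons a l ih => rw [sz_cons, List.length_cons]; omega

theorem sz_le_of_mem {a : α} {l : List α} (h : a ∈ l) : sz a ≤ sz l := by
  induction l with
  | nil => simp at h
  | cons b l ih =>
    rw [sz_cons]
    rcases List.mem_cons.1 h with rfl | h
    · omega
    · have := ih h; omega

theorem sz_list_le {l : List α} {B : ℕ} (h : ∀ a ∈ l, sz a ≤ B) :
    sz l ≤ 1 + l.length * (1 + B) := by
  induction l with
  | nil => simp [sz_nil]
  | cons a l ih =>
    have h1 := ih fun a ha => h a (List.mem_cons_of_mem _ ha)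
    have h2 := h a List.mem_cons_self
    rw [sz_cons, List.length_cons]
    linarith

theorem sz_sublist {l l' : List α} (h : l.Sublist l') : sz l ≤ sz l' := by
  induction h with
  | slnil => rfl
  | cons a _ ih => rw [sz_cons]; omega
  | cons_cons a _ ih => rw [sz_cons, sz_cons]; omega

theorem sz_append (l l' : List α) : sz (l ++ l') + 1 = sz l + sz l' := by
  induction l with
  | nil => simp [sz_nil, add_comm]
  | cons a l ih => rw [List.cons_append, sz_cons, sz_cons]; omega

/-- The empty list is stored as a number and a nonempty one as the pair of head and tail, so
`isPair` is the test and the datum is already the argument of the second case. The equations for `k`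
allow functions that are defined by pattern matching. -/
theorem PolyTime.listCases {L : α → List β} {g : α → γ} {h : α → β → List β → γ} {k : α → γ}
    (hL : PolyTime L) (hg : PolyTime g) (hh : PolyTime fun p : α × β × List β => h p.1 p.2.1 p.2.2)
    (hnil : ∀ a, L a = [] → k a = g a) (hcons : ∀ a b l, L a = b :: l → k a = h a b l) :
    PolyTime k := by
  obtain ⟨R, hR⟩ := hL.polySize
  obtain ⟨p, hp, P, h1⟩ := hL
  obtain ⟨q, hq, Q, h2⟩ := hg
  obtain ⟨r, hr, S, h3⟩ := hh
  refine ⟨.ite (.comp (.prim .isPair) p) (.comp r (.pair (.prim .id) p)) q,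
    ⟨⟨trivial, hp⟩, ⟨hr, trivial, hp⟩, hq⟩,
    1 + Polynomial.X + (1 + P + (1 + R) ^ 2) + Q +
      (1 + (1 + Polynomial.X + (1 + Polynomial.X) ^ 2 + P) + S.comp (1 + Polynomial.X + R)),
    fun O a => ?_⟩
  obtain ⟨t1, ht1, hle1⟩ := h1 O a
  have hpair : Eval O (.comp (.prim .isPair) p) (enc a) _ _ := ht1.comp (Eval.prim .isPair _)
  have hsq : (1 + sz (L a)) ^ 2 ≤ (1 + R.eval (sz a)) ^ 2 :=
    Nat.pow_le_pow_left (Nat.add_le_add_left (hR a) 1) 2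
  cases hLa : L a with
  | nil =>
    obtain ⟨t2, ht2, hle2⟩ := h2 O a
    rw [hnil a hLa]
    have : Prim.isPair.run (enc (L a)) = .nat 0 := by rw [hLa]; rfl
    rw [this] at hpair
    refine ⟨_, Eval.iteFalse hpair ht2, ?_⟩
    simp
    change 1 + sz a + (1 + t1 + (1 + sz (L a)) ^ 2) + t2 ≤ _
    omega
  | cons b l =>
    obtain ⟨t3, ht3, hle3⟩ := h3 O (a, b, l)
    rw [hcons a b l hLa]
    have : Prim.isPair.run (enc (L a)) = .nat 1 := by rw [hLa]; rfl
    rw [this] at hpair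
    have hcomp : Eval O (.pair (.prim .id) p) (enc a) (enc (a, b, l)) _ :=
      (Eval.prim .id (enc a)).pair (by rw [hLa] at ht1; exact ht1)
    refine ⟨_, Eval.iteTrue hpair (by simp) (hcomp.comp ht3), ?_⟩
    have h4 : sz (a, b, l) ≤ 1 + sz a + R.eval (sz a) := by
      have h5 := hR a
      rw [hLa] at h5
      exact Nat.add_le_add_left h5 _
    have := hle3.trans (poly_eval_mono S h4)
    simp
    change 1 + sz a + (1 + t1 + (1 + sz (L a)) ^ 2)
      + (1 + (1 + sz a + (1 + sz a) ^ 2 + t1) + t3) ≤ _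
    omega

@[fun_prop]
theorem PolyTime.cons {f : α → β} {L : α → List β} (hf : PolyTime f) (hL : PolyTime L) :
    PolyTime (fun a => f a :: L a) :=
  PolyTime.of_enc_eq (hf.prodMk hL) (fun a => a) (fun _ => rfl) (fun _ => rfl)

@[fun_prop]
theorem PolyTime.tail {L : α → List β} (hL : PolyTime L) : PolyTime (fun a => (L a).tail) :=
  PolyTime.listCases (g := fun _ => []) (h := fun _ _ l => l) hL (by fun_prop) (by fun_prop)
    (fun a h => by simp [h]) (fun a b l h => by simp [h])

@[fun_prop]
theorem PolyTime.headD {L : α → List β} {d : α → β} (hL : PolyTime L) (hd : PolyTime d) :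
    PolyTime (fun a => (L a).headD (d a)) :=
  PolyTime.listCases (g := d) (h := fun _ b _ => b) hL (by fun_prop) (by fun_prop)
    (fun a h => by simp [h]) (fun a b l h => by simp [h])

@[fun_prop]
theorem PolyTime.isEmpty {L : α → List β} (hL : PolyTime L) : PolyTime (fun a => (L a).isEmpty) :=
  PolyTime.listCases (g := fun _ => true) (h := fun _ _ _ => false) hL (by fun_prop) (by fun_prop)
    (fun a h => by simp [h]) (fun a b l h => by simp [h])

/-- One round of a fold over a list, with a parameter. -/
def foldStep {α β γ : Type} (step : α → γ → β → γ) (x : α × γ × List β) : α × γ × List β :=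
  match x.2.2 with
  | [] => x
  | b :: l => (x.1, step x.1 x.2.1 b, l)

theorem foldStep_iterate {α β γ : Type} (step : α → γ → β → γ) (a : α) (s : γ) (l : List β) (k : ℕ)
    (hk : k ≤ l.length) :
    (foldStep step)^[k] (a, s, l) = (a, (l.take k).foldl (step a) s, l.drop k) := by
  induction k generalizing s l with
  | zero => simp
  | succ k ih =>
    cases l with
    | nil => simp at hk
    | cons b l =>
      rw [Function.iterate_succ_apply]
      simpa [foldStep] using ih (step a s b) l (by simpa using hk)

/-- A polynomial-time step alone is not enough, as repeated squaring shows. The accumulator has to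
be bounded after every prefix of the list. -/
theorem PolyTime.foldl_of_bound {L : α → List β} {init : α → γ} {step : α → γ → β → γ}
    (hL : PolyTime L) (hinit : PolyTime init)
    (hstep : PolyTime fun p : α × γ × β => step p.1 p.2.1 p.2.2)
    (hsize : ∃ P : Polynomial ℕ, ∀ a, ∀ l, l <+: L a →
      sz (l.foldl (step a) (init a)) ≤ P.eval (sz a)) :
    PolyTime fun a => (L a).foldl (step a) (init a) := by
  obtain ⟨P, hP⟩ := hsize
  obtain ⟨R, hR⟩ := hL.polySize
  have hs : PolyTime (foldStep step) := by
    refine PolyTime.listCases (L := fun x : α × γ × List β => x.2.2) (g := fun x => x)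
      (h := fun x b l => (x.1, step x.1 x.2.1 b, l)) (by fun_prop) (by fun_prop) ?_
      (fun x h => ?_) (fun x b l h => ?_)
    · have h : PolyTime fun p : (α × γ × List β) × β × List β =>
          (fun q : α × γ × β => step q.1 q.2.1 q.2.2) (p.1.1, p.1.2.1, p.2.1) :=
        PolyTime.comp hstep (by fun_prop)
      fun_prop
    · simp [foldStep, h]
    · simp [foldStep, h]
  have key := PolyTime.iterate_while (init := fun a => (a, init a, L a))
    (c := fun x : α × γ × List β => !x.2.2.isEmpty) (step := foldStep step)
    (fun a => (L a).length) (by fun_prop) (by fun_prop) hs ?_ ?_ ?_ ?_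
  · refine (PolyTime.fst (PolyTime.snd key)).congr fun a => ?_
    simp [foldStep_iterate _ _ _ _ _ le_rfl]
  · intro a k hk
    simp [foldStep_iterate _ _ _ _ _ hk.le, hk]
  · intro a
    simp [foldStep_iterate _ _ _ _ _ le_rfl]
  · exact ⟨R, fun a => (length_lt_sz _).le.trans (hR a)⟩
  · refine ⟨1 + Polynomial.X + (1 + P + R), fun a k hk => ?_⟩
    rw [foldStep_iterate _ _ _ _ _ hk, sz_prod, sz_prod]
    have h1 := hP a _ (List.take_prefix k (L a))
    have h2 := (sz_sublist (List.drop_sublist k (L a))).trans (hR a)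
    simp
    omega

/-- If a step adds to `μ` an amount that does not depend on the accumulator, the growth over all
rounds is at most the number of rounds times this amount. A measure other than the size is needed
for rational numbers. -/
theorem PolyTime.foldl_of_measure {L : α → List β} {init : α → γ} {step : α → γ → β → γ}
    (μ : γ → ℕ) (K : ℕ) (hL : PolyTime L) (hinit : PolyTime init)
    (hstep : PolyTime fun p : α × γ × β => step p.1 p.2.1 p.2.2)
    (hμ : ∀ s, μ s ≤ sz s) (hK : ∀ s, sz s ≤ K * μ s)
    (hsize : ∃ P : Polynomial ℕ, ∀ a s b, μ (step a s b) ≤ μ s + P.eval (sz a + sz b)) :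
    PolyTime fun a => (L a).foldl (step a) (init a) := by
  refine PolyTime.foldl_of_bound hL hinit hstep ?_
  obtain ⟨P, hP⟩ := hsize
  obtain ⟨R, hR⟩ := hL.polySize
  obtain ⟨I, hI⟩ := hinit.polySize
  refine ⟨Polynomial.C K * (I + R * P.comp (Polynomial.X + R)), fun a l hl => ?_⟩
  have key : ∀ (l' : List β) s, l'.Sublist (L a) →
      μ (l'.foldl (step a) s) ≤ μ s + l'.length * P.eval (sz a + sz (L a)) := by
    intro l' s h
    induction l' generalizing s with
    | nil => simp
    | cons b l' ih =>
      have h1 := ih (step a s b) ((List.sublist_cons_self b l').trans h)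
      have h2 := hP a s b
      have h3 := poly_eval_mono P (Nat.add_le_add_left
        (sz_le_of_mem (h.subset List.mem_cons_self)) (sz a))
      rw [List.foldl_cons, List.length_cons]
      linarith
  have h1 := key l (init a) hl.sublist
  have h2 := (hμ _).trans (hI a)
  have h3 : l.length ≤ R.eval (sz a) :=
    (hl.sublist.length_le).trans ((length_lt_sz _).le.trans (hR a))
  have h4 := poly_eval_mono P (Nat.add_le_add_left (hR a) (sz a))
  have h5 := Nat.mul_le_mul h3 h4
  refine (hK _).trans ?_
  simp only [Polynomial.eval_mul, Polynomial.eval_C, Polynomial.eval_add, Polynomial.eval_comp,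
    Polynomial.eval_X]
  exact Nat.mul_le_mul_left K (by omega)

theorem PolyTime.foldl {L : α → List β} {init : α → γ} {step : α → γ → β → γ}
    (hL : PolyTime L) (hinit : PolyTime init)
    (hstep : PolyTime fun p : α × γ × β => step p.1 p.2.1 p.2.2)
    (hsize : ∃ P : Polynomial ℕ, ∀ a s b, sz (step a s b) ≤ sz s + P.eval (sz a + sz b)) :
    PolyTime fun a => (L a).foldl (step a) (init a) :=
  PolyTime.foldl_of_measure sz 1 hL hinit hstep (fun _ => le_rfl) (fun s => by simp) hsize

@[fun_prop]
theorem PolyTime.reverse {L : α → List β} (hL : PolyTime L) : PolyTime (fun a => (L a).reverse) := by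
  have h := PolyTime.foldl (step := fun (_ : α) (s : List β) b => b :: s) hL
    (PolyTime.const []) (by fun_prop)
    ⟨1 + Polynomial.X, fun a s b => by rw [sz_cons]; simp; omega⟩
  exact h.congr fun a => by simp

@[fun_prop]
theorem PolyTime.append {L M : α → List β} (hL : PolyTime L) (hM : PolyTime M) :
    PolyTime (fun a => L a ++ M a) := by
  have h := PolyTime.foldl (step := fun (_ : α) (s : List β) b => b :: s) hL.reverse
    hM (by fun_prop)
    ⟨1 + Polynomial.X, fun a s b => by rw [sz_cons]; simp; omega⟩
  exact h.congr fun a => by simp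

theorem foldl_append_eq_flatMap {β γ : Type} (f : β → List γ) (l : List β) (s : List γ) :
    l.foldl (fun s b => s ++ f b) s = s ++ l.flatMap f := by
  induction l generalizing s with
  | nil => simp
  | cons b l ih => simp [ih]

@[fun_prop]
theorem PolyTime.flatMap {L : α → List β} {f : α → β → List γ} (hL : PolyTime L)
    (hf : PolyTime fun p : α × β => f p.1 p.2) :
    PolyTime (fun a => (L a).flatMap (fun b => f a b)) := by
  obtain ⟨F, hF⟩ := hf.polySize
  have hf' : PolyTime fun p : α × List γ × β => (fun q : α × β => f q.1 q.2) (p.1, p.2.2) :=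
    PolyTime.comp hf (by fun_prop)
  have h := PolyTime.foldl (step := fun (a : α) (s : List γ) b => s ++ f a b) hL
    (PolyTime.const []) (by fun_prop)
    ⟨F.comp (1 + Polynomial.X), fun a s b => by
      have h1 := sz_append s (f a b)
      have h2 := hF (a, b)
      rw [sz_prod] at h2
      simp only [Polynomial.eval_comp, Polynomial.eval_add, Polynomial.eval_one, Polynomial.eval_X,
        ← add_assoc] at *
      omega⟩
  exact h.congr fun a => by rw [foldl_append_eq_flatMap, List.nil_append]

@[fun_prop]
theorem PolyTime.map {L : α → List β} {f : α → β → γ} (hL : PolyTime L)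
    (hf : PolyTime fun p : α × β => f p.1 p.2) :
    PolyTime (fun a => (L a).map (fun b => f a b)) := by
  have h : PolyTime (fun a => (L a).flatMap (fun b => [f a b])) := by fun_prop
  exact h.congr fun a => by
    induction L a with
    | nil => rfl
    | cons b l ih => rw [List.flatMap_cons, ← ih]; rfl

@[fun_prop]
theorem PolyTime.filter {L : α → List β} {f : α → β → Bool} (hL : PolyTime L)
    (hf : PolyTime fun p : α × β => f p.1 p.2) :
    PolyTime (fun a => (L a).filter (fun b => f a b)) := by
  have h : PolyTime (fun a => (L a).flatMap (fun b => bif f a b then [b] else [])) := by fun_prop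
  exact h.congr fun a => by
    induction L a with
    | nil => rfl
    | cons b l ih => rw [List.flatMap_cons, ← ih]; cases h : f a b <;> simp [h]

@[fun_prop]
theorem PolyTime.all {L : α → List β} {f : α → β → Bool} (hL : PolyTime L)
    (hf : PolyTime fun p : α × β => f p.1 p.2) :
    PolyTime (fun a => (L a).all (fun b => f a b)) := by
  have h : PolyTime (fun a => ((L a).filter (fun b => !f a b)).isEmpty) := by fun_prop
  exact h.congr fun a => by
    induction L a with
    | nil => rfl
    | cons b l ih => cases h : f a b <;> simp [h, ih]

@[fun_prop]
theorem PolyTime.any {L : α → List β} {f : α → β → Bool} (hL : PolyTime L)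
    (hf : PolyTime fun p : α × β => f p.1 p.2) :
    PolyTime (fun a => (L a).any (fun b => f a b)) := by
  have h : PolyTime (fun a => !(L a).all (fun b => !f a b)) := by fun_prop
  exact h.congr fun a => by simp [List.all_eq_not_any_not]

@[fun_prop]
theorem PolyTime.natMem {L : α → List ℕ} {f : α → ℕ} (hL : PolyTime L)
    (hf : PolyTime f) : PolyTime (fun a => decide (f a ∈ L a)) := by
  have h : PolyTime (fun a => (L a).any (fun b => decide (b = f a))) := by fun_prop
  exact h.congr fun a => by rw [Bool.eq_iff_iff]; simp

@[fun_prop]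
theorem PolyTime.natSum {L : α → List β} {f : α → β → ℕ} (hL : PolyTime L)
    (hf : PolyTime fun p : α × β => f p.1 p.2) :
    PolyTime (fun a => ((L a).map (fun b => f a b)).sum) := by
  have h := PolyTime.foldl (step := fun (_ : α) (s b : ℕ) => s + b) (hL.map hf)
    (PolyTime.const 0) (by fun_prop)
    ⟨1 + Polynomial.X, fun a s b => by
      have := size_add_le s b
      simp [sz_nat]
      omega⟩
  exact h.congr fun a => by rw [List.sum_eq_foldl]

@[fun_prop]
theorem PolyTime.natProd {L : α → List β} {f : α → β → ℕ} (hL : PolyTime L)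
    (hf : PolyTime fun p : α × β => f p.1 p.2) :
    PolyTime (fun a => ((L a).map (fun b => f a b)).prod) := by
  have h := PolyTime.foldl (step := fun (_ : α) (s b : ℕ) => s * b) (hL.map hf)
    (PolyTime.const 1) (by fun_prop)
    ⟨1 + Polynomial.X, fun a s b => by
      have := size_mul_le s b
      simp [sz_nat]
      omega⟩
  exact h.congr fun a => by rw [List.prod_eq_foldl]

@[fun_prop]
theorem PolyTime.length {L : α → List β} (hL : PolyTime L) : PolyTime (fun a => (L a).length) := by
  have h : PolyTime (fun a => ((L a).map (fun _ => 1)).sum) := by fun_prop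
  exact h.congr fun a => by simp

@[fun_prop]
theorem PolyTime.getD {L : α → List β} {i : α → ℕ} {d : α → β} (hL : PolyTime L)
    (hi : PolyTime i) (hd : PolyTime d) : PolyTime (fun a => (L a).getD (i a) (d a)) := by
  have h := PolyTime.foldl
    (step := fun (a : α) (s : ℕ × β) b => (s.1 + 1, bif decide (s.1 = i a) then b else s.2)) hL
    (init := fun a => (0, d a)) (by fun_prop) (by fun_prop)
    ⟨2 + Polynomial.X, fun a s b => by
      have := size_add_le s.1 1
      rw [sz_prod, sz_prod, sz_nat, sz_nat]
      cases decide (s.1 = i a) <;> simp at * <;> omega⟩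
  refine h.snd.congr fun a => ?_
  have key : ∀ (l : List β) (k : ℕ) (d : β), (l.foldl (fun (s : ℕ × β) b =>
      (s.1 + 1, bif decide (s.1 = i a) then b else s.2)) (k, d)).2 =
        if k ≤ i a then l.getD (i a - k) d else d := by
    intro l
    induction l with
    | nil => simp
    | cons b l ih =>
      intro k d
      rw [List.foldl_cons, ih]
      rcases lt_trichotomy k (i a) with h | h | h
      · obtain ⟨m, hm⟩ : ∃ m, i a - k = m + 1 := ⟨i a - k - 1, by omega⟩
        rw [if_pos (by omega), if_pos (by omega), hm, List.getD_cons_succ,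
          show i a - (k + 1) = m by omega]
        simp [h.ne]
      · simp [h]
      · rw [if_neg (by omega), if_neg (by omega)]
        simp [h.ne']
  rw [key]
  simp

end Lists

/-! ### Integers and rational numbers -/

instance : Enc ℤ := ⟨Val.int⟩
instance : Enc ℚ := ⟨Val.rat⟩

/-- The number of steps of the Euclidean algorithm. -/
def euclidSteps (a b : ℕ) : ℕ :=
  if h : b = 0 then 0 else euclidSteps b (a % b) + 1
termination_by b
decreasing_by exact Nat.mod_lt _ (Nat.pos_of_ne_zero h)

theorem euclidSteps_zero (a : ℕ) : euclidSteps a 0 = 0 := by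
  rw [euclidSteps]; simp

theorem euclidSteps_of_ne {a b : ℕ} (h : b ≠ 0) : euclidSteps a b = euclidSteps b (a % b) + 1 := by
  rw [euclidSteps]; simp [h]

/-- Two steps replace `b` by `b % (a % b)`, which is less than `b / 2`, so every two rounds remove a
bit. -/
theorem euclidSteps_le (a b : ℕ) : euclidSteps a b ≤ 2 * b.size := by
  induction b using Nat.strong_induction_on generalizing a with
  | _ b ih =>
    by_cases hb : b = 0
    · simp [hb, euclidSteps_zero]
    have hpos : 0 < b.size := Nat.size_pos.2 (Nat.pos_of_ne_zero hb)
    rw [euclidSteps_of_ne hb]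
    by_cases hr : a % b = 0
    · rw [hr, euclidSteps_zero]; omega
    have hlt : a % b < b := Nat.mod_lt _ (Nat.pos_of_ne_zero hb)
    have hlt' : b % (a % b) < a % b := Nat.mod_lt _ (Nat.pos_of_ne_zero hr)
    rw [euclidSteps_of_ne hr]
    have h1 := ih (b % (a % b)) (by omega) (a % b)
    have h2 : 2 * (b % (a % b)) < b := by
      have h3 := Nat.div_add_mod b (a % b)
      have h4 : 1 ≤ b / (a % b) := Nat.div_pos hlt.le (Nat.pos_of_ne_zero hr)
      nlinarith
    have h3 : (b % (a % b)).size ≤ b.size - 1 := by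
      rw [Nat.size_le]
      have h5 := Nat.lt_size_self b
      rw [show b.size = b.size - 1 + 1 by omega, pow_succ] at h5
      omega
    omega

/-- One step of the Euclidean algorithm. -/
def euclidStep (x : ℕ × ℕ) : ℕ × ℕ := (x.2, x.1 % x.2)

theorem euclidStep_iterate (k : ℕ) (a b : ℕ) (hk : k ≤ euclidSteps a b) :
    ∃ c d, euclidStep^[k] (a, b) = (c, d) ∧ c.gcd d = a.gcd b ∧ max c d ≤ max a b ∧
      euclidSteps c d + k = euclidSteps a b := by
  induction k generalizing a b with
  | zero => exact ⟨a, b, rfl, rfl, le_rfl, rfl⟩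
  | succ k ih =>
    have hb : b ≠ 0 := by
      rintro rfl
      simp [euclidSteps_zero] at hk
    have hs := euclidSteps_of_ne (a := a) hb
    obtain ⟨c, d, h1, h2, h3, h4⟩ := ih b (a % b) (by omega)
    refine ⟨c, d, h1, ?_, h3.trans ?_, by omega⟩
    · rw [h2, Nat.gcd_comm, ← Nat.gcd_rec, Nat.gcd_comm]
    · have := (Nat.mod_lt a (Nat.pos_of_ne_zero hb)).le
      omega

section Arithmetic

variable {α β γ : Type} [Enc α] [Enc β] [Enc γ]

@[fun_prop]
theorem PolyTime.natGcd {f g : α → ℕ} (hf : PolyTime f) (hg : PolyTime g) :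
    PolyTime (fun a => (f a).gcd (g a)) := by
  suffices h : PolyTime (fun x : ℕ × ℕ => x.1.gcd x.2) by
    exact PolyTime.comp (f := fun x : ℕ × ℕ => x.1.gcd x.2) h (hf.prodMk hg)
  have key := PolyTime.iterate_while (init := fun x : ℕ × ℕ => x)
    (c := fun x : ℕ × ℕ => !decide (x.2 = 0)) (step := euclidStep)
    (fun x => euclidSteps x.1 x.2) (by fun_prop) (by fun_prop) (by unfold euclidStep; fun_prop)
    ?_ ?_ ?_ ?_
  · refine key.fst.congr fun x => ?_
    obtain ⟨c, d, h1, h2, h3, h4⟩ := euclidStep_iterate _ x.1 x.2 le_rfl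
    have hd : d = 0 := by
      by_contra h
      rw [euclidSteps_of_ne h] at h4
      omega
    rw [h1, ← h2, hd]
    simp
  · intro x k hk
    obtain ⟨c, d, h1, h2, h3, h4⟩ := euclidStep_iterate k x.1 x.2 hk.le
    rw [h1]
    have hd : d ≠ 0 := by
      rintro rfl
      rw [euclidSteps_zero] at h4
      omega
    simp [hd]
  · intro x
    obtain ⟨c, d, h1, h2, h3, h4⟩ := euclidStep_iterate _ x.1 x.2 le_rfl
    rw [h1]
    by_contra h
    rw [euclidSteps_of_ne (by simpa using h)] at h4
    omega
  · refine ⟨2 * Polynomial.X, fun x => (euclidSteps_le _ _).trans ?_⟩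
    simp [sz_prod, sz_nat]
    omega
  · refine ⟨2 * Polynomial.X, fun x k hk => ?_⟩
    obtain ⟨c, d, h1, h2, h3, h4⟩ := euclidStep_iterate k x.1 x.2 hk
    rw [h1]
    have hsz : ∀ y, y ≤ max x.1 x.2 → y.size ≤ x.1.size + x.2.size := fun y hy => by
      rcases le_max_iff.1 hy with h | h
      · exact (Nat.size_le_size h).trans (by omega)
      · exact (Nat.size_le_size h).trans (by omega)
    have h5 := hsz c (by omega)
    have h6 := hsz d (by omega)
    simp [sz_prod, sz_nat]
    omega

@[fun_prop]
theorem PolyTime.natAbs {f : α → ℤ} (hf : PolyTime f) : PolyTime (fun a => (f a).natAbs) :=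
  PolyTime.comp (f := fun z : ℤ => z.natAbs) (.of_prim .snd fun _ => rfl) hf

@[fun_prop]
theorem PolyTime.intLtZero {f : α → ℤ} (hf : PolyTime f) : PolyTime (fun a => decide (f a < 0)) :=
  PolyTime.comp (f := fun z : ℤ => decide (z < 0))
    (.of_prim .fst fun z => by by_cases h : z < 0 <;> simp [enc, Val.int, Prim.run, h]) hf

@[fun_prop]
theorem PolyTime.toNat {f : α → ℤ} (hf : PolyTime f) : PolyTime (fun a => (f a).toNat) := by
  have h : PolyTime (fun a => bif decide (f a < 0) then 0 else (f a).natAbs) := by fun_prop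
  exact h.congr fun a => by by_cases h : f a < 0 <;> simp [h] <;> omega

@[fun_prop]
theorem PolyTime.toNat_neg {f : α → ℤ} (hf : PolyTime f) : PolyTime (fun a => (-f a).toNat) := by
  have h : PolyTime (fun a => bif decide (f a < 0) then (f a).natAbs else 0) := by fun_prop
  exact h.congr fun a => by by_cases h : f a < 0 <;> simp [h] <;> omega

/-- Reduces integer arithmetic to natural numbers: with truncated subtraction, the absolute value of
the difference is `(g - h) + (h - g)`. -/
theorem PolyTime.int_of_sub {f : α → ℤ} {g h : α → ℕ} (hg : PolyTime g) (hh : PolyTime h)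
    (heq : ∀ a, f a = g a - h a) : PolyTime f := by
  have k : PolyTime (fun a => (decide (g a < h a), (g a - h a) + (h a - g a))) := by fun_prop
  refine PolyTime.of_enc_eq k (fun a => a) (fun _ => rfl) fun a => ?_
  rw [heq]
  have h2 : ((g a : ℤ) - h a).natAbs = (g a - h a) + (h a - g a) := by omega
  by_cases hlt : g a < h a
  · have h1 : (g a : ℤ) - h a < 0 := by omega
    simp only [enc, Val.int, h1, h2, hlt, if_true, decide_true, Bool.toNat_true]
  · have h1 : ¬ (g a : ℤ) - h a < 0 := by omega
    simp only [enc, Val.int, h1, h2, hlt, if_false, decide_false, Bool.toNat_false]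

@[fun_prop]
theorem PolyTime.intCast {f : α → ℕ} (hf : PolyTime f) : PolyTime (fun a => (f a : ℤ)) :=
  PolyTime.int_of_sub hf (PolyTime.const 0) (by simp)

@[fun_prop]
theorem PolyTime.intNeg {f : α → ℤ} (hf : PolyTime f) : PolyTime (fun a => -f a) :=
  PolyTime.int_of_sub hf.toNat_neg hf.toNat (fun a => by omega)

@[fun_prop]
theorem PolyTime.intAdd {f g : α → ℤ} (hf : PolyTime f) (hg : PolyTime g) :
    PolyTime (fun a => f a + g a) :=
  PolyTime.int_of_sub (hf.toNat.natAdd hg.toNat) (hf.toNat_neg.natAdd hg.toNat_neg)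
    (fun a => by push_cast; omega)

@[fun_prop]
theorem PolyTime.intMul {f g : α → ℤ} (hf : PolyTime f) (hg : PolyTime g) :
    PolyTime (fun a => f a * g a) :=
  PolyTime.int_of_sub
    ((hf.toNat.natMul hg.toNat).natAdd (hf.toNat_neg.natMul hg.toNat_neg))
    ((hf.toNat.natMul hg.toNat_neg).natAdd (hf.toNat_neg.natMul hg.toNat)) (fun a => by
      push_cast
      nth_rewrite 1 [show f a = (f a).toNat - ((-f a).toNat : ℤ) by omega,
        show g a = (g a).toNat - ((-g a).toNat : ℤ) by omega]
      ring)

@[fun_prop]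
theorem PolyTime.ratNum {f : α → ℚ} (hf : PolyTime f) : PolyTime (fun a => (f a).num) :=
  PolyTime.comp (f := fun q : ℚ => q.num) (.of_prim .fst fun _ => rfl) hf

@[fun_prop]
theorem PolyTime.ratDen {f : α → ℚ} (hf : PolyTime f) : PolyTime (fun a => (f a).den) :=
  PolyTime.comp (f := fun q : ℚ => q.den) (.of_prim .snd fun _ => rfl) hf

-- A rational number is stored as its reduced fraction, so this normalization, through the Euclidean
-- algorithm, is what the rational operations rest on.
@[fun_prop]
theorem PolyTime.mkRat {f : α → ℤ} {g : α → ℕ} (hf : PolyTime f) (hg : PolyTime g) :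
    PolyTime (fun a => mkRat (f a) (g a)) := by
  have hnum : PolyTime (fun a => (_root_.mkRat (f a) (g a)).num) := by
    refine PolyTime.int_of_sub
      (g := fun a => bif decide (g a = 0) then 0 else (f a).toNat / (g a).gcd (f a).natAbs)
      (h := fun a => bif decide (g a = 0) then 0 else (-f a).toNat / (g a).gcd (f a).natAbs)
      (by fun_prop) (by fun_prop) fun a => ?_
    rw [Rat.num_mkRat]
    by_cases h0 : g a = 0
    · simp [h0]
    obtain ⟨k, hk⟩ : (((g a).gcd (f a).natAbs : ℕ) : ℤ) ∣ f a := by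
      rw [← Int.dvd_natAbs]
      exact_mod_cast Nat.gcd_dvd_right _ _
    have hpos : 0 < (g a).gcd (f a).natAbs := Nat.gcd_pos_of_pos_left _ (Nat.pos_of_ne_zero h0)
    generalize (g a).gcd (f a).natAbs = d at *
    simp only [h0, decide_false, cond_false, if_false]
    have hd : (d : ℤ) ≠ 0 := by omega
    rw [hk, Int.mul_ediv_cancel_left _ hd]
    rcases le_total 0 k with h | h
    · lift k to ℕ using h
      have h1 : ((d : ℤ) * k).toNat = d * k := by
        rw [← Nat.cast_mul, Int.toNat_natCast]
      have h2 : (-((d : ℤ) * k)).toNat = 0 := by rw [← Nat.cast_mul]; omega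
      simp [h1, h2, Nat.mul_div_cancel_left _ hpos]
    · obtain ⟨m, rfl⟩ : ∃ m : ℕ, k = -m := ⟨k.natAbs, by omega⟩
      have h1 : ((d : ℤ) * -m).toNat = 0 := by rw [mul_neg, ← Nat.cast_mul]; omega
      have h2 : (-((d : ℤ) * -m)).toNat = d * m := by
        rw [mul_neg, neg_neg, ← Nat.cast_mul, Int.toNat_natCast]
      rw [h1, h2, Nat.mul_div_cancel_left _ hpos]
      simp
  have hden : PolyTime (fun a => (_root_.mkRat (f a) (g a)).den) := by
    have : PolyTime (fun a => bif decide (g a = 0) then 1 else g a / (g a).gcd (f a).natAbs) := by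
      fun_prop
    exact this.congr fun a => by
      rw [Rat.den_mkRat]
      by_cases h0 : g a = 0 <;> simp [h0]
  exact PolyTime.of_enc_eq (hnum.prodMk hden) (fun a => a) (fun _ => rfl) (fun _ => rfl)

@[fun_prop]
theorem PolyTime.ratCast {f : α → ℕ} (hf : PolyTime f) : PolyTime (fun a => (f a : ℚ)) := by
  have h : PolyTime (fun a => _root_.mkRat (f a : ℤ) 1) := by fun_prop
  exact h.congr fun a => by simp [Rat.mkRat_eq_div]

@[fun_prop]
theorem PolyTime.ratAdd {f g : α → ℚ} (hf : PolyTime f) (hg : PolyTime g) :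
    PolyTime (fun a => f a + g a) := by
  have h : PolyTime (fun a => _root_.mkRat ((f a).num * ((g a).den : ℤ) +
    (g a).num * ((f a).den : ℤ)) ((f a).den * (g a).den)) := by fun_prop
  exact h.congr fun a => Rat.add_def' _ _

@[fun_prop]
theorem PolyTime.ratMul {f g : α → ℚ} (hf : PolyTime f) (hg : PolyTime g) :
    PolyTime (fun a => f a * g a) := by
  have h : PolyTime (fun a => _root_.mkRat ((f a).num * (g a).num) ((f a).den * (g a).den)) := by
    fun_prop
  exact h.congr fun a => Rat.mul_def' _ _

@[fun_prop]
theorem PolyTime.ratNeg {f : α → ℚ} (hf : PolyTime f) : PolyTime (fun a => -f a) := by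
  have h : PolyTime (fun a => _root_.mkRat (-(f a).num) (f a).den) := by fun_prop
  exact h.congr fun a => by rw [← Rat.neg_mkRat, Rat.mkRat_self]

@[fun_prop]
theorem PolyTime.ratSub {f g : α → ℚ} (hf : PolyTime f) (hg : PolyTime g) :
    PolyTime (fun a => f a - g a) := by
  have h : PolyTime (fun a => f a + -g a) := by fun_prop
  exact h.congr fun a => sub_eq_add_neg _ _

@[fun_prop]
theorem PolyTime.ratInv {f : α → ℚ} (hf : PolyTime f) : PolyTime (fun a => (f a)⁻¹) := by
  have h : PolyTime (fun a => bif decide ((f a).num < 0) then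
    -_root_.mkRat ((f a).den : ℤ) (f a).num.natAbs
    else _root_.mkRat ((f a).den : ℤ) (f a).num.natAbs) := by fun_prop
  refine h.congr fun a => ?_
  simp only [Rat.mkRat_eq_div]
  nth_rewrite 1 [← Rat.num_div_den (f a)]
  rw [inv_div]
  by_cases hlt : (f a).num < 0
  · have : (((f a).num.natAbs : ℕ) : ℚ) = -((f a).num : ℚ) := by
      rw [← Int.cast_natCast, Int.ofNat_natAbs_of_nonpos hlt.le, Int.cast_neg]
    simp [hlt, this, div_neg]
  · have : (((f a).num.natAbs : ℕ) : ℚ) = ((f a).num : ℚ) := by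
      rw [← Int.cast_natCast, Int.natAbs_of_nonneg (by omega)]
    simp [hlt, this]

@[fun_prop]
theorem PolyTime.ratDiv {f g : α → ℚ} (hf : PolyTime f) (hg : PolyTime g) :
    PolyTime (fun a => f a / g a) := by
  have h : PolyTime (fun a => f a * (g a)⁻¹) := by fun_prop
  exact h.congr fun a => div_eq_mul_inv _ _

/-- The bit length of the numerator or the denominator, whichever is larger, up to a constant. -/
def ratHeight (q : ℚ) : ℕ := 3 + max q.num.natAbs.size q.den.size

theorem sz_rat (q : ℚ) : sz q = 5 + (if q.num < 0 then 1 else 0) + q.num.natAbs.size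
    + q.den.size := by
  simp only [sz, enc, Val.rat, Val.int, Val.size]
  split_ifs <;> simp <;> omega

theorem ratHeight_le_sz (q : ℚ) : ratHeight q ≤ sz q := by
  rw [sz_rat, ratHeight]; omega

theorem sz_le_ratHeight (q : ℚ) : sz q ≤ 2 * ratHeight q := by
  rw [sz_rat, ratHeight]; split_ifs <;> omega

theorem natAbs_num_mkRat_le (z : ℤ) (d : ℕ) : (mkRat z d).num.natAbs ≤ z.natAbs := by
  rw [Rat.num_mkRat]
  split_ifs
  · simp
  · exact Int.natAbs_ediv_le_natAbs _ _

theorem den_mkRat_le (z : ℤ) {d : ℕ} (hd : d ≠ 0) : (mkRat z d).den ≤ d := by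
  rw [Rat.den_mkRat, if_neg hd]
  exact Nat.div_le_self _ _

theorem size_add_le_max (a b : ℕ) : (a + b).size ≤ max a.size b.size + 1 := by
  rw [Nat.size_le, pow_succ]
  have h1 := (Nat.lt_size_self a).trans_le
    (Nat.pow_le_pow_right (by omega : 0 < 2) (le_max_left a.size b.size))
  have h2 := (Nat.lt_size_self b).trans_le
    (Nat.pow_le_pow_right (by omega : 0 < 2) (le_max_right a.size b.size))
  omega

/-- The total size of numerator and denominator could double under addition, since the new numerator
involves the denominator of `q`. The maximum of the two bit lengths grows only by the size of `r`.
-/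
theorem ratHeight_add_le (q r : ℚ) : ratHeight (q + r) ≤ ratHeight q + sz r := by
  rw [Rat.add_def', sz_rat]
  have h1 := Nat.size_le_size (natAbs_num_mkRat_le (q.num * r.den + r.num * q.den) (q.den * r.den))
  have h2 := Nat.size_le_size (den_mkRat_le (q.num * r.den + r.num * q.den)
    (mul_ne_zero q.den_ne_zero r.den_ne_zero))
  have h3 := Nat.size_le_size (Int.natAbs_add_le (q.num * r.den) (r.num * q.den))
  rw [Int.natAbs_mul, Int.natAbs_mul, Int.natAbs_natCast, Int.natAbs_natCast] at h3
  have h4 := size_add_le_max (q.num.natAbs * r.den) (r.num.natAbs * q.den)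
  have h5 := size_mul_le q.num.natAbs r.den
  have h6 := size_mul_le r.num.natAbs q.den
  have h7 := size_mul_le q.den r.den
  simp only [ratHeight]
  omega

theorem ratHeight_mul_le (q r : ℚ) : ratHeight (q * r) ≤ ratHeight q + sz r := by
  rw [Rat.mul_def', sz_rat]
  have h1 := Nat.size_le_size (natAbs_num_mkRat_le (q.num * r.num) (q.den * r.den))
  have h2 := Nat.size_le_size (den_mkRat_le (q.num * r.num)
    (mul_ne_zero q.den_ne_zero r.den_ne_zero))
  rw [Int.natAbs_mul] at h1
  have h5 := size_mul_le q.num.natAbs r.num.natAbs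
  have h7 := size_mul_le q.den r.den
  simp only [ratHeight]
  omega

@[fun_prop]
theorem PolyTime.ratSum {L : α → List β} {f : α → β → ℚ} (hL : PolyTime L)
    (hf : PolyTime fun p : α × β => f p.1 p.2) :
    PolyTime (fun a => ((L a).map (fun b => f a b)).sum) := by
  have h := PolyTime.foldl_of_measure (step := fun (_ : α) (s b : ℚ) => s + b) ratHeight 2
    (hL.map hf) (PolyTime.const 0) (by fun_prop) ratHeight_le_sz sz_le_ratHeight
    ⟨Polynomial.X, fun a s b => (ratHeight_add_le s b).trans (by simp)⟩
  exact h.congr fun a => by rw [List.sum_eq_foldl]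

@[fun_prop]
theorem PolyTime.ratProd {L : α → List β} {f : α → β → ℚ} (hL : PolyTime L)
    (hf : PolyTime fun p : α × β => f p.1 p.2) :
    PolyTime (fun a => ((L a).map (fun b => f a b)).prod) := by
  have h := PolyTime.foldl_of_measure (step := fun (_ : α) (s b : ℚ) => s * b) ratHeight 2
    (hL.map hf) (PolyTime.const 1) (by fun_prop) ratHeight_le_sz sz_le_ratHeight
    ⟨Polynomial.X, fun a s b => (ratHeight_mul_le s b).trans (by simp)⟩
  exact h.congr fun a => by rw [List.prod_eq_foldl]

end Arithmetic

/-! ### Formulas -/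

namespace Form

/-- Recursion over a formula with fixed operations. -/
def fold {V β : Type} (kc : Bool → β) (kv : V → β) (kn : β → β) (ka ko : β → β → β) : Form V → β
  | const b => kc b
  | var x => kv x
  | neg A => kn (A.fold kc kv kn ka ko)
  | and A B => ka (A.fold kc kv kn ka ko) (B.fold kc kv kn ka ko)
  | or A B => ko (A.fold kc kv kn ka ko) (B.fold kc kv kn ka ko)

/-- The formula with the variables replaced by their indices. -/
def toNat {n : ℕ} (A : Form (Fin n)) : Form ℕ := A.subst fun i => var i.val

/-- Formulas whose variables are natural numbers, as data. -/
def toVal : Form ℕ → Val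
  | const b => .pair (.nat 0) (.nat b.toNat)
  | var i => .pair (.nat 1) (.nat i)
  | neg A => .pair (.nat 2) A.toVal
  | and A B => .pair (.nat 3) (.pair A.toVal B.toVal)
  | or A B => .pair (.nat 4) (.pair A.toVal B.toVal)

instance : Enc (Form ℕ) := ⟨toVal⟩

theorem form_eq_enc_toNat {n : ℕ} (A : Form (Fin n)) : Val.form A = enc A.toNat := by
  induction A with
  | const | var => rfl
  | neg A ih => simpa [Val.form, enc, toNat, subst, toVal] using ih
  | and A B ihA ihB | or A B ihA ihB =>
    simpa [Val.form, enc, toNat, subst, toVal] using ⟨ihA, ihB⟩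

theorem sz_neg (A : Form ℕ) : sz A.neg = 4 + sz A := by
  have : Nat.size 2 = 2 := by decide
  simp only [sz, enc, toVal, Val.size]
  omega

theorem sz_and (A B : Form ℕ) : sz (A.and B) = 5 + sz A + sz B := by
  have : Nat.size 3 = 2 := by decide
  simp only [sz, enc, toVal, Val.size]
  omega

theorem sz_or (A B : Form ℕ) : sz (A.or B) = 6 + sz A + sz B := by
  have : Nat.size 4 = 3 := by decide
  simp only [sz, enc, toVal, Val.size]
  omega

/-- The kind of the topmost symbol of a formula. -/
def tag : Form ℕ → ℕ
  | const _ => 0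
  | var _ => 1
  | neg _ => 2
  | and _ _ => 3
  | or _ _ => 4

/-- The truth value or the variable of an atomic formula. -/
def arg : Form ℕ → ℕ
  | const b => b.toNat
  | var i => i
  | _ => 0

/-- The immediate subformulas. -/
def children : Form ℕ → List (Form ℕ)
  | const _ => []
  | var _ => []
  | neg A => [A]
  | and A B => [A, B]
  | or A B => [A, B]

/-- The number of symbols of a formula. -/
def nodes : Form ℕ → ℕ
  | const _ => 1
  | var _ => 1
  | neg A => A.nodes + 1
  | and A B => A.nodes + B.nodes + 1
  | or A B => A.nodes + B.nodes + 1

/-- The symbols of a formula in reverse Polish order. -/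
def rpn : Form ℕ → List (ℕ × ℕ)
  | const b => [(0, b.toNat)]
  | var i => [(1, i)]
  | neg A => A.rpn ++ [(2, 0)]
  | and A B => B.rpn ++ (A.rpn ++ [(3, 0)])
  | or A B => B.rpn ++ (A.rpn ++ [(4, 0)])

theorem polyTime_tag : PolyTime tag := .of_prim .fst fun A => by cases A <;> rfl

theorem polyTime_payload : PolyTime fun A : Form ℕ => Prim.snd.run (enc A) := .of_prim .snd fun _ => rfl

theorem polyTime_arg : PolyTime arg := by
  have h1 := polyTime_tag
  have h2 := polyTime_payload
  have h : PolyTime (fun A : Form ℕ => bif decide (A.tag ≤ 1) then Prim.snd.run (enc A) else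
    Val.nat 0) := by fun_prop
  exact PolyTime.of_enc_eq h (fun a => a) (fun _ => rfl) fun A => by cases A <;> rfl

theorem polyTime_children : PolyTime children := by
  have h1 := polyTime_tag
  have h2 := polyTime_payload
  have h3 : PolyTime (fun v : Val => Prim.fst.run v) := .of_prim .fst fun _ => rfl
  have h4 : PolyTime (fun v : Val => Prim.snd.run v) := .of_prim .snd fun _ => rfl
  have h5 : PolyTime (fun A : Form ℕ => Prim.fst.run (Prim.snd.run (enc A))) := h3.comp h2
  have h6 : PolyTime (fun A : Form ℕ => Prim.snd.run (Prim.snd.run (enc A))) := h4.comp h2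
  have h : PolyTime (fun A : Form ℕ => bif decide (A.tag ≤ 1) then ([] : List Val) else
    bif decide (A.tag = 2) then [Prim.snd.run (enc A)] else
      [Prim.fst.run (Prim.snd.run (enc A)), Prim.snd.run (Prim.snd.run (enc A))]) := by fun_prop
  exact PolyTime.of_enc_eq h (fun a => a) (fun _ => rfl) fun A => by cases A <;> rfl

/-- One step of the translation of a stack of formulas into reverse Polish notation. -/
def rpnStep (x : List (Form ℕ) × List (ℕ × ℕ)) : List (Form ℕ) × List (ℕ × ℕ) :=
  match x.1 with
  | [] => x
  | A :: st => (A.children ++ st, (A.tag, A.arg) :: x.2)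

theorem sz_rpnStep_le (x : List (Form ℕ) × List (ℕ × ℕ)) : sz (rpnStep x) ≤ sz x + 10 := by
  obtain ⟨st, out⟩ := x
  cases st with
  | nil => simp [rpnStep]
  | cons A st =>
    have h := sz_append A.children st
    have hA : sz A.children + sz A.arg ≤ sz A + 2 := by
      cases A <;> simp only [sz, enc, toVal, children, arg, Val.list, Val.size, List.map, Nat.size_zero] <;> omega
    have ht : sz A.tag ≤ 5 := by cases A <;> simp only [tag] <;> decide
    simp only [rpnStep, sz_prod, sz_cons] at *
    omega

/-- The number of symbols left on the stack drops by one in each round, so the translation takes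
exactly `nodes` rounds. -/
theorem load_rpnStep (x : List (Form ℕ) × List (ℕ × ℕ)) :
    ((rpnStep x).1.map nodes).sum = (x.1.map nodes).sum - 1 := by
  obtain ⟨st, out⟩ := x
  cases st with
  | nil => simp [rpnStep]
  | cons A st => cases A <;> simp [rpnStep, children, nodes] <;> omega

/-- The output of the translation of a stack of formulas. -/
def rpnStack : List (Form ℕ) → List (ℕ × ℕ) → List (ℕ × ℕ)
  | [], out => out
  | A :: st, out => rpnStack st (A.rpn ++ out)

theorem rpnStack_rpnStep (x : List (Form ℕ) × List (ℕ × ℕ)) :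
    rpnStack (rpnStep x).1 (rpnStep x).2 = rpnStack x.1 x.2 := by
  obtain ⟨st, out⟩ := x
  cases st with
  | nil => rfl
  | cons A st => cases A <;> simp [rpnStep, rpnStack, children, rpn, tag, arg]

theorem nodes_pos (A : Form ℕ) : 0 < A.nodes := by cases A <;> simp [nodes]

theorem nodes_le_sz (A : Form ℕ) : A.nodes ≤ sz A := by
  induction A <;> simp [nodes, sz, enc, toVal, Val.size] at * <;> omega

theorem rpn_length (A : Form ℕ) : A.rpn.length = A.nodes := by
  induction A <;> simp [rpn, nodes] <;> omega

/-- Programs have loops but no recursion, so a formula is traversed with an explicit stack. The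
resulting token list turns recursion over formulas into a fold over a list. -/
theorem polyTime_rpn : PolyTime rpn := by
  have hs : PolyTime rpnStep := by
    have h1 := polyTime_tag
    have h2 := polyTime_arg
    have h3 := polyTime_children
    refine PolyTime.listCases (L := fun x : List (Form ℕ) × List (ℕ × ℕ) => x.1) (g := fun x => x)
      (h := fun x A st => (A.children ++ st, (A.tag, A.arg) :: x.2)) (by fun_prop) (by fun_prop)
      (by fun_prop) (fun x h => ?_) (fun x b l h => ?_)
    · simp [rpnStep, h]
    · simp [rpnStep, h]
  have hload : ∀ k x, ((rpnStep^[k] x).1.map nodes).sum = (x.1.map nodes).sum - k := by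
    intro k x
    induction k with
    | zero => simp
    | succ k ih => rw [Function.iterate_succ_apply', load_rpnStep, ih]; omega
  have hstack : ∀ k x, rpnStack (rpnStep^[k] x).1 (rpnStep^[k] x).2 = rpnStack x.1 x.2 := by
    intro k x
    induction k with
    | zero => simp
    | succ k ih => rw [Function.iterate_succ_apply', rpnStack_rpnStep, ih]
  have hsz : ∀ k x, sz (rpnStep^[k] x) ≤ sz x + k * 10 := by
    intro k x
    induction k with
    | zero => simp
    | succ k ih =>
      rw [Function.iterate_succ_apply']
      have := sz_rpnStep_le (rpnStep^[k] x)
      omega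
  have hend : ∀ A : Form ℕ, (rpnStep^[A.nodes] ([A], [])).1 = [] := by
    intro A
    have h := hload A.nodes ([A], [])
    cases hst : (rpnStep^[A.nodes] ([A], [])).1 with
    | nil => rfl
    | cons B st =>
      have := nodes_pos B
      simp [hst] at h
      omega
  have key := PolyTime.iterate_while (init := fun A : Form ℕ => ([A], ([] : List (ℕ × ℕ))))
    (c := fun x : List (Form ℕ) × List (ℕ × ℕ) => !x.1.isEmpty) (step := rpnStep)
    nodes (by fun_prop) (by fun_prop) hs ?_ ?_ ?_ ?_
  · refine key.snd.congr fun A => ?_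
    have h := hstack A.nodes ([A], [])
    rw [hend] at h
    simpa [rpnStack] using h.symm
  · intro A k hk
    have h := hload k ([A], [])
    cases hst : (rpnStep^[k] ([A], [])).1 with
    | nil => simp [hst] at h; omega
    | cons B st => rfl
  · intro A
    rw [hend]; rfl
  · exact ⟨Polynomial.X, fun A => by simpa using nodes_le_sz A⟩
  · refine ⟨4 + 11 * Polynomial.X, fun A k hk => (hsz k _).trans ?_⟩
    have := nodes_le_sz A
    simp [sz_prod, sz_cons, sz_nil]
    omega

section Fold

variable {β : Type} (kc : Bool → β) (kv : ℕ → β) (kn : β → β) (ka ko : β → β → β) (d : β)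

/-- The effect of a symbol in reverse Polish notation on a stack of values. -/
def foldTok (st : List β) (t : ℕ × ℕ) : List β :=
  bif decide (t.1 = 0) then kc (decide (t.2 = 1)) :: st
  else bif decide (t.1 = 1) then kv t.2 :: st
  else bif decide (t.1 = 2) then kn (st.headD d) :: st.tail
  else bif decide (t.1 = 3) then ka (st.headD d) (st.tail.headD d) :: st.tail.tail
  else ko (st.headD d) (st.tail.headD d) :: st.tail.tail

theorem foldl_foldTok (A : Form ℕ) (st : List β) :
    A.rpn.foldl (foldTok kc kv kn ka ko d) st = A.fold kc kv kn ka ko :: st := by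
  induction A generalizing st with
  | const b => cases b <;> rfl
  | var i => rfl
  | neg A ih => rw [rpn, List.foldl_append, ih]; rfl
  | and A B ihA ihB | or A B ihA ihB =>
    rw [rpn, List.foldl_append, ihB, List.foldl_append, ihA]; rfl

theorem prefix_append_cases {γ : Type} {l x y : List γ} (h : l <+: x ++ y) :
    l <+: x ∨ ∃ l', l = x ++ l' ∧ l' <+: y := by
  rcases le_total l.length x.length with hl | hl
  · exact .inl (List.prefix_of_prefix_length_le h (List.prefix_append x y) hl)
  · obtain ⟨l', rfl⟩ := List.prefix_of_prefix_length_le (List.prefix_append x y) h hl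
    exact .inr ⟨l', rfl, (List.prefix_append_right_inj x).1 h⟩

/-- At every moment the new stack entries are values of subformulas of `A`. Only their size matters
for bounding the intermediate stacks, hence the weaker `sz B ≤ sz A`. -/
theorem foldl_foldTok_prefix (A : Form ℕ) (st : List β) (l : List (ℕ × ℕ)) (hl : l <+: A.rpn) :
    ∃ vs : List β, l.foldl (foldTok kc kv kn ka ko d) st = vs ++ st ∧ vs.length ≤ l.length ∧
      ∀ v ∈ vs, ∃ B : Form ℕ, sz B ≤ sz A ∧ v = B.fold kc kv kn ka ko := by
  let Traced (A : Form ℕ) : Prop := ∀ (st : List β) (l : List (ℕ × ℕ)), l <+: A.rpn →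
    ∃ vs : List β, l.foldl (foldTok kc kv kn ka ko d) st = vs ++ st ∧ vs.length ≤ l.length ∧
      ∀ v ∈ vs, ∃ B : Form ℕ, sz B ≤ sz A ∧ v = B.fold kc kv kn ka ko
  have single : ∀ (A : Form ℕ) (t : ℕ × ℕ), A.rpn = [t] → Traced A := by
    intro A t ht st l hl
    rcases eq_or_ne l [] with rfl | hne
    · exact ⟨[], by simp⟩
    have hl' : l = A.rpn := by
      refine hl.eq_of_length_le ?_
      have := List.length_pos_iff.2 hne
      simp [ht]; omega
    refine ⟨[A.fold kc kv kn ka ko], ?_, by simp [hl', ht],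
      fun v hv => ⟨A, le_rfl, by simpa using hv⟩⟩
    rw [hl', foldl_foldTok]; rfl
  -- A proper prefix ends either inside the tokens of `B`, or inside those of `A` with the value of
  -- `B` already on the stack.
  have binary : ∀ (A B C : Form ℕ) (t : ℕ × ℕ), C.rpn = B.rpn ++ (A.rpn ++ [t]) → sz A ≤ sz C →
      sz B ≤ sz C → Traced A → Traced B → Traced C := by
    intro A B C t hC hA hB ihA ihB st l hl
    rcases eq_or_ne l C.rpn with rfl | hne
    · exact ⟨[C.fold kc kv kn ka ko], by rw [foldl_foldTok]; rfl,
        by simp [hC]; omega, fun v hv => ⟨C, le_rfl, by simpa using hv⟩⟩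
    rw [hC, ← List.append_assoc] at hl hne
    rcases List.prefix_concat_iff.1 hl with h | h
    · exact absurd h hne
    rcases prefix_append_cases h with h | ⟨l', rfl, h'⟩
    · obtain ⟨vs, h1, h2, h3⟩ := ihB st l h
      refine ⟨vs, h1, h2, fun v hv => ?_⟩
      obtain ⟨D, hD, rfl⟩ := h3 v hv
      exact ⟨D, hD.trans hB, rfl⟩
    · obtain ⟨vs, h1, h2, h3⟩ := ihA (B.fold kc kv kn ka ko :: st) l' h'
      refine ⟨vs ++ [B.fold kc kv kn ka ko], ?_, ?_, fun v hv => ?_⟩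
      · rw [List.foldl_append, foldl_foldTok, h1]; simp
      · have := rpn_length B
        have := nodes_pos B
        simp; omega
      · rcases List.mem_append.1 hv with hv | hv
        · obtain ⟨D, hD, rfl⟩ := h3 v hv
          exact ⟨D, hD.trans hA, rfl⟩
        · exact ⟨B, hB, by simpa using hv⟩
  induction A generalizing st l with
  | const b => exact single _ _ rfl st l hl
  | var i => exact single _ _ rfl st l hl
  | neg A ih =>
    rcases eq_or_ne l (neg A).rpn with rfl | hne
    · exact ⟨[(neg A).fold kc kv kn ka ko], by rw [foldl_foldTok]; rfl,
        by simp [rpn], fun v hv => ⟨neg A, le_rfl, by simpa using hv⟩⟩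
    have hl' : l <+: A.rpn := (List.prefix_concat_iff.1 hl).resolve_left hne
    obtain ⟨vs, h1, h2, h3⟩ := ih st l hl'
    refine ⟨vs, h1, h2, fun v hv => ?_⟩
    obtain ⟨B, hB, rfl⟩ := h3 v hv
    exact ⟨B, hB.trans (by rw [sz_neg]; omega), rfl⟩
  | and A B ihA ihB =>
    exact binary A B (and A B) (3, 0) rfl (by rw [sz_and]; omega)
      (by rw [sz_and]; omega) ihA ihB st l hl
  | or A B ihA ihB =>
    exact binary A B (or A B) (4, 0) rfl (by rw [sz_or]; omega)
      (by rw [sz_or]; omega) ihA ihB st l hl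

end Fold

end Form

section FormFold

variable {α β γ : Type} [Enc α] [Enc β] [Enc γ]

/-- The fold runs over the reverse Polish form, and `hsize` bounds all stack entries because they
are values of formulas not larger than `A a`. The value `d` stands for the top of an empty stack,
which is never read. -/
theorem PolyTime.formFold {A : α → Form ℕ} {kc : α → Bool → β} {kv : α → ℕ → β}
    {kn : α → β → β} {ka ko : α → β → β → β} (d : β) (hA : PolyTime A)
    (hkc : PolyTime fun p : α × Bool => kc p.1 p.2) (hkv : PolyTime fun p : α × ℕ => kv p.1 p.2)
    (hkn : PolyTime fun p : α × β => kn p.1 p.2)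
    (hka : PolyTime fun p : α × β × β => ka p.1 p.2.1 p.2.2)
    (hko : PolyTime fun p : α × β × β => ko p.1 p.2.1 p.2.2)
    (hsize : ∃ P : Polynomial ℕ, ∀ a (B : Form ℕ), sz B ≤ sz (A a) →
      sz (B.fold (kc a) (kv a) (kn a) (ka a) (ko a)) ≤ P.eval (sz a)) :
    PolyTime fun a => (A a).fold (kc a) (kv a) (kn a) (ka a) (ko a) := by
  have hrpn : PolyTime fun a => (A a).rpn := Form.polyTime_rpn.comp hA
  have key := PolyTime.foldl_of_bound (L := fun a => (A a).rpn) (init := fun _ => ([] : List β))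
    (step := fun a => Form.foldTok (kc a) (kv a) (kn a) (ka a) (ko a) d) hrpn (by fun_prop) ?_ ?_
  · have h2 : PolyTime fun a => ((A a).rpn.foldl
      (Form.foldTok (kc a) (kv a) (kn a) (ka a) (ko a) d) []).headD d := by fun_prop
    exact h2.congr fun a => by rw [Form.foldl_foldTok]; rfl
  · unfold Form.foldTok
    have h1 : PolyTime fun p : α × List β × ℕ × ℕ =>
      (fun q : α × Bool => kc q.1 q.2) (p.1, decide (p.2.2.2 = 1)) :=
        PolyTime.comp hkc (by fun_prop)
    have h2 : PolyTime fun p : α × List β × ℕ × ℕ => (fun q : α × ℕ => kv q.1 q.2) (p.1, p.2.2.2) :=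
        PolyTime.comp hkv (by fun_prop)
    have h3 : PolyTime fun p : α × List β × ℕ × ℕ =>
      (fun q : α × β => kn q.1 q.2) (p.1, p.2.1.headD d) := PolyTime.comp hkn (by fun_prop)
    have h4 : PolyTime fun p : α × List β × ℕ × ℕ => (fun q : α × β × β => ka q.1 q.2.1 q.2.2)
      (p.1, p.2.1.headD d, p.2.1.tail.headD d) := PolyTime.comp hka (by fun_prop)
    have h5 : PolyTime fun p : α × List β × ℕ × ℕ => (fun q : α × β × β => ko q.1 q.2.1 q.2.2)
      (p.1, p.2.1.headD d, p.2.1.tail.headD d) := PolyTime.comp hko (by fun_prop)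
    fun_prop
  · obtain ⟨P, hP⟩ := hsize
    obtain ⟨R, hR⟩ := hrpn.polySize
    refine ⟨1 + R * (1 + P), fun a l hl => ?_⟩
    obtain ⟨vs, h1, h2, h3⟩ :=
      Form.foldl_foldTok_prefix (kc a) (kv a) (kn a) (ka a) (ko a) d (A a) [] l hl
    rw [h1, List.append_nil]
    have h4 : ∀ v ∈ vs, sz v ≤ P.eval (sz a) := fun v hv => by
      obtain ⟨B, hB, rfl⟩ := h3 v hv
      exact hP a B hB
    have h5 : vs.length ≤ R.eval (sz a) :=
      (h2.trans hl.length_le).trans ((length_lt_sz _).le.trans (hR a))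
    refine (sz_list_le h4).trans ?_
    simp only [Polynomial.eval_add, Polynomial.eval_mul, Polynomial.eval_one]
    gcongr

theorem PolyTime.formConst {b : α → Bool} (hb : PolyTime b) :
    PolyTime fun a => (Form.const (b a) : Form ℕ) := by
  have h : PolyTime fun a => (0, b a) := by fun_prop
  exact PolyTime.of_enc_eq h (fun a => a) (fun _ => rfl) fun _ => rfl

@[fun_prop]
theorem PolyTime.formVar {i : α → ℕ} (hi : PolyTime i) : PolyTime fun a => Form.var (i a) := by
  have h : PolyTime fun a => (1, i a) := by fun_prop
  exact PolyTime.of_enc_eq h (fun a => a) (fun _ => rfl) fun _ => rfl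

@[fun_prop]
theorem PolyTime.formNeg {A : α → Form ℕ} (hA : PolyTime A) : PolyTime fun a => (A a).neg := by
  have h : PolyTime fun a => (2, A a) := by fun_prop
  exact PolyTime.of_enc_eq h (fun a => a) (fun _ => rfl) fun _ => rfl

@[fun_prop]
theorem PolyTime.formAnd {A B : α → Form ℕ} (hA : PolyTime A) (hB : PolyTime B) :
    PolyTime fun a => (A a).and (B a) := by
  have h : PolyTime fun a => (3, A a, B a) := by fun_prop
  exact PolyTime.of_enc_eq h (fun a => a) (fun _ => rfl) fun _ => rfl

@[fun_prop]
theorem PolyTime.formOr {A B : α → Form ℕ} (hA : PolyTime A) (hB : PolyTime B) :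
    PolyTime fun a => (A a).or (B a) := by
  have h : PolyTime fun a => (4, A a, B a) := by fun_prop
  exact PolyTime.of_enc_eq h (fun a => a) (fun _ => rfl) fun _ => rfl

theorem PolyTime.formDisj {L : α → List (Form ℕ)} (hL : PolyTime L) :
    PolyTime fun a => Form.disj (L a) := by
  -- The flag marks the empty accumulator: the last disjunct has to stand alone, without a
  -- disjunction with `0`, since OR-substitution is an equality of formulas.
  have h := PolyTime.foldl (step := fun (_ : α) (s : Bool × Form ℕ) A =>
      (false, bif s.1 then A else A.or s.2)) hL.reverse
    (init := fun _ => (true, Form.const false)) (by fun_prop) (by fun_prop)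
    ⟨10 + Polynomial.X, fun a s A => by
      have h1 := sz_bool_le false
      have h2 := sz_pos s.1
      have h3 := Form.sz_or A s.2
      obtain ⟨b, B⟩ := s
      cases b <;> simp only [sz_prod, cond_true, cond_false, h3] at * <;> simp <;> omega⟩
  refine h.snd.congr fun a => ?_
  have key : ∀ l : List (Form ℕ), l.reverse.foldl (fun (s : Bool × Form ℕ) A =>
      (false, bif s.1 then A else A.or s.2)) (true, Form.const false) = (l.isEmpty, Form.disj l) := by
    intro l
    induction l with
    | nil => rfl
    | cons A l ih =>
      rw [List.reverse_cons, List.foldl_append, ih]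
      cases l <;> rfl
  rw [key]

theorem sz_subst_le {θ : ℕ → Form ℕ} {M : ℕ} (A : Form ℕ)
    (h : ∀ i, sz i ≤ sz A → sz (θ i) ≤ M) : sz (A.subst θ) ≤ sz A * (1 + M) := by
  induction A with
  | const b => exact Nat.le_mul_of_pos_right _ (by omega)
  | var i =>
    have h1 := h i (by simp [sz, enc, Form.toVal, Val.size])
    have h2 := sz_pos (Form.var i)
    rw [Form.subst]
    nlinarith
  | neg A ih =>
    have h1 := ih fun i hi => h i (hi.trans (by simp only [Form.sz_neg]; omega))
    simp only [Form.subst, Form.sz_neg]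
    nlinarith
  | and A B ihA ihB =>
    have h1 := ihA fun i hi => h i (hi.trans (by simp only [Form.sz_and]; omega))
    have h2 := ihB fun i hi => h i (hi.trans (by simp only [Form.sz_and]; omega))
    simp only [Form.subst, Form.sz_and]
    nlinarith
  | or A B ihA ihB =>
    have h1 := ihA fun i hi => h i (hi.trans (by simp only [Form.sz_or]; omega))
    have h2 := ihB fun i hi => h i (hi.trans (by simp only [Form.sz_or]; omega))
    simp only [Form.subst, Form.sz_or]
    nlinarith

theorem PolyTime.formSubst {A : α → Form ℕ} {θ : α → ℕ → Form ℕ} (hA : PolyTime A)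
    (hθ : PolyTime fun p : α × ℕ => θ p.1 p.2) : PolyTime fun a => (A a).subst (θ a) := by
  obtain ⟨R, hR⟩ := hA.polySize
  obtain ⟨T, hT⟩ := hθ.polySize
  have hfold : ∀ (θ : ℕ → Form ℕ) (A : Form ℕ),
      A.subst θ = A.fold Form.const θ Form.neg Form.and Form.or := by
    intro θ A
    induction A <;> simp_all [Form.subst, Form.fold]
  have key := PolyTime.formFold (A := A) (kc := fun _ => Form.const) (kv := θ)
    (kn := fun _ => Form.neg) (ka := fun _ => Form.and) (ko := fun _ => Form.or) (.const true)
    hA (PolyTime.formConst (by fun_prop)) hθ (by fun_prop) (by fun_prop) (by fun_prop)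
    ⟨R * (1 + T.comp (1 + Polynomial.X + R)), fun a B hB => by
      rw [← hfold]
      have h1 := sz_subst_le (θ := θ a) (M := T.eval (1 + sz a + R.eval (sz a))) B fun i hi =>
        (hT (a, i)).trans (poly_eval_mono T (by
          rw [sz_prod]
          have := hR a
          simp only
          omega))
      refine h1.trans ?_
      simp only [Polynomial.eval_mul, Polynomial.eval_add, Polynomial.eval_one,
        Polynomial.eval_comp, Polynomial.eval_X]
      exact Nat.mul_le_mul_right _ (hB.trans (hR a))⟩
  exact key.congr fun a => hfold _ _

theorem PolyTime.formEval {A : α → Form ℕ} {v : α → ℕ → Bool} (hA : PolyTime A)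
    (hv : PolyTime fun p : α × ℕ => v p.1 p.2) : PolyTime fun a => (A a).eval (v a) := by
  have hfold : ∀ (v : ℕ → Bool) (A : Form ℕ),
      A.eval v = A.fold (fun b => b) v Bool.not Bool.and Bool.or := by
    intro v A
    induction A <;> simp_all [Form.eval, Form.fold]
  have key := PolyTime.formFold (A := A) (kc := fun _ b => b) (kv := v)
    (kn := fun _ => Bool.not) (ka := fun _ => Bool.and) (ko := fun _ => Bool.or) true
    hA (by fun_prop) hv (by fun_prop) (by fun_prop) (by fun_prop)
    ⟨2, fun a B hB => (sz_bool_le _).trans (by simp)⟩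
  exact key.congr fun a => hfold _ _

end FormFold

/-! ## Substitution of variables by disjunctions -/

namespace Form

theorem eval_subst {V W : Type} (θ : V → Form W) (v : W → Bool) (A : Form V) :
    (A.subst θ).eval v = A.eval fun x => (θ x).eval v := by
  induction A <;> simp_all [subst, eval]

theorem eval_disj {V : Type} (v : V → Bool) (L : List (Form V)) :
    (disj L).eval v = L.any fun A => A.eval v := by
  induction L with
  | nil => rfl
  | cons A L ih =>
    cases L with
    | nil => simp [disj]
    | cons B L => rw [disj, eval, ih]; simp

theorem subst_subst {U V W : Type} (θ : U → Form V) (τ : V → Form W) (A : Form U) :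
    (A.subst θ).subst τ = A.subst fun x => (θ x).subst τ := by
  induction A <;> simp_all [subst]

theorem subst_disj {V W : Type} (θ : V → Form W) (L : List (Form V)) :
    (disj L).subst θ = disj (L.map (subst θ)) := by
  induction L with
  | nil => rfl
  | cons A L ih =>
    cases L with
    | nil => rfl
    | cons B L => rw [disj, subst, ih]; rfl

theorem subst_var {V : Type} (A : Form V) : A.subst var = A := by
  induction A <;> simp_all [subst]

theorem subst_congr {V W : Type} {θ τ : V → Form W} (h : ∀ x, θ x = τ x) (A : Form V) :
    A.subst θ = A.subst τ := (funext h : θ = τ) ▸ rfl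

end Form

namespace BoolFun

/-- The function in which the variable `Xᵢ` is substituted by a disjunction of `m i` fresh
variables, which are numbered consecutively. -/
def subOr (F : BoolFun) (m : ℕ → ℕ) : BoolFun where
  n := ∑ i : Fin F.n, m i
  form := F.form.subst fun i : Fin F.n =>
    Form.disj (List.ofFn fun j : Fin (m i) => Form.var (finSigmaFinEquiv ⟨i, j⟩))

/-- The names of the fresh variables. -/
def fresh (F : BoolFun) (m : ℕ → ℕ) : (Σ i : Fin F.n, Fin (m i)) ≃ Fin (F.subOr m).n :=
  finSigmaFinEquiv

theorem form_subOr (F : BoolFun) (m : ℕ → ℕ) : (F.subOr m).form = F.form.subst fun i : Fin F.n =>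
    Form.disj (List.ofFn fun j : Fin (m i) => Form.var (F.fresh m ⟨i, j⟩)) := rfl

theorem orSubst_subOr (F : BoolFun) (m : ℕ → ℕ) : F.OrSubst (F.subOr m) :=
  ⟨fun i => m i, F.fresh m, rfl⟩

/-- The variable for which a fresh variable was substituted. -/
def origin (F : BoolFun) (m : ℕ → ℕ) (z : Fin (F.subOr m).n) : Fin F.n := ((F.fresh m).symm z).1

theorem origin_fresh (F : BoolFun) (m : ℕ → ℕ) (i : Fin F.n) (j : Fin (m i)) :
    F.origin m (F.fresh m ⟨i, j⟩) = i := by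
  simp [origin]

theorem eval_subOr (F : BoolFun) (m : ℕ → ℕ) (v : Fin (F.subOr m).n → Bool) (w : Fin F.n → Bool)
    (hw : ∀ i, w i = true ↔ ∃ z, F.origin m z = i ∧ v z = true) :
    (F.subOr m).form.eval v = F.form.eval w := by
  rw [form_subOr, Form.eval_subst]
  congr 1
  funext i
  rw [Form.eval_disj, Bool.eq_iff_iff, hw]
  constructor
  · intro h
    obtain ⟨A, hA, h⟩ := List.any_eq_true.1 h
    obtain ⟨j, rfl⟩ := List.mem_ofFn.1 hA
    exact ⟨_, F.origin_fresh m i j, h⟩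
  · rintro ⟨z, rfl, hz⟩
    refine List.any_eq_true.2 ⟨_, List.mem_ofFn.2 ⟨((F.fresh m).symm z).2, rfl⟩, ?_⟩
    simpa [Form.eval, origin] using hz

theorem val_subOr (F : BoolFun) (m : ℕ → ℕ) (T : Finset (Fin (F.subOr m).n)) :
    (F.subOr m).val T = F.val (T.image (F.origin m)) := by
  unfold val
  rw [F.eval_subOr m _ (fun i => decide (i ∈ T.image (F.origin m)))]
  intro i
  simp [and_comm]

end BoolFun

instance : Enc BoolFun := ⟨Val.boolFun⟩
instance (C : Set BoolFun) : Enc C := ⟨fun F => Val.boolFun F.1⟩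

theorem enc_boolFun (F : BoolFun) : enc F = enc (List.range F.n, F.form.toNat) := by
  change Val.pair _ _ = Val.pair _ _
  rw [Form.form_eq_enc_toNat]
  congr 1
  change Val.list _ = Val.list _
  congr 1
  apply List.ext_getElem <;> simp [enc]

section BoolFunPolyTime

variable {α : Type} [Enc α]

@[fun_prop]
theorem PolyTime.coe {C : Set BoolFun} {F : α → C} (hF : PolyTime F) :
    PolyTime fun a => (F a).1 :=
  PolyTime.of_enc_eq hF (fun a => a) (fun _ => rfl) (fun _ => rfl)

theorem PolyTime.subtypeMk {C : Set BoolFun} {F : α → BoolFun} (hF : PolyTime F)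
    (h : ∀ a, F a ∈ C) : PolyTime fun a => (⟨F a, h a⟩ : C) :=
  PolyTime.of_enc_eq hF (fun a => a) (fun _ => rfl) (fun _ => rfl)

-- The input contains the list of its variables, that is, `n` in unary. All loops over the variables
-- draw on this list.
@[fun_prop]
theorem PolyTime.vars {F : α → BoolFun} (hF : PolyTime F) :
    PolyTime fun a => List.range (F a).n := by
  have h : PolyTime fun a => (List.range (F a).n, (F a).form.toNat) :=
    PolyTime.of_enc_eq hF (fun a => a) (fun _ => rfl) (fun a => (enc_boolFun _).symm)
  exact h.fst

@[fun_prop]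
theorem PolyTime.form {F : α → BoolFun} (hF : PolyTime F) :
    PolyTime fun a => (F a).form.toNat := by
  have h : PolyTime fun a => (List.range (F a).n, (F a).form.toNat) :=
    PolyTime.of_enc_eq hF (fun a => a) (fun _ => rfl) (fun a => (enc_boolFun _).symm)
  exact h.snd

@[fun_prop]
theorem PolyTime.numVars {F : α → BoolFun} (hF : PolyTime F) : PolyTime fun a => (F a).n := by
  have h : PolyTime fun a => (List.range (F a).n).length := by fun_prop
  exact h.congr fun a => by simp

theorem n_lt_sz (F : BoolFun) : F.n < sz F := by
  have h := length_lt_sz (List.range F.n)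
  have h2 : sz F = sz (List.range F.n, F.form.toNat) := by rw [sz, enc_boolFun, sz]
  rw [h2, sz_prod]
  simp at *
  omega

@[fun_prop]
theorem PolyTime.range_length {β : Type} [Enc β] {L : α → List β} (hL : PolyTime L) :
    PolyTime fun a => List.range (L a).length := by
  have key : ∀ (l : List β), l.foldl (fun (s : List ℕ) _ => s ++ [s.length]) [] =
      List.range l.length := by
    intro l
    induction l using List.reverseRecOn with
    | nil => rfl
    | append_singleton l b ih => simp [ih, List.range_succ]
  have h := PolyTime.foldl_of_bound (step := fun (_ : α) (s : List ℕ) (_ : β) => s ++ [s.length]) hL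
    (PolyTime.const []) (by fun_prop) ?_
  · exact h.congr fun a => (key _).symm
  · obtain ⟨R, hR⟩ := hL.polySize
    refine ⟨1 + R * (1 + (1 + R)), fun a l hl => ?_⟩
    rw [key]
    have h1 : l.length ≤ R.eval (sz a) := hl.length_le.trans ((length_lt_sz _).le.trans (hR a))
    refine (sz_list_le (B := 1 + R.eval (sz a)) fun i hi => ?_).trans ?_
    · rw [sz_nat]
      have h2 := List.mem_range.1 hi
      have h3 : i.size ≤ i := by
        rw [Nat.size_le]; exact Nat.lt_two_pow_self
      omega
    · simp only [List.length_range, Polynomial.eval_add, Polynomial.eval_mul, Polynomial.eval_one]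
      gcongr

theorem flatMap_range_blocks (m : ℕ → ℕ) (n : ℕ) :
    (List.range n).flatMap (fun j => (List.range (m j)).map
      fun t => ((List.range j).map m).sum + t) = List.range ((List.range n).map m).sum := by
  induction n with
  | zero => rfl
  | succ n ih =>
    rw [List.range_succ, List.flatMap_append, ih, List.map_append, List.sum_append]
    simp [List.range_add]

theorem filter_lt_range {j n : ℕ} (h : j ≤ n) :
    (List.range n).filter (fun i => decide (i < j)) = List.range j := by
  obtain ⟨k, rfl⟩ := Nat.exists_eq_add_of_le h
  rw [List.range_add, List.filter_append, List.filter_eq_self.2, List.filter_eq_nil_iff.2]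
  · simp
  · simp
  · simp

/-- The multiplicities must be available in unary, since as many fresh variables are written down.
-/
theorem PolyTime.subOr {F : α → BoolFun} {m : α → ℕ → ℕ} (hF : PolyTime F)
    (hm : PolyTime fun p : α × ℕ => List.range (m p.1 p.2)) :
    PolyTime fun a => (F a).subOr (m a) := by
  have hlen : PolyTime fun p : α × ℕ => m p.1 p.2 := hm.length.congr fun p => by simp
  have hlen2 : PolyTime fun p : (α × ℕ) × ℕ => (fun q : α × ℕ => m q.1 q.2) (p.1.1, p.2) :=
    PolyTime.comp hlen (by fun_prop)
  -- The first number of the block of `j`, in agreement with the numbering by `finSigmaFinEquiv`. As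
  -- `j` is given in binary, `List.range j` is obtained by filtering the list of the variables.
  obtain ⟨off, off_def⟩ : ∃ off : α → ℕ → ℕ, ∀ a j, off a j =
    (((List.range (F a).n).filter (fun i => decide (i < j))).map fun i => m a i).sum :=
    ⟨_, fun _ _ => rfl⟩
  have hoff : PolyTime fun p : α × ℕ => off p.1 p.2 := by
    simp only [off_def]
    fun_prop
  have hoff2 : PolyTime fun p : (α × ℕ) × ℕ => (fun q : α × ℕ => off q.1 q.2) p.1 :=
    PolyTime.comp (f := fun q : α × ℕ => off q.1 q.2) hoff (by fun_prop)
  have hvars : PolyTime fun a => (List.range (F a).n).flatMap fun j => (List.range (m a j)).map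
      fun t => off a j + t := by fun_prop
  have hform : PolyTime fun a => (F a).form.toNat.subst fun j =>
      Form.disj ((List.range (m a j)).map fun t => Form.var (off a j + t)) :=
    PolyTime.formSubst (by fun_prop) (PolyTime.formDisj (by fun_prop))
  refine PolyTime.of_enc_eq (hvars.prodMk hform) (fun a => a) (fun _ => rfl) fun a => ?_
  rw [enc_boolFun]
  have hoffeq : ∀ j ≤ (F a).n, off a j = ((List.range j).map (m a)).sum := fun j hj => by
    simp only [off_def, filter_lt_range hj]
  congr 1
  refine Prod.ext ?_ ?_
  · simp only [BoolFun.subOr]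
    have hsum : ∑ i : Fin (F a).n, m a i = ((List.range (F a).n).map (m a)).sum := by
      rw [Fin.sum_univ_eq_sum_range (m a)]; rfl
    rw [hsum, ← flatMap_range_blocks]
    refine List.flatMap_congr fun j hj => ?_
    rw [hoffeq j (List.mem_range.1 hj).le]
  · simp only [BoolFun.subOr, Form.toNat]
    rw [Form.subst_subst, Form.subst_subst]
    refine Form.subst_congr (fun i => ?_) _
    rw [Form.subst_disj, Form.subst, hoffeq i i.2.le]
    congr 1
    apply List.ext_getElem
    · simp
    · intro k h1 h2
      simp [Form.subst, finSigmaFinEquiv_apply]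
      rw [Fin.sum_univ_eq_sum_range (m a)]
      rfl

end BoolFunPolyTime

/-! ## Reductions -/

instance (A : Problem) : Enc A.Inst := ⟨A.input⟩

/-- Every polynomial-time algorithm for `B` gives rise to one for `A`. -/
def Transfers (A B : Problem) : Prop :=
  ∀ (s : Prog) (P : Polynomial ℕ), ∃ (q : Prog) (Q : Polynomial ℕ),
    (s.OracleFree → q.OracleFree) ∧ ∀ O, B.SolvedBy O s P → A.SolvedBy O q Q

theorem Transfers.trans {A B C : Problem} (h : Transfers A B) (k : Transfers B C) :
    Transfers A C := by
  intro s P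
  obtain ⟨q, Q, hq, hQ⟩ := k s P
  obtain ⟨r, R, hr, hR⟩ := h q Q
  exact ⟨r, R, fun hs => hr (hq hs), fun O hO => hR O (hQ O hO)⟩

/-- A single oracle call solves `B`. It is charged for its answer, so it takes polynomial time only
if the answers are polynomially long. -/
theorem Transfers.polyReduces {A B : Problem} (h : Transfers A B)
    (hB : ∃ P : Polynomial ℕ, ∀ y, (B.output y).size ≤ P.eval (B.input y).size) :
    PolyReduces A B := by
  obtain ⟨P, hP⟩ := hB
  obtain ⟨q, Q, -, hQ⟩ := h .oracle (1 + Polynomial.X + P)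
  refine ⟨q, Q, fun O hO => hQ O fun y => ?_⟩
  have h1 := Eval.oracle (O := O) (B.input y)
  rw [hO y] at h1
  refine ⟨_, h1, ?_⟩
  have := hP y
  simp
  omega

theorem Transfers.inFP {A B : Problem} (h : Transfers A B) (hB : InFP B) : InFP A := by
  obtain ⟨s, P, hs, hP⟩ := hB
  obtain ⟨q, Q, hq, hQ⟩ := h s P
  exact ⟨q, Q, hq hs, fun O => hQ O (hP O)⟩

theorem InFP.of_polyTime {A : Problem} {β : Type} [Enc β] {f : A.Inst → β} (hf : PolyTime f)
    (h : ∀ x, A.output x = enc (f x)) : InFP A := by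
  obtain ⟨p, hp, P, hP⟩ := hf
  refine ⟨p, P, hp, fun O x => ?_⟩
  obtain ⟨t, ht, hle⟩ := hP O x
  exact ⟨t, by rw [h]; exact ht, hle⟩

/-- The program that applies `s` to the first element of the first of two lists and moves the
result to the second list. -/
def mapBody (s : Prog) : Prog :=
  .pair (.comp (.prim .snd) (.prim .fst))
    (.pair (.comp s (.comp (.prim .fst) (.prim .fst))) (.prim .snd))

theorem eval_mapBody {O : Val → Val} {s : Prog} {u w l r : Val} {t S : ℕ} (h : Eval O s u w t)
    (hS : (Val.pair (.pair u l) r).size ≤ S) :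
    ∃ t', Eval O (mapBody s) (.pair (.pair u l) r) (.pair l (.pair w r)) t' ∧
      t' ≤ 7 + 2 * S + 5 * (1 + S) ^ 2 + t := by
  have hu : (Val.pair u l).size ≤ S := by simp only [Val.size] at *; omega
  have h1 := Nat.pow_le_pow_left (Nat.add_le_add_left hS 1) 2
  have h2 := Nat.pow_le_pow_left (Nat.add_le_add_left hu 1) 2
  refine ⟨_, .pair (.comp (.prim .fst _) (.prim .snd _))
    (.pair (.comp (.comp (.prim .fst _) (.prim .fst _)) h) (.prim .snd _)), ?_⟩
  simp only [Prim.run]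
  omega

/-- A non-adaptive reduction: `pre` computes a list of instances of `B`, and `post` the solution
from their solutions. -/
theorem Transfers.of_nonadaptive {A B : Problem} {β γ : Type} [Enc β] [Enc γ]
    {ans : B.Inst → β} (hans : ∀ y, B.output y = enc (ans y))
    {pre : A.Inst → List B.Inst} (hpre : PolyTime pre)
    {post : A.Inst × List β → γ} (hpost : PolyTime post)
    (h : ∀ x, A.output x = enc (post (x, (pre x).map ans))) : Transfers A B := by
  intro s P
  obtain ⟨K, -, hK⟩ := Eval.size_le s
  obtain ⟨R, hR⟩ := hpre.polySize
  obtain ⟨p, hp, Pp, hPp⟩ := hpre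
  have hpost' : PolyTime fun z : A.Inst × (List B.Inst × List β) =>
      post (z.1, z.2.2.reverse) := PolyTime.comp hpost (by fun_prop)
  obtain ⟨r, hr, Pr, hPr⟩ := hpost'
  let S : Polynomial ℕ := 2 + R + R * (1 + Polynomial.C K * P.comp R)
  let T : Polynomial ℕ := 7 + 2 * S + 5 * (1 + S) ^ 2 + P.comp R
  refine ⟨.comp r (.pair (.prim .id) (.comp (.loop (.comp (.prim .isPair) (.prim .fst)) (mapBody s))
      (.comp (.pair (.prim .id) (.prim (.const (.nat 0)))) p))),
    1 + (1 + Polynomial.X + (1 + Polynomial.X) ^ 2 + (1 + (1 + Pp + (1 + R + 2 * (1 + R) ^ 2)) +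
      (R + 1) * (1 + 3 * T))) + Pr.comp (1 + Polynomial.X + S),
    fun hs => ⟨hr, trivial, ⟨⟨trivial, trivial⟩, ⟨trivial, trivial⟩, ⟨hs, trivial, trivial⟩,
      trivial⟩, ⟨trivial, trivial⟩, hp⟩, fun O hO x => ?_⟩
  set L := pre x with hL
  have hRx : sz L ≤ R.eval (sz x) := hR x
  have hlen : L.length ≤ R.eval (sz x) := (length_lt_sz L).le.trans hRx
  have hin : ∀ y ∈ L, sz y ≤ R.eval (sz x) := fun y hy => (sz_le_of_mem hy).trans hRx
  have hrun : ∀ y ∈ L, ∃ t, Eval O s (enc y) (enc (ans y)) t ∧ t ≤ P.eval (R.eval (sz x)) := by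
    intro y hy
    obtain ⟨t, ht, hle⟩ := hO y
    rw [hans] at ht
    exact ⟨t, ht, hle.trans (poly_eval_mono P (hin y hy))⟩
  have hout : ∀ b ∈ L.map ans, sz b ≤ K * P.eval (R.eval (sz x)) := by
    intro b hb
    obtain ⟨y, hy, rfl⟩ := List.mem_map.1 hb
    obtain ⟨t, ht, hle⟩ := hrun y hy
    exact (hK _ _ _ _ ht).trans (Nat.mul_le_mul_left K hle)
  -- The state after `k` rounds: the open queries, and the answers so far in reverse order.
  let a (k : ℕ) : Val := enc (L.drop k, ((L.take k).map ans).reverse)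
  have hsize : ∀ k, (a k).size ≤ S.eval (sz x) := by
    intro k
    have h1 : sz (L.drop k) ≤ R.eval (sz x) := (sz_sublist (List.drop_sublist k L)).trans hRx
    have h2 := sz_list_le (l := ((L.take k).map ans).reverse) (B := K * P.eval (R.eval (sz x)))
      fun b hb => hout b (by
        obtain ⟨y, hy, rfl⟩ := List.mem_map.1 (List.mem_reverse.1 hb)
        exact List.mem_map_of_mem (List.mem_of_mem_take hy))
    have h3 : ((L.take k).map ans).reverse.length ≤ R.eval (sz x) := by
      simp
      omega
    have h4 := Nat.mul_le_mul_right (1 + K * P.eval (R.eval (sz x))) h3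
    change sz (L.drop k, ((L.take k).map ans).reverse) ≤ _
    rw [sz_prod]
    simp only [S, Polynomial.eval_add, Polynomial.eval_mul, Polynomial.eval_one,
      Polynomial.eval_comp, Polynomial.eval_C, Polynomial.eval_ofNat] at *
    omega
  have hST : S.eval (sz x) ≤ T.eval (sz x) := by
    simp only [T, Polynomial.eval_add, Polynomial.eval_mul, Polynomial.eval_one,
      Polynomial.eval_comp, Polynomial.eval_pow, Polynomial.eval_ofNat]
    omega
  have hcond : ∀ k, ∃ t, Eval O (.comp (.prim .isPair) (.prim .fst)) (a k)
      (Prim.isPair.run (enc (L.drop k))) t ∧ t ≤ T.eval (sz x) := by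
    intro k
    refine ⟨_, .comp (.prim .fst _) (.prim .isPair _), ?_⟩
    have h1 := hsize k
    have h2 : (enc (L.drop k)).size ≤ S.eval (sz x) := by
      refine le_trans ?_ h1
      simp only [a, enc, Val.size]
      omega
    have h3 := Nat.pow_le_pow_left (Nat.add_le_add_left h1 1) 2
    have h4 := Nat.pow_le_pow_left (Nat.add_le_add_left h2 1) 2
    change 1 + (1 + (a k).size) ^ 2 + (1 + (enc (L.drop k)).size) ^ 2 ≤ _
    simp only [T, Polynomial.eval_add, Polynomial.eval_mul, Polynomial.eval_one,
      Polynomial.eval_comp, Polynomial.eval_pow, Polynomial.eval_ofNat]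
    omega
  obtain ⟨t1, ht1, hle1⟩ := Eval.loop_of_seq (O := O) (c := .comp (.prim .isPair) (.prim .fst))
    (p := mapBody s) L.length (T.eval (sz x)) a
    (fun k hk => by
      obtain ⟨t, ht, hle⟩ := hcond k
      refine ⟨_, t, ht, ?_, hle⟩
      rw [List.drop_eq_getElem_cons hk]
      change Val.nat 1 ≠ Val.nat 0
      simp)
    (by
      obtain ⟨t, ht, hle⟩ := hcond L.length
      rw [List.drop_length] at ht
      exact ⟨t, ht, hle⟩)
    (fun k hk => by
      obtain ⟨t, ht, hle⟩ := hrun L[k] (List.getElem_mem hk)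
      have h1 := hsize k
      have ha : a k = .pair (.pair (enc L[k]) (enc (L.drop (k + 1))))
          (enc ((L.take k).map ans).reverse) := by
        simp only [a, List.drop_eq_getElem_cons hk]; rfl
      have ha' : a (k + 1) = .pair (enc (L.drop (k + 1))) (.pair (enc (ans L[k]))
          (enc ((L.take k).map ans).reverse)) := by
        simp only [a, List.take_succ_eq_append_getElem hk, List.map_append, List.reverse_append]
        rfl
      rw [ha] at h1
      obtain ⟨t', ht', hle'⟩ := eval_mapBody ht h1
      rw [ha, ha']
      refine ⟨t', ht', hle'.trans ?_⟩
      simp only [T, Polynomial.eval_add, Polynomial.eval_mul, Polynomial.eval_one,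
        Polynomial.eval_comp, Polynomial.eval_pow, Polynomial.eval_ofNat]
      omega)
    (fun k _ => (hsize k).trans hST)
  obtain ⟨t2, ht2, hle2⟩ := hPp O x
  obtain ⟨t3, ht3, hle3⟩ := hPr O (x, (L.drop L.length, ((L.take L.length).map ans).reverse))
  have hres : enc (post (x, ((L.take L.length).map ans).reverse.reverse)) = A.output x := by
    rw [List.reverse_reverse, List.take_length, h]
  rw [show enc (post (x, (List.drop L.length L, (List.map ans (List.take L.length L)).reverse).2.reverse))
    = A.output x from hres] at ht3
  have hinit : Eval O (.pair (.prim .id) (.prim (.const (.nat 0)))) (enc L) (a 0) _ :=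
    .pair (.prim .id (enc L)) (.prim (.const (.nat 0)) (enc L))
  refine ⟨_, .comp (.pair (.prim .id _) (.comp (.comp ht2 hinit) ht1)) ht3, ?_⟩
  have h5 : sz (x, (L.drop L.length, ((L.take L.length).map ans).reverse)) ≤
      1 + sz x + S.eval (sz x) := Nat.add_le_add_left (hsize L.length) _
  have h6 := hle3.trans (poly_eval_mono Pr h5)
  have h7 := Nat.pow_le_pow_left (Nat.add_le_add_left hRx 1) 2
  have h8 := Nat.mul_le_mul_right (1 + 3 * T.eval (sz x)) (Nat.add_le_add_right hlen 1)
  simp only [Polynomial.eval_add, Polynomial.eval_mul, Polynomial.eval_one, Polynomial.eval_X,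
    Polynomial.eval_comp, Polynomial.eval_pow, Polynomial.eval_ofNat]
  change 1 + (1 + sz x + (1 + sz x) ^ 2 + (1 + (1 + t2 + (1 + sz L + (1 + sz L) ^ 2 +
    (1 + sz L) ^ 2)) + t1)) + t3 ≤ _
  change _ ≤ 1 + (1 + sz x + (1 + sz x) ^ 2 + (1 + (1 + Pp.eval (sz x) + (1 + R.eval (sz x) + 2 *
    (1 + R.eval (sz x)) ^ 2)) + (R.eval (sz x) + 1) * (1 + 3 * T.eval (sz x)))) +
    Pr.eval (1 + sz x + S.eval (sz x))
  omega

/-! ## Shapley values and counting by size -/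

namespace BoolFun

open Finset Equiv
open scoped Nat

theorem card_before_eq {n : ℕ} (π : Perm (Fin n)) (i : Fin n) :
    #(before π i) = (π.symm i : ℕ) := by
  have : before π i = (Iio (π.symm i)).map π.toEmbedding := by
    ext j
    simp [before]
  rw [this, card_map, Fin.card_Iio]

theorem card_filter_prefix {n : ℕ} (S : Finset (Fin n)) :
    #(univ.filter fun π : Perm (Fin n) => ∀ x, x ∈ S ↔ (π.symm x : ℕ) < #S) =
      (#S)! * (n - #S)! := by
  have h := Numbering.card_prefixed S
  rw [Fintype.card_fin] at h
  rw [← h]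
  refine card_bij' (fun π _ => π.symm.trans (finCongr (Fintype.card_fin n).symm))
    (fun f _ => (f.trans (finCongr (Fintype.card_fin n))).symm) ?_ ?_ ?_ ?_
  · intro π hπ
    simp only [mem_filter, mem_univ, true_and] at hπ
    rw [Numbering.mem_prefixed]
    intro x
    simpa using hπ x
  · intro f hf
    rw [Numbering.mem_prefixed] at hf
    simp only [mem_filter, mem_univ, true_and]
    intro x
    simpa using hf x
  · intro π _
    ext x
    simp
  · intro f _
    ext x
    simp

/-- The permutations that begin with the elements of `S` are classified by the element that follows.
Exchanging `i` and `j` shows that all `n - #S` classes have the same size, so `(#S)! * (n - #S)!` is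
divided by `n - #S`. -/
theorem card_filter_before_eq {n : ℕ} (S : Finset (Fin n)) (i : Fin n) (hi : i ∉ S) :
    #(univ.filter fun π : Perm (Fin n) => before π i = S) = (#S)! * (n - 1 - #S)! := by
  have hlt : #S < n := by
    have := card_lt_univ_of_notMem hi
    simpa using this
  have swap_mem : ∀ j, j ∉ S → ∀ x, Equiv.swap i j x ∈ S ↔ x ∈ S := by
    intro j hj x
    rcases eq_or_ne x i with rfl | hxi
    · simp [hi, hj]
    rcases eq_or_ne x j with rfl | hxj
    · simp [hi, hj]
    rw [Equiv.swap_apply_of_ne_of_ne hxi hxj]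
  have hsymm : ∀ j ∈ Sᶜ, #(univ.filter fun π : Perm (Fin n) => before π j = S) =
      #(univ.filter fun π : Perm (Fin n) => before π i = S) := by
    intro j hj
    rw [mem_compl] at hj
    refine (card_equiv (Equiv.mulLeft (Equiv.swap i j)) fun π => ?_).symm
    simp only [mem_filter, mem_univ, true_and, Finset.ext_iff, before, Equiv.coe_mulLeft]
    have hs : ∀ x, (Equiv.swap i j * π).symm x = π.symm (Equiv.swap i j x) := by
      intro x
      rw [Equiv.symm_apply_eq]
      simp
    simp only [hs, Equiv.swap_apply_right]
    constructor
    · intro h x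
      rw [← swap_mem j hj x, ← h]
    · intro h x
      rw [← swap_mem j hj x, ← h]
      simp
  have hfib := card_eq_sum_card_fiberwise (s := univ.filter fun π : Perm (Fin n) =>
      ∀ x, x ∈ S ↔ (π.symm x : ℕ) < #S) (t := Sᶜ) (f := fun π => π ⟨#S, hlt⟩) (by
    intro π hπ
    simp only [coe_filter, mem_univ, true_and, Set.mem_ofPred_eq] at hπ
    rw [mem_coe, mem_compl, hπ]
    simp)
  rw [card_filter_prefix] at hfib
  have hcong : ∀ j ∈ Sᶜ, #((univ.filter fun π : Perm (Fin n) =>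
      ∀ x, x ∈ S ↔ (π.symm x : ℕ) < #S).filter fun π => π ⟨#S, hlt⟩ = j) =
      #(univ.filter fun π : Perm (Fin n) => before π i = S) := by
    intro j hj
    rw [← hsymm j hj, filter_filter]
    congr 1
    ext π
    simp only [mem_filter, mem_univ, true_and]
    constructor
    · rintro ⟨h, rfl⟩
      ext x
      rw [h]
      simp only [before, mem_filter, mem_univ, true_and, Equiv.symm_apply_apply]
      exact Iff.rfl
    · intro h
      have h1 := card_before_eq π j
      rw [h] at h1
      have h2 : π ⟨#S, hlt⟩ = j := by
        rw [← Equiv.eq_symm_apply]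
        exact Fin.ext h1
      refine ⟨fun x => ?_, h2⟩
      nth_rewrite 1 [← h]
      rw [h1]
      simp only [before, mem_filter, mem_univ, true_and]
      exact Iff.rfl
  rw [sum_congr rfl hcong, sum_const, card_compl, Fintype.card_fin, smul_eq_mul] at hfib
  have h3 : n - #S = (n - 1 - #S) + 1 := by omega
  rw [h3, Nat.factorial_succ] at hfib
  refine Nat.eq_of_mul_eq_mul_left (Nat.succ_pos (n - 1 - #S)) ?_
  rw [Nat.succ_eq_add_one, ← hfib]
  ring

theorem shapley_eq_sum_powerset (F : BoolFun) (i : Fin F.n) :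
    F.shapley i = ∑ S ∈ (univ.erase i).powerset, ((#S)! * (F.n - 1 - #S)! : ℚ) / (F.n ! : ℚ) *
      ((F.val (insert i S) : ℚ) - F.val S) := by
  rw [shapley, ← sum_fiberwise_of_maps_to (s := univ) (t := (univ.erase i).powerset)
    (g := fun π => before π i), mul_sum]
  · refine sum_congr rfl fun S hS => ?_
    have hi : i ∉ S := fun h => by simpa using (mem_powerset.1 hS) h
    have hc : ∀ π ∈ univ.filter (fun π : Perm (Fin F.n) => before π i = S),
        ((F.val (before π i ∪ {i}) : ℚ) - F.val (before π i)) =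
        (F.val (insert i S) : ℚ) - F.val S := by
      intro π hπ
      rw [(mem_filter.1 hπ).2, union_comm, ← insert_eq]
    rw [sum_congr rfl hc, sum_const, card_filter_before_eq S i hi, nsmul_eq_mul]
    push_cast
    ring
  · intro π _
    rw [mem_powerset]
    intro j hj
    simp only [before, mem_filter, mem_univ, true_and] at hj
    refine mem_erase.2 ⟨?_, mem_univ _⟩
    rintro rfl
    exact lt_irrefl _ hj

/-- The number of the models of size `k` that do not contain `i`. -/
def countWithout (F : BoolFun) (i : Fin F.n) (k : ℕ) : ℕ :=
  ∑ S ∈ (univ.erase i).powersetCard k, F.val S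

/-- The number of the models of size `k + 1` that contain `i`. -/
def countWith (F : BoolFun) (i : Fin F.n) (k : ℕ) : ℕ :=
  ∑ S ∈ (univ.erase i).powersetCard k, F.val (insert i S)

theorem countSize_succ (F : BoolFun) (i : Fin F.n) (k : ℕ) :
    F.countSize (k + 1) = F.countWithout i (k + 1) + F.countWith i k := by
  have hi : i ∉ univ.erase i := by simp
  have h : univ = insert i (univ.erase i) := by simp
  rw [countSize, h, powersetCard_succ_insert hi, sum_union, sum_image]
  · simp [countWithout, countWith]
  · intro S hS T hT hST
    have hS' : i ∉ S := fun h => hi ((mem_powersetCard.1 hS).1 h)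
    have hT' : i ∉ T := fun h => hi ((mem_powersetCard.1 hT).1 h)
    rw [← erase_insert hS', hST, erase_insert hT']
  · rw [disjoint_left]
    intro S hS hS'
    obtain ⟨T, -, rfl⟩ := mem_image.1 hS'
    exact hi ((mem_powersetCard.1 hS).1 (mem_insert_self i T))

/-- Double counting: a set of size `k` is counted once for each of the `n - k` indices outside it.
-/
theorem sum_countWithout (F : BoolFun) (k : ℕ) :
    ∑ i, F.countWithout i k = (F.n - k) * F.countSize k := by
  have h : ∀ i, F.countWithout i k =
      ∑ S ∈ (univ : Finset (Fin F.n)).powersetCard k, if i ∉ S then F.val S else 0 := by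
    intro i
    rw [countWithout, ← sum_filter]
    refine sum_congr ?_ fun _ _ => rfl
    ext S
    simp only [mem_powersetCard, mem_filter, subset_univ, true_and]
    refine ⟨fun h => ⟨h.2, fun hi => by simpa using h.1 hi⟩, fun h => ⟨fun x hx => ?_, h.1⟩⟩
    exact mem_erase.2 ⟨fun hxi => h.2 (hxi ▸ hx), mem_univ _⟩
  simp only [h]
  rw [sum_comm, countSize, mul_sum]
  refine sum_congr rfl fun S hS => ?_
  rw [← sum_filter, sum_const, smul_eq_mul]
  congr 1
  have : univ.filter (fun i => i ∉ S) = Sᶜ := by ext; simp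
  rw [this, card_compl, (mem_powersetCard.1 hS).2, Fintype.card_fin]

theorem sum_countWith (F : BoolFun) (k : ℕ) :
    ∑ i, F.countWith i k = (k + 1) * F.countSize (k + 1) := by
  have h1 : ∑ i, F.countWithout i (k + 1) + ∑ i, F.countWith i k = F.n * F.countSize (k + 1) := by
    rw [← sum_add_distrib]
    simp [← countSize_succ]
  rw [sum_countWithout] at h1
  rcases le_or_gt (k + 1) F.n with h | h
  · obtain ⟨m, hm⟩ := Nat.exists_eq_add_of_le h
    have h2 : F.n - (k + 1) = m := by omega
    have h3 : F.n * F.countSize (k + 1) = (k + 1) * F.countSize (k + 1) +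
        m * F.countSize (k + 1) := by rw [← add_mul, ← hm]
    rw [h2, h3] at h1
    omega
  · have h0 : F.countSize (k + 1) = 0 := by
      rw [countSize, powersetCard_eq_empty.2 (by simpa using h)]
      simp
    rw [h0] at h1 ⊢
    simpa using h1

theorem count_eq_sum_countSize (F : BoolFun) : F.count = ∑ k ∈ range (F.n + 1), F.countSize k := by
  rw [count, ← powerset_univ, sum_powerset]
  simp [countSize]

theorem val_le_one (F : BoolFun) (T : Finset (Fin F.n)) : F.val T ≤ 1 := Bool.toNat_le _

theorem count_le (F : BoolFun) : F.count ≤ 2 ^ F.n := by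
  refine (sum_le_card_nsmul _ _ 1 fun T _ => F.val_le_one T).trans ?_
  simp

theorem countSize_le (F : BoolFun) (k : ℕ) : F.countSize k ≤ 2 ^ F.n := by
  refine le_trans ?_ F.count_le
  exact sum_le_sum_of_subset (subset_univ _)

theorem countSize_zero (F : BoolFun) : F.countSize 0 = F.val ∅ := by
  simp [countSize]

theorem shapley_eq_sum_range (F : BoolFun) (i : Fin F.n) :
    F.shapley i = ∑ k ∈ range F.n, (k ! * (F.n - 1 - k)! : ℚ) / (F.n ! : ℚ) *
      ((F.countWith i k : ℚ) - F.countWithout i k) := by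
  have hcard : #((univ : Finset (Fin F.n)).erase i) + 1 = F.n := by
    rw [card_erase_of_mem (mem_univ _), card_univ, Fintype.card_fin]
    have := i.2
    omega
  rw [shapley_eq_sum_powerset, sum_powerset, hcard]
  refine sum_congr rfl fun k _ => ?_
  rw [countWith, countWithout]
  push_cast
  rw [← sum_sub_distrib, mul_sum]
  refine sum_congr rfl fun S hS => ?_
  rw [(mem_powersetCard.1 hS).2]

/-! ### The effect of substitutions -/

/-- The sum over the sets of fresh variables none of which was substituted for `Xᵢ`, if the other
variables were renamed. -/
theorem sum_origin {M : Type*} [AddCommMonoid M] (F : BoolFun) (m : ℕ → ℕ) (i : Fin F.n)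
    (hm : ∀ j : Fin F.n, j ≠ i → m j = 1) (ψ : Finset (Fin F.n) → ℕ → M) :
    ∑ T ∈ univ.filter (fun T : Finset (Fin (F.subOr m).n) => i ∉ T.image (F.origin m)),
      ψ (T.image (F.origin m)) #T = ∑ S ∈ (univ.erase i).powerset, ψ S #S := by
  have hinj : ∀ z z', F.origin m z = F.origin m z' → F.origin m z ≠ i → z = z' := by
    intro z z' h hz
    apply (F.fresh m).symm.injective
    have h1 := hm _ hz
    unfold origin at *
    generalize (F.fresh m).symm z = p at *
    generalize (F.fresh m).symm z' = q at *
    obtain ⟨p1, p2⟩ := p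
    obtain ⟨q1, q2⟩ := q
    simp only at h h1
    subst h
    congr 1
    have := p2.2
    have := q2.2
    exact Fin.ext (by omega)
  have hsurj : ∀ j, j ≠ i → ∃ z, F.origin m z = j := fun j hj =>
    ⟨_, F.origin_fresh m j ⟨0, by rw [hm j hj]; exact Nat.one_pos⟩⟩
  have hinjT : ∀ T : Finset (Fin (F.subOr m).n), i ∉ T.image (F.origin m) →
      Set.InjOn (F.origin m) T := fun T hT z hz z' _ h =>
    hinj z z' h fun h0 => hT (mem_image.2 ⟨z, hz, h0⟩)
  refine sum_bij' (fun T _ => T.image (F.origin m))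
    (fun S _ => univ.filter fun z => F.origin m z ∈ S) ?_ ?_ ?_ ?_ ?_
  · intro T hT
    rw [mem_powerset]
    intro j hj
    exact mem_erase.2 ⟨fun h => (mem_filter.1 hT).2 (h ▸ hj), mem_univ _⟩
  · intro S hS
    refine mem_filter.2 ⟨mem_univ _, fun h => ?_⟩
    obtain ⟨z, hz, rfl⟩ := mem_image.1 h
    have h1 := (mem_powerset.1 hS) (mem_filter.1 hz).2
    simp at h1
  · intro T hT
    ext z
    simp only [mem_filter, mem_univ, true_and, mem_image]
    refine ⟨?_, fun hz => ⟨z, hz, rfl⟩⟩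
    rintro ⟨z', hz', h⟩
    have : z' = z := hinj z' z h fun h0 => (mem_filter.1 hT).2 (mem_image.2 ⟨z', hz', h0⟩)
    exact this ▸ hz'
  · intro S hS
    ext j
    simp only [mem_image, mem_filter, mem_univ, true_and]
    refine ⟨by rintro ⟨z, hz, rfl⟩; exact hz, fun hj => ?_⟩
    have hji : j ≠ i := by
      have := (mem_powerset.1 hS) hj
      simpa using this
    obtain ⟨z, rfl⟩ := hsurj j hji
    exact ⟨z, hj, rfl⟩
  · intro T hT
    rw [card_image_of_injOn (hinjT T (mem_filter.1 hT).2)]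

theorem countSize_subOr_zero (F : BoolFun) (i : Fin F.n) (m : ℕ → ℕ)
    (hm : ∀ j : Fin F.n, j ≠ i → m j = 1) (hi : m i = 0) (k : ℕ) :
    (F.subOr m).countSize k = F.countWithout i k := by
  have hno : ∀ z, F.origin m z ≠ i := by
    intro z h
    unfold origin at h
    generalize (F.fresh m).symm z = p at h
    obtain ⟨p1, p2⟩ := p
    simp only at h
    subst h
    have := p2.2
    omega
  have h := F.sum_origin m i hm (fun S c => if c = k then F.val S else 0)
  have hall : univ.filter (fun T : Finset (Fin (F.subOr m).n) => i ∉ T.image (F.origin m)) =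
      univ := by
    refine filter_true_of_mem fun T _ hT => ?_
    obtain ⟨z, -, hz⟩ := mem_image.1 hT
    exact hno z hz
  rw [hall] at h
  rw [countWithout, countSize, powersetCard_eq_filter, powersetCard_eq_filter, sum_filter,
    sum_filter, powerset_univ, ← h]
  refine sum_congr rfl fun T _ => ?_
  rw [val_subOr]

/-- Adding `z` to a set that already contains a copy of `Xᵢ` changes nothing. The remaining sets
correspond to sets of the other variables, with the same sizes. So the differences are those of `F`,
and only the number of variables in the factorial weights changes. -/
theorem shapley_subOr (F : BoolFun) (i : Fin F.n) (m : ℕ → ℕ)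
    (hm : ∀ j : Fin F.n, j ≠ i → m j = 1) (z : Fin (F.subOr m).n) (hz : F.origin m z = i) :
    (F.subOr m).shapley z = ∑ k ∈ range F.n,
      (k ! * ((F.subOr m).n - 1 - k)! : ℚ) / ((F.subOr m).n ! : ℚ) *
      ((F.countWith i k : ℚ) - F.countWithout i k) := by
  have hcard : #((univ : Finset (Fin F.n)).erase i) + 1 = F.n := by
    rw [card_erase_of_mem (mem_univ _), card_univ, Fintype.card_fin]
    have := i.2
    omega
  have h := F.sum_origin m i hm (fun S c => (c ! * ((F.subOr m).n - 1 - c)! : ℚ) /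
    ((F.subOr m).n ! : ℚ) * ((F.val (insert i S) : ℚ) - F.val S))
  have hR : ∑ S ∈ (univ.erase i).powerset, ((#S)! * ((F.subOr m).n - 1 - #S)! : ℚ) /
    ((F.subOr m).n ! : ℚ) * ((F.val (insert i S) : ℚ) - F.val S) = ∑ k ∈ range F.n,
      (k ! * ((F.subOr m).n - 1 - k)! : ℚ) / ((F.subOr m).n ! : ℚ) *
      ((F.countWith i k : ℚ) - F.countWithout i k) := by
    rw [sum_powerset, hcard]
    refine sum_congr rfl fun k _ => ?_
    rw [countWith, countWithout]
    push_cast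
    rw [← sum_sub_distrib, mul_sum]
    refine sum_congr rfl fun S hS => ?_
    rw [(mem_powersetCard.1 hS).2]
  rw [← hR, ← h, shapley_eq_sum_powerset]
  symm
  refine sum_subset_zero_on_sdiff ?_ ?_ ?_
  · intro T hT
    rw [mem_powerset]
    intro y hy
    refine mem_erase.2 ⟨?_, mem_univ _⟩
    rintro rfl
    exact (mem_filter.1 hT).2 (mem_image.2 ⟨y, hy, hz⟩)
  · intro T hT
    have h1 : i ∈ T.image (F.origin m) := by
      by_contra h2
      exact (mem_sdiff.1 hT).2 (mem_filter.2 ⟨mem_univ _, h2⟩)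
    rw [val_subOr, val_subOr, image_insert, hz, insert_eq_of_mem h1]
    simp
  · intro T _
    rw [val_subOr, val_subOr, image_insert, hz]

/-- A set of copies with image `S` consists of a nonempty set of copies for each `i ∈ S` and of no
copies for the other variables. -/
theorem count_subOr_const (F : BoolFun) (M : ℕ) :
    (F.subOr fun _ => M).count = ∑ k ∈ range (F.n + 1), F.countSize k * (2 ^ M - 1) ^ k := by
  have hfib : ∀ S : Finset (Fin F.n), #(univ.filter fun T : Finset (Fin (F.subOr fun _ => M).n) =>
      T.image (F.origin fun _ => M) = S) = (2 ^ M - 1) ^ #S := by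
    intro S
    have hcard : #(Fintype.piFinset fun i : Fin F.n =>
        if i ∈ S then (univ : Finset (Finset (Fin M))).erase ∅ else {∅}) = (2 ^ M - 1) ^ #S := by
      rw [Fintype.card_piFinset]
      have : ∀ i : Fin F.n, #(if i ∈ S then (univ : Finset (Finset (Fin M))).erase ∅ else {∅}) =
          if i ∈ S then 2 ^ M - 1 else 1 := by
        intro i
        split_ifs
        · rw [card_erase_of_mem (mem_univ _)]
          simp
        · simp
      simp only [this]
      rw [prod_ite]
      simp
    rw [← hcard]
    let e := F.fresh fun _ => M
    refine card_bij' (fun T _ i => univ.filter fun j => e ⟨i, j⟩ ∈ (T : Finset (Fin _)))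
      (fun g _ => univ.filter fun z => (e.symm z).2 ∈ g (e.symm z).1) ?_ ?_ ?_ ?_
    · intro T hT
      rw [Fintype.mem_piFinset]
      intro i
      have hS : i ∈ S ↔ ∃ z ∈ T, (e.symm z).1 = i := by
        rw [← (mem_filter.1 hT).2, mem_image]; rfl
      split_ifs with hi
      · obtain ⟨z, hz, hzi⟩ := hS.1 hi
        subst hzi
        refine mem_erase.2 ⟨?_, mem_univ _⟩
        refine Finset.Nonempty.ne_empty ⟨(e.symm z).2, ?_⟩
        simp only [mem_filter, mem_univ, true_and]
        simpa using hz
      · rw [mem_singleton, filter_eq_empty_iff]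
        intro j _ hj
        exact hi (hS.2 ⟨_, hj, by simp⟩)
    · intro g hg
      rw [Fintype.mem_piFinset] at hg
      refine mem_filter.2 ⟨mem_univ _, ?_⟩
      ext i
      rw [mem_image]
      have hgi := hg i
      constructor
      · rintro ⟨z, hz, rfl⟩
        by_contra h
        change (e.symm z).1 ∉ S at h
        have hgz := hg (e.symm z).1
        rw [if_neg h, mem_singleton] at hgz
        have h2 := (mem_filter.1 hz).2
        rw [hgz] at h2
        simp at h2
      · intro hi
        rw [if_pos hi] at hgi
        obtain ⟨j, hj⟩ := nonempty_iff_ne_empty.2 (mem_erase.1 hgi).1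
        refine ⟨e ⟨i, j⟩, mem_filter.2 ⟨mem_univ _, ?_⟩, F.origin_fresh (fun _ => M) i j⟩
        rw [Equiv.symm_apply_apply]
        exact hj
    · intro T _
      ext z
      simp
    · intro g _
      funext i
      ext j
      simp
  rw [count]
  have h1 : ∀ T : Finset (Fin (F.subOr fun _ => M).n), (F.subOr fun _ => M).val T =
      F.val (T.image (F.origin fun _ => M)) := F.val_subOr _
  simp only [h1]
  rw [← sum_fiberwise (g := fun T : Finset (Fin (F.subOr fun _ => M).n) =>
    T.image (F.origin fun _ => M))]
  have h2 : ∀ S : Finset (Fin F.n), ∑ T ∈ univ.filter (fun T : Finset (Fin (F.subOr fun _ => M).n) =>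
      T.image (F.origin fun _ => M) = S), F.val (T.image (F.origin fun _ => M)) =
      F.val S * (2 ^ M - 1) ^ #S := by
    intro S
    rw [sum_congr rfl (g := fun _ => F.val S) fun T hT => by rw [(mem_filter.1 hT).2], sum_const,
      hfib, smul_eq_mul, mul_comm]
  simp only [h2]
  rw [← powerset_univ, sum_powerset, card_univ, Fintype.card_fin]
  refine sum_congr rfl fun k _ => ?_
  rw [countSize, sum_mul]
  refine sum_congr rfl fun S hS => ?_
  rw [(mem_powersetCard.1 hS).2]

end BoolFun

/-! ### Recovering the counts from the Shapley values -/

section Recover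

open Finset Polynomial
open scoped Nat

/-- Binomial inversion: the matrix with the entries `(-1) ^ j * r.choose j` is its own inverse. -/
theorem sum_alternating_choose_mul_choose {n r q : ℕ} (hr : r < n) :
    ∑ j ∈ range n, ((-1 : ℚ) ^ j * (r.choose j : ℚ)) * ((-1) ^ q * (j.choose q : ℚ)) =
      if r = q then 1 else 0 := by
  rcases lt_or_ge r q with h | h
  · rw [if_neg h.ne]
    refine sum_eq_zero fun j _ => ?_
    rcases lt_or_ge r j with h' | h'
    · simp [Nat.choose_eq_zero_of_lt h']
    · simp [Nat.choose_eq_zero_of_lt (h'.trans_lt h)]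
  have hsub : range (q + (r - q + 1)) ⊆ range n := range_subset_range.2 (by omega)
  rw [← sum_subset hsub, sum_range_add, sum_eq_zero, zero_add]
  · have h1 : ∀ i ∈ range (r - q + 1), ((-1 : ℚ) ^ (q + i) * (r.choose (q + i) : ℚ)) *
        ((-1) ^ q * ((q + i).choose q : ℚ)) =
        (r.choose q : ℚ) * (((-1 : ℤ) ^ i * ((r - q).choose i : ℤ) : ℤ) : ℚ) := by
      intro i _
      have h2 := Nat.choose_mul (n := r) (k := q + i) (s := q) (by omega)
      rw [Nat.add_sub_cancel_left] at h2
      have h3 : (r.choose (q + i) : ℚ) * ((q + i).choose q : ℚ) =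
          (r.choose q : ℚ) * ((r - q).choose i : ℚ) := by exact_mod_cast h2
      have h4 : ((-1 : ℚ) ^ q) * (-1) ^ q = 1 := by rw [← mul_pow]; simp
      push_cast
      calc _ = ((-1 : ℚ) ^ q * (-1) ^ q) * (-1) ^ i *
            ((r.choose (q + i) : ℚ) * ((q + i).choose q : ℚ)) := by ring
        _ = _ := by rw [h3, h4]; ring
    rw [sum_congr rfl h1, ← mul_sum, ← Int.cast_sum, Int.alternating_sum_range_choose]
    rcases eq_or_ne r q with rfl | hne
    · simp
    · rw [if_neg (by omega), if_neg hne]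
      simp
  · intro j hj
    simp [Nat.choose_eq_zero_of_lt (mem_range.1 hj)]
  · intro j _ hj
    have : r < j := by
      rw [mem_range] at hj
      omega
    simp [Nat.choose_eq_zero_of_lt this]

/-- The value at `-j` of the polynomial of degree less than `n` that takes the value `f a` at
`a + 1` for `a < n`. -/
def extrapolate (n : ℕ) (f : ℕ → ℚ) (j : ℕ) : ℚ :=
  ∑ a ∈ range n, f a * ∏ b ∈ range n,
    if b = a then 1 else (-(j : ℚ) - (b + 1)) / ((a : ℚ) - b)

theorem extrapolate_eq {n : ℕ} {f : ℕ → ℚ} {p : ℚ[X]} (hp : p.degree < n)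
    (hf : ∀ a < n, f a = p.eval ((a : ℚ) + 1)) (j : ℕ) : extrapolate n f j = p.eval (-(j : ℚ)) := by
  have hinj : Set.InjOn (fun a : ℕ => (a : ℚ) + 1) (range n : Finset ℕ) := by
    intro a _ b _ h
    simpa using h
  have h := Lagrange.eq_interpolate_of_eval_eq (fun a => f a) hinj
    (by simpa using hp) (fun a ha => (hf a (mem_range.1 ha)).symm)
  rw [h, Lagrange.interpolate_apply, eval_finsetSum, extrapolate]
  refine sum_congr rfl fun a ha => ?_
  rw [eval_mul, eval_C]
  congr 1
  rw [Lagrange.basis, eval_prod, ← mul_prod_erase _ _ ha]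
  simp only [if_true, one_mul]
  refine prod_congr rfl fun b hb => ?_
  rw [if_neg (mem_erase.1 hb).1, Lagrange.basisDivisor]
  simp only [eval_mul, eval_C, eval_sub, eval_X]
  rw [div_eq_inv_mul]
  congr 2
  ring

/-- The differences that determine the counts, see `recover_counts`. -/
def extrapolateDiff (n : ℕ) (f : ℕ → ℚ) (r : ℕ) : ℚ :=
  ∑ j ∈ range n, (-1 : ℚ) ^ j * (r.choose j : ℚ) * extrapolate n f j

/-- The rising factorial of length `q` takes the value `(-1) ^ q * q! * j.choose q` at `-j`. So
extrapolation from `1, …, n` to `0, -1, …` makes the system for the coefficients triangular, and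
binomial inversion solves it. -/
theorem recover_coeff {n : ℕ} {f e : ℕ → ℚ}
    (hf : ∀ a < n, f a = ∑ r ∈ range n, e r / (r ! : ℚ) * ((a + 1).ascFactorial r : ℚ))
    {r : ℕ} (hr : r < n) : extrapolateDiff n f r = e r := by
  let p : ℚ[X] := ∑ r ∈ range n, C (e r / (r ! : ℚ)) * ascPochhammer ℚ r
  have hdeg : p.degree < n := by
    rw [← mem_degreeLT]
    refine Submodule.sum_mem _ fun r hr => ?_
    rw [C_mul']
    refine Submodule.smul_mem _ _ (mem_degreeLT.2 ?_)
    refine degree_le_natDegree.trans_lt ?_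
    rw [ascPochhammer_natDegree]
    exact_mod_cast mem_range.1 hr
  have hev : ∀ j : ℕ, p.eval (-(j : ℚ)) = ∑ q ∈ range n, e q * ((-1) ^ q * (j.choose q : ℚ)) := by
    intro j
    simp only [p, eval_finsetSum, eval_mul, eval_C]
    refine sum_congr rfl fun q _ => ?_
    rw [ascPochhammer_eval_neg_eq_descPochhammer, descPochhammer_eval_eq_descFactorial,
      Nat.descFactorial_eq_factorial_mul_choose]
    have : (q ! : ℚ) ≠ 0 := by exact_mod_cast q.factorial_ne_zero
    push_cast
    field_simp
  have hpf : ∀ a < n, f a = p.eval ((a : ℚ) + 1) := by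
    intro a ha
    rw [hf a ha]
    simp only [p, eval_finsetSum, eval_mul, eval_C]
    refine sum_congr rfl fun q _ => ?_
    rw [← ascPochhammer_nat_eq_ascFactorial, ascPochhammer_eval_cast]
    push_cast
    rfl
  rw [extrapolateDiff]
  calc ∑ j ∈ range n, (-1 : ℚ) ^ j * (r.choose j : ℚ) * extrapolate n f j
      = ∑ j ∈ range n, ∑ q ∈ range n, e q *
          (((-1 : ℚ) ^ j * (r.choose j : ℚ)) * ((-1) ^ q * (j.choose q : ℚ))) := by
        refine sum_congr rfl fun j _ => ?_
        rw [extrapolate_eq hdeg hpf, hev, mul_sum]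
        exact sum_congr rfl fun q _ => by ring
    _ = ∑ q ∈ range n, e q * (if r = q then 1 else 0) := by
        rw [sum_comm]
        refine sum_congr rfl fun q _ => ?_
        rw [← mul_sum, sum_alternating_choose_mul_choose hr]
    _ = e r := by simp [hr]

/-- The counts are determined by the sums of the Shapley values of the functions that arise if a
variable is replaced by a disjunction of `a + 1` variables. -/
theorem recover_counts {n : ℕ} {c s f : ℕ → ℚ}
    (hs : ∀ a < n, s a = ∑ k ∈ range n, (k ! * (n + a - 1 - k)! : ℚ) / ((n + a)! : ℚ) *
      ((k + 1) * c (k + 1) - ((n - k : ℕ) : ℚ) * c k))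
    (hf : ∀ a < n, f a = (∏ j ∈ range n, ((a : ℚ) + 1 + j)) * s a) {k : ℕ} (hk : k ≤ n) :
    c k = (n ! : ℚ) / (k ! * (n - k)! : ℚ) *
      (c 0 + (∑ q ∈ range k, extrapolateDiff n f (n - 1 - q)) / (n ! : ℚ)) := by
  -- With `k = n - 1 - r` this is `b (k + 1) - b k` for `b k = k! * (n - k)! * c k`, so the sums of
  -- these numbers telescope.
  let e (r : ℕ) : ℚ := (r ! * (n - 1 - r)! : ℚ) *
    (((n - 1 - r : ℕ) + 1) * c (n - 1 - r + 1) - ((n - (n - 1 - r) : ℕ) : ℚ) * c (n - 1 - r))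
  have hfac : ∀ m : ℕ, (m ! : ℚ) ≠ 0 := fun m => by exact_mod_cast m.factorial_ne_zero
  have hprod : ∀ a, (a ! : ℚ) * ∏ j ∈ range n, ((a : ℚ) + 1 + j) = ((n + a)! : ℚ) := by
    intro a
    have h : ∀ m, (a ! : ℚ) * ∏ j ∈ range m, ((a : ℚ) + 1 + j) = ((m + a)! : ℚ) := by
      intro m
      induction m with
      | zero => simp
      | succ m ih =>
        rw [prod_range_succ, ← mul_assoc, ih, show m + 1 + a = (m + a) + 1 by ring,
          Nat.factorial_succ]
        push_cast
        ring
    exact h n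
  have hcoef : ∀ r < n, extrapolateDiff n f r = e r := by
    intro r hr
    refine recover_coeff (fun a ha => ?_) hr
    -- The product in `hf` is `(n + a)! / a!`. It cancels the denominator, and after the reflection
    -- `k = n - 1 - r` the quotient `(a + r)! / a!` is left, a rising factorial.
    rw [hf a ha, hs a ha, mul_sum, ← sum_range_reflect]
    refine sum_congr rfl fun r hr => ?_
    have hr' := mem_range.1 hr
    have h1 : n + a - 1 - (n - 1 - r) = a + r := by omega
    have h2 : (a ! : ℚ) * ((a + 1).ascFactorial r : ℚ) = ((a + r)! : ℚ) := by
      exact_mod_cast Nat.factorial_mul_ascFactorial a r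
    have h3 := hprod a
    simp only [e]
    rw [h1, ← h2, ← h3]
    have hP : ∏ j ∈ range n, ((a : ℚ) + 1 + j) ≠ 0 := fun h0 => by
      rw [h0, mul_zero] at h3
      exact hfac _ h3.symm
    have := hfac a
    have := hfac r
    field_simp
  induction k with
  | zero =>
    have := hfac n
    simp
    field_simp
  | succ k ih =>
    have ih := ih (by omega)
    rw [sum_range_succ, hcoef _ (by omega)]
    simp only [e]
    have h1 : n - 1 - (n - 1 - k) = k := by omega
    rw [h1]
    have h2 : n - (k + 1) = n - 1 - k := by omega
    have h3 : n - k = (n - 1 - k) + 1 := by omega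
    rw [h2]
    rw [h3, Nat.factorial_succ] at ih
    rw [h3]
    have := hfac n
    have := hfac k
    have := hfac (n - 1 - k)
    have h4 : ((k : ℚ) + 1) ≠ 0 := by positivity
    have h5 : (((n - 1 - k : ℕ) : ℚ) + 1) ≠ 0 := by positivity
    rw [Nat.factorial_succ]
    push_cast at *
    generalize ∑ q ∈ range k, extrapolateDiff n f (n - 1 - q) = s at *
    generalize (((n - 1 - k : ℕ) : ℚ)) = m at *
    rw [ih]
    field_simp
    ring

end Recover

/-! ## The reductions between the three problems -/

section Programs

variable {α : Type} [Enc α]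

/-- The factorial of `k`, computed with the list of the numbers less than some `n ≥ k`. -/
def listFactorial (V : List ℕ) (k : ℕ) : ℕ :=
  ((V.filter fun j => decide (j < k)).map fun j => j + 1).prod

/-- The power `b ^ k`, computed with the list of the numbers less than some `n ≥ k`. -/
def listPow (V : List ℕ) (b k : ℕ) : ℕ :=
  ((V.filter fun j => decide (j < k)).map fun _ => b).prod

open scoped Nat in
theorem listFactorial_range {n k : ℕ} (h : k ≤ n) : listFactorial (List.range n) k = k ! := by
  rw [listFactorial, filter_lt_range h]
  induction k with
  | zero => rfl
  | succ k ih =>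
    rw [List.range_succ, List.map_append, List.prod_append, ih (by omega), Nat.factorial_succ]
    simp [mul_comm]

theorem listPow_range {n k : ℕ} (b : ℕ) (h : k ≤ n) : listPow (List.range n) b k = b ^ k := by
  rw [listPow, filter_lt_range h]
  simp

@[fun_prop]
theorem PolyTime.listFactorial {V : α → List ℕ} {k : α → ℕ} (hV : PolyTime V) (hk : PolyTime k) :
    PolyTime fun a => listFactorial (V a) (k a) := by
  unfold ShapMC.listFactorial
  fun_prop

@[fun_prop]
theorem PolyTime.listPow {V : α → List ℕ} {b k : α → ℕ} (hV : PolyTime V) (hb : PolyTime b)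
    (hk : PolyTime k) : PolyTime fun a => listPow (V a) (b a) (k a) := by
  unfold ShapMC.listPow
  fun_prop

end Programs

/-- The problem to compute the function `f` on encoded data. -/
def encProblem {ι γ : Type} [Enc ι] [Enc γ] (f : ι → γ) : Problem := ⟨ι, enc, fun x => enc (f x)⟩

theorem encProblem_transfers {ι κ β γ : Type} [Enc ι] [Enc κ] [Enc β] [Enc γ] {f : ι → γ}
    {g : κ → β} {pre : ι → List κ} (hpre : PolyTime pre) {post : ι × List β → γ}
    (hpost : PolyTime post) (h : ∀ x, f x = post (x, (pre x).map g)) :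
    Transfers (encProblem f) (encProblem g) :=
  Transfers.of_nonadaptive (A := encProblem f) (B := encProblem g) (ans := g) (fun _ => rfl)
    (pre := pre) hpre (post := post) hpost fun x => congrArg enc (h x)

/-! ### Counts and size counts. -/

theorem countProblem_eq (C : Set BoolFun) :
    countProblem C = encProblem fun F : C => F.1.count := rfl

/-- The vector of the numbers of models by size. -/
def BoolFun.sizeCounts (F : BoolFun) : List ℕ := (List.range (F.n + 1)).map F.countSize

theorem fixedSizeCountProblem_eq (C : Set BoolFun) :
    fixedSizeCountProblem C = encProblem fun F : C => F.1.sizeCounts := by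
  rw [fixedSizeCountProblem, encProblem]
  congr 1
  funext F
  change Val.list _ = Val.list _
  congr 1
  apply List.ext_getElem
  · rw [List.length_ofFn, List.length_map, BoolFun.sizeCounts, List.length_map, List.length_range]
  · intro i h1 h2
    simp only [BoolFun.sizeCounts, List.getElem_ofFn, List.getElem_map, List.getElem_range]
    rfl

/-- The vector of the Shapley values. -/
def BoolFun.shapleys (F : BoolFun) : List ℚ := List.ofFn F.shapley

theorem shapleyProblem_eq (C : Set BoolFun) :
    shapleyProblem C = encProblem fun F : C => F.1.shapleys := by
  rw [shapleyProblem, encProblem]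
  congr 1
  funext F
  change Val.list _ = Val.list _
  congr 1
  apply List.ext_getElem <;> simp [BoolFun.shapleys, enc]

theorem sum_map_range {M : Type*} [AddCommMonoid M] (f : ℕ → M) (n : ℕ) :
    ((List.range n).map f).sum = ∑ k ∈ Finset.range n, f k := rfl

theorem prod_map_range {M : Type*} [CommMonoid M] (f : ℕ → M) (n : ℕ) :
    ((List.range n).map f).prod = ∏ k ∈ Finset.range n, f k := rfl

theorem count_transfers (C : Set BoolFun) :
    Transfers (countProblem C) (fixedSizeCountProblem C) := by
  rw [countProblem_eq, fixedSizeCountProblem_eq]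
  refine encProblem_transfers (pre := fun F => [F])
    (post := fun z => ((z.2.headD []).map fun b => b).sum) (by fun_prop) (by fun_prop) fun F => ?_
  rw [F.1.count_eq_sum_countSize]
  simp [BoolFun.sizeCounts, sum_map_range]

theorem mem_of_orSubst {C : Set BoolFun} (hC : C = orClosure C) {F G : BoolFun} (hF : F ∈ C)
    (h : F.OrSubst G) : G ∈ C := by
  rw [hC]
  exact ⟨F, hF, h⟩

/-- The terms below `k` sum to less than `B ^ k`, and those above `k` are divisible by `B ^ (k +
1)`. -/
theorem digit_of_sum (c : ℕ → ℕ) {B m k : ℕ} (hB : ∀ j, c j < B) (hk : k < m) :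
    (∑ j ∈ Finset.range m, c j * B ^ j) / B ^ k % B = c k := by
  have hpos : 0 < B := (Nat.zero_le _).trans_lt (hB 0)
  have hlow : ∀ k, ∑ j ∈ Finset.range k, c j * B ^ j < B ^ k := by
    intro k
    induction k with
    | zero => simp
    | succ k ih =>
      rw [Finset.sum_range_succ, pow_succ]
      have h1 := Nat.mul_le_mul_right (B ^ k) (Nat.succ_le_of_lt (hB k))
      rw [Nat.succ_mul] at h1
      rw [mul_comm (B ^ k) B]
      omega
  obtain ⟨d, rfl⟩ : ∃ d, m = k + 1 + d := Nat.exists_eq_add_of_le hk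
  have h2 : ∑ j ∈ Finset.range (k + 1 + d), c j * B ^ j =
      ∑ j ∈ Finset.range k, c j * B ^ j +
        (c k + (∑ j ∈ Finset.range d, c (k + 1 + j) * B ^ j) * B) * B ^ k := by
    rw [Finset.sum_range_add, Finset.sum_range_succ, add_mul, add_assoc]
    congr 2
    rw [Finset.sum_mul, Finset.sum_mul]
    exact Finset.sum_congr rfl fun j _ => by ring
  rw [h2, Nat.add_mul_div_right _ _ (Nat.pow_pos hpos), Nat.div_eq_of_lt (hlow k), zero_add,
    Nat.add_mul_mod_self_right, Nat.mod_eq_of_lt (hB k)]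

theorem fixedSizeCount_transfers {C : Set BoolFun} (hC : C = orClosure C) :
    Transfers (fixedSizeCountProblem C) (countProblem C) := by
  rw [countProblem_eq, fixedSizeCountProblem_eq]
  have hpre : PolyTime fun F : C => (F.1).subOr fun _ => (0 :: 0 :: List.range F.1.n).length :=
    PolyTime.subOr (by fun_prop) (by fun_prop)
  refine encProblem_transfers
    -- The number `n + 2` of copies, in unary. The base `2 ^ (n + 2) - 1` exceeds all counts, which
    -- are at most `2 ^ n`; with `n + 1` copies this would fail for `n = 0`.
    (pre := fun F : C => [⟨F.1.subOr fun _ => (0 :: 0 :: List.range F.1.n).length,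
      mem_of_orSubst hC F.2 (F.1.orSubst_subOr _)⟩])
    (post := fun z : C × List ℕ => (List.range z.1.1.n ++ [z.1.1.n]).map fun k =>
      z.2.headD 0 / listPow (List.range z.1.1.n)
        (listPow (List.range z.1.1.n) 2 z.1.1.n * 4 - 1) k %
          (listPow (List.range z.1.1.n) 2 z.1.1.n * 4 - 1))
    ((PolyTime.subtypeMk hpre fun F => _).cons (by fun_prop)) (by fun_prop) fun F => ?_
  simp only [List.map_cons, List.headD_cons, List.length_cons, List.length_range]
  rw [BoolFun.sizeCounts, ← List.range_succ]
  refine List.map_congr_left fun k hk => ?_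
  have hk' := List.mem_range.1 hk
  rw [listPow_range _ le_rfl, listPow_range _ (by omega), BoolFun.count_subOr_const]
  have hB : 2 ^ F.1.n * 4 = 2 ^ (F.1.n + 1 + 1) := by ring
  rw [hB, digit_of_sum _ _ hk']
  intro j
  have h1 := F.1.countSize_le j
  have h2 : 1 ≤ 2 ^ F.1.n := Nat.one_le_two_pow
  omega

/-! ### From size counts to Shapley values. -/

theorem getD_map_range {β : Type*} (f : ℕ → β) (n k : ℕ) (d : β) (hk : k < n) :
    ((List.range n).map f).getD k d = f k := by
  simp [List.getD_eq_getElem?_getD, hk]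

theorem BoolFun.sizeCounts_getD (F : BoolFun) (k : ℕ) : F.sizeCounts.getD k 0 = F.countSize k := by
  rcases lt_or_ge k (F.n + 1) with h | h
  · exact getD_map_range _ _ _ _ h
  · rw [BoolFun.sizeCounts, List.getD_eq_default _ _ (by simpa using h), BoolFun.countSize,
      Finset.powersetCard_eq_empty.2 (by simpa using h)]
    simp

/-- The multiplicities of a substitution in which `a` fresh variables are substituted for `Xᵢ` and
the other variables are renamed. -/
def mult (i a j : ℕ) : ℕ := bif decide (j = i) then a else 1

theorem PolyTime.subOr_mult {α β : Type} [Enc α] [Enc β] {F : α → BoolFun} {i : α → ℕ}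
    {L : α → List β} (hF : PolyTime F) (hi : PolyTime i) (hL : PolyTime L) :
    PolyTime fun a => (F a).subOr (mult (i a) (L a).length) := by
  have h : PolyTime fun p : α × ℕ => bif decide (p.2 = i p.1) then List.range (L p.1).length
      else [0] := by fun_prop
  refine PolyTime.subOr hF (h.congr fun p => ?_)
  by_cases hp : p.2 = i p.1 <;> simp [mult, hp]

-- Query 0 is `F`, and query `i + 1` is `F` with `0` substituted for `Xᵢ`, whose size counts are
-- `countWithout i`. The numbers `countWith i` follow from `countSize_succ`.
open scoped Nat in
theorem shapley_transfers {C : Set BoolFun} (hC : C = orClosure C) :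
    Transfers (shapleyProblem C) (fixedSizeCountProblem C) := by
  rw [shapleyProblem_eq, fixedSizeCountProblem_eq]
  have hsub : PolyTime fun p : C × ℕ => (p.1.1).subOr (mult p.2 ([] : List ℕ).length) :=
    PolyTime.subOr_mult (by fun_prop) (by fun_prop) (by fun_prop)
  have hsub' : PolyTime fun p : C × ℕ => (⟨(p.1.1).subOr (mult p.2 ([] : List ℕ).length),
      mem_of_orSubst hC p.1.2 (p.1.1.orSubst_subOr _)⟩ : C) := PolyTime.subtypeMk hsub _
  refine encProblem_transfers
    (pre := fun F : C => F :: (List.range F.1.n).map fun i =>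
      ⟨F.1.subOr (mult i ([] : List ℕ).length), mem_of_orSubst hC F.2 (F.1.orSubst_subOr _)⟩)
    (post := fun z : C × List (List ℕ) => (List.range z.1.1.n).map fun i =>
      ((List.range z.1.1.n).map fun k =>
        (((listFactorial (List.range z.1.1.n) k : ℕ) : ℚ) *
          ((listFactorial (List.range z.1.1.n) (z.1.1.n - 1 - k) : ℕ) : ℚ)) /
        ((listFactorial (List.range z.1.1.n) z.1.1.n : ℕ) : ℚ) *
        (((((z.2.getD 0 []).getD (k + 1) 0 : ℕ) : ℚ) -
          (((z.2.getD (i + 1) []).getD (k + 1) 0 : ℕ) : ℚ)) -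
          (((z.2.getD (i + 1) []).getD k 0 : ℕ) : ℚ))).sum)
    (PolyTime.id.cons (PolyTime.map (by fun_prop) hsub')) (by fun_prop) fun F => ?_
  simp only [List.map_cons, List.map_map]
  apply List.ext_getElem
  · simp [BoolFun.shapleys]
  intro i h1 h2
  have hi : i < F.1.n := by simpa [BoolFun.shapleys] using h1
  simp only [BoolFun.shapleys, List.getElem_ofFn, List.getElem_map, List.getElem_range]
  rw [BoolFun.shapley_eq_sum_range, sum_map_range]
  refine Finset.sum_congr rfl fun k hk => ?_
  have hk := Finset.mem_range.1 hk
  rw [listFactorial_range hk.le, listFactorial_range (by omega), listFactorial_range le_rfl,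
    List.getD_cons_zero, List.getD_cons_succ, getD_map_range _ _ _ _ hi]
  simp only [Function.comp_apply, BoolFun.sizeCounts_getD]
  have hm : ∀ j : Fin F.1.n, j ≠ ⟨i, hi⟩ → mult i ([] : List ℕ).length j = 1 := by
    intro j hj
    have : (j : ℕ) ≠ i := fun h => hj (Fin.ext h)
    simp [mult, this]
  have hm0 : mult i ([] : List ℕ).length (⟨i, hi⟩ : Fin F.1.n) = 0 := by simp [mult]
  rw [F.1.countSize_subOr_zero ⟨i, hi⟩ _ hm hm0, F.1.countSize_subOr_zero ⟨i, hi⟩ _ hm hm0,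
    F.1.countSize_succ ⟨i, hi⟩ k]
  push_cast
  ring

/-! ### The inversion formula as a polynomial-time computation. -/

section RecoverPrograms

variable {α : Type} [Enc α]

/-- The binomial coefficient, computed with the list of the numbers less than some `n ≥ r`. -/
def listChoose (V : List ℕ) (r j : ℕ) : ℕ :=
  bif decide (j ≤ r) then listFactorial V r / (listFactorial V j * listFactorial V (r - j)) else 0

theorem listChoose_range {n r : ℕ} (j : ℕ) (h : r ≤ n) :
    listChoose (List.range n) r j = r.choose j := by
  rcases le_or_gt j r with hj | hj
  · rw [listChoose, listFactorial_range h, listFactorial_range (hj.trans h),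
      listFactorial_range ((Nat.sub_le _ _).trans h), Nat.choose_eq_factorial_div_factorial hj]
    simp [hj]
  · simp [listChoose, Nat.choose_eq_zero_of_lt hj, hj.not_ge]

@[fun_prop]
theorem PolyTime.listChoose {V : α → List ℕ} {r j : α → ℕ} (hV : PolyTime V) (hr : PolyTime r)
    (hj : PolyTime j) : PolyTime fun a => listChoose (V a) (r a) (j a) := by
  unfold ShapMC.listChoose
  fun_prop

/-- `extrapolate`, computed with the list of the numbers less than `n`. -/
def listExtrapolate (V : List ℕ) (g : List ℚ) (j : ℕ) : ℚ :=
  (V.map fun a => g.getD a 0 * (V.map fun b =>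
    if b = a then (1 : ℚ) else (-(j : ℚ) - ((b : ℚ) + 1)) / ((a : ℚ) - b)).prod).sum

theorem listExtrapolate_range (n : ℕ) (g : List ℚ) (j : ℕ) :
    listExtrapolate (List.range n) g j = extrapolate n (fun a => g.getD a 0) j := rfl

@[fun_prop]
theorem PolyTime.listExtrapolate {V : α → List ℕ} {g : α → List ℚ} {j : α → ℕ} (hV : PolyTime V)
    (hg : PolyTime g) (hj : PolyTime j) :
    PolyTime fun a => listExtrapolate (V a) (g a) (j a) := by
  unfold ShapMC.listExtrapolate
  fun_prop

/-- `extrapolateDiff`, computed with the list of the numbers less than `n`. -/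
def listExtrapolateDiff (V : List ℕ) (g : List ℚ) (r : ℕ) : ℚ :=
  (V.map fun j => (if j % 2 = 0 then (1 : ℚ) else -1) * ((listChoose V r j : ℕ) : ℚ) *
    listExtrapolate V g j).sum

theorem listExtrapolateDiff_range {n r : ℕ} (g : List ℚ) (hr : r ≤ n) :
    listExtrapolateDiff (List.range n) g r = extrapolateDiff n (fun a => g.getD a 0) r := by
  rw [listExtrapolateDiff, sum_map_range, extrapolateDiff]
  refine Finset.sum_congr rfl fun j _ => ?_
  rw [listChoose_range _ hr, listExtrapolate_range]
  congr 2
  split_ifs with h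
  · exact (Even.neg_one_pow (Nat.even_iff.2 h)).symm
  · exact (Odd.neg_one_pow (Nat.not_even_iff_odd.1 fun h' => h (Nat.even_iff.1 h'))).symm

@[fun_prop]
theorem PolyTime.listExtrapolateDiff {V : α → List ℕ} {g : α → List ℚ} {r : α → ℕ}
    (hV : PolyTime V) (hg : PolyTime g) (hr : PolyTime r) :
    PolyTime fun a => listExtrapolateDiff (V a) (g a) (r a) := by
  unfold ShapMC.listExtrapolateDiff
  fun_prop

/-- The number of models of size `k`, computed as in `recover_counts`. -/
def recoverCount (V : List ℕ) (n c : ℕ) (g : List ℚ) (k : ℕ) : ℚ :=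
  ((listFactorial V n : ℕ) : ℚ) / (((listFactorial V k : ℕ) : ℚ) *
    ((listFactorial V (n - k) : ℕ) : ℚ)) * ((c : ℚ) +
    ((V.filter fun q => decide (q < k)).map fun q => listExtrapolateDiff V g (n - 1 - q)).sum /
      ((listFactorial V n : ℕ) : ℚ))

@[fun_prop]
theorem PolyTime.recoverCount {V : α → List ℕ} {n c k : α → ℕ} {g : α → List ℚ} (hV : PolyTime V)
    (hn : PolyTime n) (hc : PolyTime c) (hg : PolyTime g) (hk : PolyTime k) :
    PolyTime fun a => recoverCount (V a) (n a) (c a) (g a) (k a) := by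
  unfold ShapMC.recoverCount
  fun_prop

/-- The sums of Shapley values to which `recover_counts` applies, from the answers to the
queries. -/
def shapleySums (V : List ℕ) (n : ℕ) (ans : List (List ℚ)) : List ℚ :=
  V.map fun a : ℕ => (V.map fun j : ℕ => (a : ℚ) + 1 + (j : ℚ)).prod *
    (V.map fun i : ℕ => (ans.getD (i * n + a) []).getD i 0).sum

@[fun_prop]
theorem PolyTime.shapleySums {V : α → List ℕ} {n : α → ℕ} {ans : α → List (List ℚ)}
    (hV : PolyTime V) (hn : PolyTime n) (hans : PolyTime ans) :
    PolyTime fun a => shapleySums (V a) (n a) (ans a) := by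
  unfold ShapMC.shapleySums
  fun_prop

@[fun_prop]
theorem PolyTime.val_empty {F : α → BoolFun} (hF : PolyTime F) :
    PolyTime fun a => (F a).val ∅ := by
  have h : PolyTime fun a => (F a).form.toNat.eval fun _ => false :=
    PolyTime.formEval (by fun_prop) (by fun_prop)
  have h2 : PolyTime fun a => bif (F a).form.toNat.eval (fun _ => false) then 1 else 0 := by
    fun_prop
  refine h2.congr fun a => ?_
  rw [Form.toNat, Form.eval_subst]
  have : (fun i : Fin (F a).n => decide (i ∈ (∅ : Finset (Fin (F a).n)))) =
    fun i => (Form.var i.val).eval fun _ => false := by funext i; simp [Form.eval]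
  rw [BoolFun.val, this]
  cases Form.eval _ (F a).form <;> rfl

end RecoverPrograms

/-! ### From Shapley values to size counts. -/

namespace BoolFun

theorem n_subOr_mult (F : BoolFun) {i a : ℕ} (hi : i < F.n) :
    (F.subOr (mult i (a + 1))).n = F.n + a := by
  change ∑ j : Fin F.n, mult i (a + 1) j = _
  have h : ∀ j : Fin F.n, mult i (a + 1) j = 1 + if j = ⟨i, hi⟩ then a else 0 := by
    intro j
    by_cases h : (j : ℕ) = i
    · simp [mult, h, Fin.ext_iff, add_comm]
    · simp [mult, h, Fin.ext_iff]
  simp [h, Finset.sum_add_distrib]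

/-- The variables before `Xᵢ` have one copy each, so the Shapley value of the first copy of `Xᵢ` is
found at position `i` of the answer. -/
theorem fresh_mult_val (F : BoolFun) {i a : ℕ} (hi : i < F.n) (j : Fin (mult i (a + 1) i))
    (hj : (j : ℕ) = 0) : (F.fresh (mult i (a + 1)) ⟨⟨i, hi⟩, j⟩ : ℕ) = i := by
  refine (finSigmaFinEquiv_apply _).trans ?_
  simp only [hj, add_zero]
  rw [Finset.sum_congr rfl (g := fun _ => 1)]
  · simp
  · intro k _
    have : (k : ℕ) ≠ i := k.2.ne
    simp [mult, this]

theorem shapleys_subOr_mult (F : BoolFun) {i a : ℕ} (hi : i < F.n) :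
    (F.subOr (mult i (a + 1))).shapleys.getD i 0 = ∑ k ∈ Finset.range F.n,
      (k.factorial * (F.n + a - 1 - k).factorial : ℚ) / ((F.n + a).factorial : ℚ) *
      ((F.countWith ⟨i, hi⟩ k : ℚ) - F.countWithout ⟨i, hi⟩ k) := by
  have hm : ∀ j : Fin F.n, j ≠ ⟨i, hi⟩ → mult i (a + 1) j = 1 := by
    intro j hj
    have : (j : ℕ) ≠ i := fun h => hj (Fin.ext h)
    simp [mult, this]
  have h0 : 0 < mult i (a + 1) i := by simp [mult]
  have hz := F.fresh_mult_val (a := a) hi ⟨0, h0⟩ rfl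
  have hlt : i < (F.subOr (mult i (a + 1))).n := by
    rw [F.n_subOr_mult hi]
    omega
  have hs := F.shapley_subOr ⟨i, hi⟩ _ hm _ (F.origin_fresh (mult i (a + 1)) ⟨i, hi⟩ ⟨0, h0⟩)
  simp only [F.n_subOr_mult hi] at hs
  rw [← hs, shapleys, List.getD_eq_getElem _ _ (by simpa using hlt), List.getElem_ofFn]
  congr 1
  exact Fin.ext hz.symm

/-- Summation over `i` removes the dependence on the single variable: only the size counts of `F`
remain. -/
theorem sum_shapleys_subOr_mult (F : BoolFun) (a : ℕ) :
    ∑ i ∈ Finset.range F.n, (F.subOr (mult i (a + 1))).shapleys.getD i 0 =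
      ∑ k ∈ Finset.range F.n,
        (k.factorial * (F.n + a - 1 - k).factorial : ℚ) / ((F.n + a).factorial : ℚ) *
        ((k + 1) * (F.countSize (k + 1) : ℚ) - ((F.n - k : ℕ) : ℚ) * F.countSize k) := by
  rw [Finset.sum_range, Finset.sum_congr rfl fun i _ => F.shapleys_subOr_mult (a := a) i.2,
    Finset.sum_comm]
  refine Finset.sum_congr rfl fun k _ => ?_
  rw [← Finset.mul_sum, Finset.sum_sub_distrib]
  have h1 := F.sum_countWith k
  have h2 := F.sum_countWithout k
  congr 2
  · exact_mod_cast h1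
  · exact_mod_cast h2

end BoolFun

theorem fixedSizeCount_transfers_shapley {C : Set BoolFun} (hC : C = orClosure C) :
    Transfers (fixedSizeCountProblem C) (shapleyProblem C) := by
  rw [shapleyProblem_eq, fixedSizeCountProblem_eq]
  have hsub : PolyTime fun p : C × ℕ => (p.1.1).subOr (mult (p.2 / p.1.1.n)
      (0 :: (List.range p.1.1.n).filter fun q => decide (q < p.2 % p.1.1.n)).length) :=
    PolyTime.subOr_mult (by fun_prop) (by fun_prop) (by fun_prop)
  -- There are `n * n` queries. Number `i * n + a` replaces `Xᵢ` by `a + 1` copies, this number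
  -- being the length of a list because it is needed in unary.
  let query (F : C) (t : ℕ) : C := ⟨F.1.subOr (mult (t / F.1.n)
    (0 :: (List.range F.1.n).filter fun q => decide (q < t % F.1.n)).length),
      mem_of_orSubst hC F.2 (F.1.orSubst_subOr _)⟩
  have hquery : PolyTime fun p : C × ℕ => query p.1 p.2 := PolyTime.subtypeMk hsub _
  refine encProblem_transfers
    (post := fun z : C × List (List ℚ) => (List.range z.1.1.n ++ [z.1.1.n]).map fun k =>
      (recoverCount (List.range z.1.1.n) z.1.1.n (z.1.1.val ∅)
        (shapleySums (List.range z.1.1.n) z.1.1.n z.2) k).num.natAbs)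
    (PolyTime.map (L := fun F : C =>
      List.range ((List.range F.1.n).flatMap fun _ => List.range F.1.n).length)
      (by fun_prop) hquery) (by fun_prop) fun F => ?_
  simp only []
  rw [BoolFun.sizeCounts, ← List.range_succ]
  refine List.map_congr_left fun k hk => ?_
  have hk' : k ≤ F.1.n := Nat.lt_succ_iff.1 (List.mem_range.1 hk)
  set n := F.1.n with hn
  set ans : List (List ℚ) := List.map _ (List.map _ _) with hans
  have hans' : ∀ i < n, ∀ a < n,
      ans.getD (i * n + a) [] = (F.1.subOr (mult i (a + 1))).shapleys := by
    intro i hi a ha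
    have hlt : i * n + a < n * n := by nlinarith
    rw [hans, List.map_map, getD_map_range _ _ _ _ (by simpa using hlt)]
    have h1 : (i * n + a) / n = i := by
      rw [mul_comm, Nat.mul_add_div (by omega), Nat.div_eq_of_lt ha, add_zero]
    have h2 : (i * n + a) % n = a := by rw [Nat.mul_add_mod', Nat.mod_eq_of_lt ha]
    simp only [Function.comp_apply, query, ← hn, h1, h2]
    rw [filter_lt_range ha.le, List.length_cons, List.length_range]
  have hsum : ∀ a < n, (shapleySums (List.range n) n ans).getD a 0 =
      (∏ j ∈ Finset.range n, ((a : ℚ) + 1 + j)) *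
        ∑ i ∈ Finset.range n, (F.1.subOr (mult i (a + 1))).shapleys.getD i 0 := by
    intro a ha
    rw [shapleySums, getD_map_range _ _ _ _ ha, prod_map_range, sum_map_range]
    congr 1
    refine Finset.sum_congr rfl fun i hi => ?_
    rw [hans' i (Finset.mem_range.1 hi) a ha]
  have h := recover_counts (n := n) (c := fun k => (F.1.countSize k : ℚ))
    (fun a _ => F.1.sum_shapleys_subOr_mult a) hsum hk'
  have h2 : recoverCount (List.range n) n (F.1.val ∅) (shapleySums (List.range n) n ans) k =
      (F.1.countSize k : ℚ) := by
    rw [h, recoverCount, listFactorial_range le_rfl, listFactorial_range hk',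
      listFactorial_range (Nat.sub_le _ _), filter_lt_range hk', sum_map_range,
      F.1.countSize_zero]
    congr 4
    funext q
    rw [listExtrapolateDiff_range _ (by omega)]
  rw [h2]
  simp

/-! ### Polynomial bounds on the sizes of the answers. -/

theorem sz_nat_le {a B : ℕ} (h : a ≤ 2 ^ B) : sz a ≤ 2 + B := by
  have : a.size ≤ B + 1 := Nat.size_le.2 (h.trans_lt (Nat.pow_lt_pow_right (by omega) (by omega)))
  rw [sz_nat]
  omega

theorem sz_div_le {z : ℤ} {d B : ℕ} (hz : z.natAbs ≤ 2 ^ B) (h0 : d ≠ 0) (hd : d ≤ 2 ^ B) :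
    sz ((z : ℚ) / d) ≤ 8 + 2 * B := by
  have h1 := sz_nat_le ((natAbs_num_mkRat_le z d).trans hz)
  have h2 := sz_nat_le ((den_mkRat_le z h0).trans hd)
  rw [← Rat.mkRat_eq_div, sz_rat]
  rw [sz_nat] at h1 h2
  split_ifs <;> omega

theorem factorial_le_two_pow (n : ℕ) : n.factorial ≤ 2 ^ (n * n) :=
  n.factorial_le_pow.trans (by
    rw [pow_mul]
    exact Nat.pow_le_pow_left Nat.lt_two_pow_self.le n)

namespace BoolFun

theorem sz_count_le (F : BoolFun) : sz F.count ≤ 2 + F.n := sz_nat_le F.count_le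

theorem sz_sizeCounts_le (F : BoolFun) : sz F.sizeCounts ≤ 1 + (F.n + 1) * (3 + F.n) := by
  refine (sz_list_le (B := 2 + F.n) fun a ha => ?_).trans ?_
  · obtain ⟨k, -, rfl⟩ := List.mem_map.1 ha
    exact sz_nat_le (F.countSize_le k)
  · simp only [sizeCounts, List.length_map, List.length_range]
    apply le_of_eq
    ring

/-- A Shapley value is an integer of absolute value at most `n!` over the denominator `n!`, and `n!
≤ 2 ^ (n * n)`. -/
theorem sz_shapleys_le (F : BoolFun) :
    sz F.shapleys ≤ 1 + F.n * (9 + 2 * (F.n * F.n)) := by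
  refine (sz_list_le (B := 8 + 2 * (F.n * F.n)) fun q hq => ?_).trans ?_
  · obtain ⟨i, rfl⟩ := List.mem_ofFn.1 hq
    have h : F.shapley i = ((∑ π : Equiv.Perm (Fin F.n), ((F.val (before π i ∪ {i}) : ℤ) -
        F.val (before π i)) : ℤ) : ℚ) / (F.n.factorial : ℕ) := by
      rw [shapley]
      push_cast
      ring
    rw [h]
    refine sz_div_le ?_ (Nat.factorial_ne_zero _) (factorial_le_two_pow _)
    refine le_trans ?_ (factorial_le_two_pow _)
    refine (Int.natAbs_sum_le _ _).trans ?_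
    refine (Finset.sum_le_card_nsmul _ _ 1 fun π _ => ?_).trans ?_
    · have h1 := F.val_le_one (before π i ∪ {i})
      have h2 := F.val_le_one (before π i)
      omega
    · simp [Fintype.card_perm]
  · simp only [shapleys, List.length_ofFn]
    apply le_of_eq
    ring

end BoolFun

theorem encProblem_output_le {C : Set BoolFun} {β : Type} [Enc β] {f : C → β} {P : Polynomial ℕ}
    (h : ∀ F, sz (f F) ≤ P.eval F.1.n) :
    ∃ P : Polynomial ℕ, ∀ F, ((encProblem f).output F).size ≤ P.eval ((encProblem f).input F).size :=
  ⟨P, fun F => (h F).trans (poly_eval_mono P (n_lt_sz F.1).le)⟩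

theorem polyReduces_countProblem {A : Problem} {C : Set BoolFun}
    (h : Transfers A (countProblem C)) : PolyReduces A (countProblem C) :=
  h.polyReduces (encProblem_output_le (f := fun F : C => F.1.count) (P := 2 + Polynomial.X)
    fun F => F.1.sz_count_le.trans (by simp))

theorem polyReduces_fixedSizeCountProblem {A : Problem} {C : Set BoolFun}
    (h : Transfers A (fixedSizeCountProblem C)) : PolyReduces A (fixedSizeCountProblem C) := by
  refine h.polyReduces ?_
  rw [fixedSizeCountProblem_eq]
  exact encProblem_output_le (P := 1 + (Polynomial.X + 1) * (3 + Polynomial.X))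
    fun F => F.1.sz_sizeCounts_le.trans (by simp)

theorem polyReduces_shapleyProblem {A : Problem} {C : Set BoolFun}
    (h : Transfers A (shapleyProblem C)) : PolyReduces A (shapleyProblem C) := by
  refine h.polyReduces ?_
  rw [shapleyProblem_eq]
  exact encProblem_output_le
    (P := 1 + Polynomial.X * (9 + 2 * (Polynomial.X * Polynomial.X)))
    fun F => F.1.sz_shapleys_le.trans (by simp)

theorem polyEquiv_of_eq_orClosure {C : Set BoolFun} (hC : C = orClosure C) :
    PolyEquiv (shapleyProblem C) (fixedSizeCountProblem C) ∧
    PolyEquiv (fixedSizeCountProblem C) (countProblem C) ∧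
    PolyEquiv (shapleyProblem C) (countProblem C) :=
  ⟨⟨polyReduces_fixedSizeCountProblem (shapley_transfers hC),
      polyReduces_shapleyProblem (fixedSizeCount_transfers_shapley hC)⟩,
    ⟨polyReduces_countProblem (fixedSizeCount_transfers hC),
      polyReduces_fixedSizeCountProblem (count_transfers C)⟩,
    ⟨polyReduces_countProblem ((shapley_transfers hC).trans (fixedSizeCount_transfers hC)),
      polyReduces_shapleyProblem ((count_transfers C).trans
        (fixedSizeCount_transfers_shapley hC))⟩⟩

/-! ## Nest points of β-acyclic hypergraphs -/

section Matrix

variable {p q : ℕ}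

/-- The order of the columns `c < c'` of `M` is lexical, the last row being the most significant. -/
def LexicalColumns (M : Fin p → Fin q → Bool) : Prop :=
  ∀ c c', c < c' → ∀ r, M r c = true → M r c' = false →
    ∃ r', r < r' ∧ M r' c = false ∧ M r' c' = true ∧ ∀ s, r' < s → M s c = M s c'

/-- Binary comparison with the last position as the most significant one: at the last difference
`t`, the larger number has the digit 1, since all lower digits together amount to less than `2 ^ t`.
-/
theorem exists_last_difference (f g : Fin p → Bool)
    (h : ∑ i, (f i).toNat * 2 ^ (i : ℕ) ≤ ∑ i, (g i).toNat * 2 ^ (i : ℕ))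
    {r : Fin p} (hf : f r = true) (hg : g r = false) :
    ∃ r', r < r' ∧ f r' = false ∧ g r' = true ∧ ∀ s, r' < s → f s = g s := by
  let D : Finset (Fin p) := Finset.univ.filter fun i => f i ≠ g i
  have hr : r ∈ D := by simp [D, hf, hg]
  obtain ⟨t, ht, hmax⟩ := D.exists_max_image (fun i => i) ⟨r, hr⟩
  have hagree : ∀ s, t < s → f s = g s := by
    intro s hs
    by_contra hne
    exact absurd (hmax s (by simp [D, hne])) (not_le.2 hs)
  have hne : f t ≠ g t := (Finset.mem_filter.1 ht).2
  have hft : f t = false := by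
    by_contra hft
    have hft : f t = true := by simpa using hft
    have hgt : g t = false := by
      rw [hft] at hne
      simpa using hne.symm
    have hlow : ∑ i ∈ Finset.univ.filter (fun i : Fin p => i < t), 2 ^ (i : ℕ) < 2 ^ (t : ℕ) := by
      refine (Finset.sum_map (Finset.univ.filter fun i : Fin p => i < t) Fin.valEmbedding
        (fun i => 2 ^ i)).symm.trans_lt ?_
      refine Nat.geomSum_lt le_rfl fun k hk => ?_
      obtain ⟨i, hi, rfl⟩ := Finset.mem_map.1 hk
      exact (Finset.mem_filter.1 hi).2
    have hsplit : ∀ u : Fin p → Bool, ∑ i, (u i).toNat * 2 ^ (i : ℕ) =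
        ∑ i ∈ Finset.univ.filter (fun i : Fin p => i < t), (u i).toNat * 2 ^ (i : ℕ) +
        ((u t).toNat * 2 ^ (t : ℕ) +
          ∑ i ∈ Finset.univ.filter (fun i : Fin p => t < i), (u i).toNat * 2 ^ (i : ℕ)) := by
      intro u
      rw [← Finset.sum_filter_add_sum_filter_not _ (fun i : Fin p => i < t)]
      congr 1
      have : Finset.univ.filter (fun i : Fin p => ¬ i < t) =
          insert t (Finset.univ.filter fun i : Fin p => t < i) := by
        ext i
        simp only [Finset.mem_filter, Finset.mem_univ, true_and, Finset.mem_insert, not_lt]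
        rw [le_iff_eq_or_lt, eq_comm]
      rw [this, Finset.sum_insert (by simp)]
    rw [hsplit f, hsplit g, hft, hgt] at h
    have h1 : ∑ i ∈ Finset.univ.filter (fun i : Fin p => t < i), (f i).toNat * 2 ^ (i : ℕ) =
        ∑ i ∈ Finset.univ.filter (fun i : Fin p => t < i), (g i).toNat * 2 ^ (i : ℕ) :=
      Finset.sum_congr rfl fun i hi => by rw [hagree i (Finset.mem_filter.1 hi).2]
    have h2 : ∑ i ∈ Finset.univ.filter (fun i : Fin p => i < t), (g i).toNat * 2 ^ (i : ℕ) ≤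
        ∑ i ∈ Finset.univ.filter (fun i : Fin p => i < t), 2 ^ (i : ℕ) :=
      Finset.sum_le_sum fun i _ => by
        have := Nat.mul_le_mul_right (2 ^ (i : ℕ)) (Bool.toNat_le (g i))
        omega
    simp only [Bool.toNat_true, Bool.toNat_false] at h
    omega
  refine ⟨t, lt_of_le_of_ne (hmax r hr) ?_, hft, ?_, hagree⟩
  · rintro rfl
    rw [hf] at hft
    exact absurd hft (by simp)
  · rw [hft] at hne
    simpa using hne.symm

/-- The potential that is maximal at doubly lexical orders. -/
def lexPotential (M : Fin p → Fin q → Bool) : ℕ :=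
  ∑ c : Fin q, (∑ r : Fin p, (M r c).toNat * 2 ^ (r : ℕ)) * 2 ^ (c : ℕ)

theorem lexPotential_transpose (M : Fin p → Fin q → Bool) :
    lexPotential (fun c r => M r c) = lexPotential M := by
  simp only [lexPotential, Finset.sum_mul]
  rw [Finset.sum_comm]
  exact Finset.sum_congr rfl fun r _ => Finset.sum_congr rfl fun c _ => by ring

/-- Exchange argument: if the columns `c` and `c'` have the values `N c` and `N c'`, swapping them
changes the potential by `(N c - N c') * (2 ^ c' - 2 ^ c)`. -/
theorem sum_le_of_lexPotential_max {M : Fin p → Fin q → Bool}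
    (h : ∀ τ : Equiv.Perm (Fin q), lexPotential (fun r c => M r (τ c)) ≤ lexPotential M)
    {c c' : Fin q} (hc : c < c') :
    ∑ r, (M r c).toNat * 2 ^ (r : ℕ) ≤ ∑ r, (M r c').toNat * 2 ^ (r : ℕ) := by
  have h1 := h (Equiv.swap c c')
  simp only [lexPotential] at h1
  set N : Fin q → ℕ := fun c => ∑ r, (M r c).toNat * 2 ^ (r : ℕ) with hN
  change ∑ d, N (Equiv.swap c c' d) * 2 ^ (d : ℕ) ≤ ∑ d, N d * 2 ^ (d : ℕ) at h1
  change N c ≤ N c'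
  have hmem : c' ∈ (Finset.univ : Finset (Fin q)).erase c := by simp [hc.ne']
  rw [← Finset.add_sum_erase _ _ (Finset.mem_univ c), ← Finset.add_sum_erase _ _ hmem,
    ← Finset.add_sum_erase _ (fun d : Fin q => N d * 2 ^ (d : ℕ)) (Finset.mem_univ c),
    ← Finset.add_sum_erase _ (fun d : Fin q => N d * 2 ^ (d : ℕ)) hmem] at h1
  have h2 : ∑ d ∈ (Finset.univ.erase c).erase c', N (Equiv.swap c c' d) * 2 ^ (d : ℕ) =
      ∑ d ∈ (Finset.univ.erase c).erase c', N d * 2 ^ (d : ℕ) := by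
    refine Finset.sum_congr rfl fun d hd => ?_
    simp only [Finset.mem_erase] at hd
    rw [Equiv.swap_apply_of_ne_of_ne hd.2.1 hd.1]
  rw [h2, Equiv.swap_apply_left, Equiv.swap_apply_right] at h1
  have h3 : 2 ^ (c : ℕ) < 2 ^ (c' : ℕ) := Nat.pow_lt_pow_right (by omega) hc
  by_contra h4
  push Not at h4
  nlinarith

/-- Every 0-1 matrix has a doubly lexical order of its rows and columns. -/
theorem exists_doubly_lexical (A : Fin p → Fin q → Bool) :
    ∃ (σ : Equiv.Perm (Fin p)) (τ : Equiv.Perm (Fin q)),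
      LexicalColumns (fun r c => A (σ r) (τ c)) ∧ LexicalColumns (fun c r => A (σ r) (τ c)) := by
  obtain ⟨⟨σ, τ⟩, hmax⟩ := Finite.exists_max fun x : Equiv.Perm (Fin p) × Equiv.Perm (Fin q) =>
    lexPotential fun r c => A (x.1 r) (x.2 c)
  refine ⟨σ, τ, fun c c' hc r h1 h2 => ?_, fun r r' hr c h1 h2 => ?_⟩
  · refine exists_last_difference _ _
      (sum_le_of_lexPotential_max (M := fun r c => A (σ r) (τ c)) (fun π => ?_) hc) h1 h2
    exact hmax (σ, π.trans τ)
  · refine exists_last_difference _ _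
      (sum_le_of_lexPotential_max (M := fun c r => A (σ r) (τ c)) (fun π => ?_) hr) h1 h2
    rw [lexPotential_transpose fun r c => A (σ r) (τ c),
      lexPotential_transpose fun r c => A (σ (π r)) (τ c)]
    exact hmax (π.trans σ, τ)

/-- Rows `r 0 < r 1 < ⋯` and columns `c 0 < c 1 < ⋯` of a doubly lexical matrix that form an
induced path of the incidence graph. -/
structure Zigzag (M : Fin p → Fin q → Bool) (k : ℕ) (r : ℕ → Fin p) (c : ℕ → Fin q) : Prop where
  entry : ∀ i j, i < k → j < k → (M (r i) (c j) = true ↔ (i = 0 ∧ j = 0) ∨ i + 1 = j ∨ j + 1 = i)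
  row_lt : ∀ i, i + 1 < k → r i < r (i + 1)
  col_lt : ∀ i, i + 1 < k → c i < c (i + 1)
  col_agree : ∀ i, i + 2 < k → ∀ s, r (i + 2) < s → M s (c i) = M s (c (i + 1))
  row_agree : ∀ i, i + 2 < k → ∀ s, c (i + 2) < s → M (r i) s = M (r (i + 1)) s

theorem Zigzag.transpose {M : Fin p → Fin q → Bool} {k : ℕ} {r : ℕ → Fin p} {c : ℕ → Fin q}
    (h : Zigzag M k r c) : Zigzag (fun c r => M r c) k c r :=
  ⟨fun i j hi hj => by rw [h.entry j i hj hi]; omega, h.col_lt, h.row_lt, h.row_agree, h.col_agree⟩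

/-- In row `r (k + 1)` the column `c k` has a 1 and the later column `c (k + 1)` a 0, so a later row
has these entries exchanged; the last difference is taken. By `col_agree` the entry 0 in column `c
k` passes down to all earlier columns of the path. -/
theorem Zigzag.exists_row {M : Fin p → Fin q → Bool} (hM : LexicalColumns M) {k : ℕ}
    {r : ℕ → Fin p} {c : ℕ → Fin q} (h : Zigzag M (k + 2) r c) :
    ∃ r', r (k + 1) < r' ∧ (∀ j, j < k + 2 → (M r' (c j) = true ↔ j = k + 1)) ∧
      ∀ s, r' < s → M s (c k) = M s (c (k + 1)) := by
  obtain ⟨r', h1, h2, h3, h4⟩ := hM (c k) (c (k + 1)) (h.col_lt k (by omega)) (r (k + 1))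
    ((h.entry _ _ (by omega) (by omega)).2 (by omega))
    (by
      rw [Bool.eq_false_iff, ne_eq, h.entry _ _ (by omega) (by omega)]
      omega)
  have hrow : ∀ i d, i + d = k + 1 → r i ≤ r (k + 1) := by
    intro i d
    induction d generalizing i with
    | zero => rintro rfl; exact le_rfl
    | succ d ih =>
      intro hi
      exact (h.row_lt i (by omega)).le.trans (ih (i + 1) (by omega))
  have hzero : ∀ d j, j + d = k → M r' (c j) = false := by
    intro d
    induction d with
    | zero => rintro j rfl; exact h2
    | succ d ih =>
      intro j hj
      rw [h.col_agree j (by omega) r' ((hrow (j + 2) (d - 0) (by omega)).trans_lt h1)]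
      exact ih (j + 1) (by omega)
  refine ⟨r', h1, fun j hj => ?_, h4⟩
  rcases Nat.lt_or_ge k j with hjk | hjk
  · obtain rfl : j = k + 1 := by omega
    simp [h3]
  · rw [hzero (k - j) j (by omega)]
    simp
    omega

/-- A new row and a new column are attached to the two ends of the path. Only their common entry is
undetermined: if it is 0 the path is still induced, and if it is 1 the path closes to a cycle. -/
theorem Zigzag.extend {M : Fin p → Fin q → Bool} (hcol : LexicalColumns M)
    (hrow : LexicalColumns fun c r => M r c) {k : ℕ} {r : ℕ → Fin p} {c : ℕ → Fin q}
    (h : Zigzag M (k + 2) r c) :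
    ∃ (r' : ℕ → Fin p) (c' : ℕ → Fin q),
      (∀ i j, i < k + 3 → j < k + 3 → ¬ (i = k + 2 ∧ j = k + 2) →
        (M (r' i) (c' j) = true ↔ (i = 0 ∧ j = 0) ∨ i + 1 = j ∨ j + 1 = i)) ∧
      (M (r' (k + 2)) (c' (k + 2)) = false → Zigzag M (k + 3) r' c') := by
  obtain ⟨x, hx1, hx2, hx3⟩ := h.exists_row hcol
  obtain ⟨y, hy1, hy2, hy3⟩ := h.transpose.exists_row hrow
  have hr : ∀ i, i < k + 2 → Function.update r (k + 2) x i = r i :=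
    fun i hi => Function.update_of_ne (by omega) _ _
  have hc : ∀ i, i < k + 2 → Function.update c (k + 2) y i = c i :=
    fun i hi => Function.update_of_ne (by omega) _ _
  have hr' : Function.update r (k + 2) x (k + 2) = x := Function.update_self _ _ _
  have hc' : Function.update c (k + 2) y (k + 2) = y := Function.update_self _ _ _
  have hentry : ∀ i j, i < k + 3 → j < k + 3 → ¬ (i = k + 2 ∧ j = k + 2) →
      (M (Function.update r (k + 2) x i) (Function.update c (k + 2) y j) = true ↔
        (i = 0 ∧ j = 0) ∨ i + 1 = j ∨ j + 1 = i) := by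
    intro i j hi hj hij
    rcases Nat.lt_or_ge i (k + 2) with hi2 | hi2
    · rw [hr i hi2]
      rcases Nat.lt_or_ge j (k + 2) with hj2 | hj2
      · rw [hc j hj2, h.entry i j hi2 hj2]
      · obtain rfl : j = k + 2 := by omega
        rw [hc', hy2 i hi2]
        omega
    · obtain rfl : i = k + 2 := by omega
      rw [hr', hc j (by omega), hx2 j (by omega)]
      omega
  refine ⟨Function.update r (k + 2) x, Function.update c (k + 2) y, hentry, fun hlast => ?_⟩
  refine ⟨fun i j hi hj => ?_, fun i hi => ?_, fun i hi => ?_, fun i hi s hs => ?_,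
    fun i hi s hs => ?_⟩
  · by_cases hij : i = k + 2 ∧ j = k + 2
    · rw [hij.1, hij.2, hlast]
      simp
    · exact hentry i j hi hj hij
  · rcases Nat.lt_or_ge (i + 1) (k + 2) with hi2 | hi2
    · rw [hr i (by omega), hr _ hi2]
      exact h.row_lt i hi2
    · obtain rfl : i = k + 1 := by omega
      rw [hr _ (by omega), hr']
      exact hx1
  · rcases Nat.lt_or_ge (i + 1) (k + 2) with hi2 | hi2
    · rw [hc i (by omega), hc _ hi2]
      exact h.col_lt i hi2
    · obtain rfl : i = k + 1 := by omega
      rw [hc _ (by omega), hc']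
      exact hy1
  · rw [hc i (by omega), hc (i + 1) (by omega)]
    rcases Nat.lt_or_ge (i + 2) (k + 2) with hi2 | hi2
    · rw [hr _ hi2] at hs
      exact h.col_agree i hi2 s hs
    · obtain rfl : i = k := by omega
      rw [hr'] at hs
      exact hx3 s hs
  · rw [hr i (by omega), hr (i + 1) (by omega)]
    rcases Nat.lt_or_ge (i + 2) (k + 2) with hi2 | hi2
    · rw [hc _ hi2] at hs
      exact h.row_agree i hi2 s hs
    · obtain rfl : i = k := by omega
      rw [hc'] at hs
      exact hy3 s hs

/-- A path through all indices less than `K` that is closed up at its ends is a cycle; the positions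
on it are numbered from `r 0` on. -/
theorem cycle_of_closed_zigzag {M : Fin p → Fin q → Bool} {m : ℕ} {r : ℕ → Fin p} {c : ℕ → Fin q}
    (h : ∀ i j, i < m + 3 → j < m + 3 → (M (r i) (c j) = true ↔
      (i = 0 ∧ j = 0) ∨ i + 1 = j ∨ j + 1 = i ∨ (i = m + 2 ∧ j = m + 2))) :
    ∃ (S : Fin (m + 3) → Fin p) (x : Fin (m + 3) → Fin q),
      ∀ i j, M (S j) (x i) = true ↔ (j = i ∨ j = i + 1) := by
  -- The cycle is `r 0, c 0, r 1, c 2, r 3, …, r 4, c 3, r 2, c 1`: out along odd rows and even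
  -- columns, back along even rows and odd columns. Truncated subtraction gives `r 0` for `s = 0`.
  refine ⟨fun s => r (if 2 * (s : ℕ) ≤ m + 3 then 2 * (s : ℕ) - 1 else 2 * (m + 3 - s)),
    fun t => c (if 2 * (t : ℕ) ≤ m + 2 then 2 * (t : ℕ) else 2 * (m + 3 - t) - 1), fun i j => ?_⟩
  have hi := i.2
  have hj := j.2
  have hadd : j = i + 1 ↔ ((i : ℕ) + 1 = j ∨ ((i : ℕ) + 1 = m + 3 ∧ (j : ℕ) = 0)) := by
    rw [Fin.ext_iff, Fin.val_add_one]
    split_ifs with hl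
    · have hl' : (i : ℕ) = m + 2 := by rw [hl]; rfl
      omega
    · have : (i : ℕ) ≠ m + 2 := fun h => hl (Fin.ext h)
      omega
  rw [hadd, Fin.ext_iff, h _ _ (by split_ifs <;> omega) (by split_ifs <;> omega)]
  split_ifs <;> omega

/-- In a doubly lexical order of a matrix without cycles, of two rows with an entry in a common
column the first one is contained in the second one to the right of this column. -/
theorem row_subset_of_lexical {M : Fin p → Fin q → Bool} (hcol : LexicalColumns M)
    (hrow : LexicalColumns fun c r => M r c)
    (hcyc : ¬ ∃ (m : ℕ) (S : Fin (m + 3) → Fin p) (x : Fin (m + 3) → Fin q),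
      ∀ i j, M (S j) (x i) = true ↔ (j = i ∨ j = i + 1))
    {r r' : Fin p} {c c' : Fin q} (hr : r < r') (hc : c < c') (h1 : M r c = true)
    (h2 : M r' c = true) (h3 : M r c' = true) : M r' c' = true := by
  by_contra h4
  -- The four entries form the shortest zigzag. Without cycles it can always be extended, but its
  -- rows increase strictly, so there cannot be more than `p` of them.
  have hex : ∀ k, ∃ (r : ℕ → Fin p) (c : ℕ → Fin q), Zigzag M (k + 2) r c := by
    intro k
    induction k with
    | zero =>
      refine ⟨fun i => if i = 0 then r else r', fun i => if i = 0 then c else c', ?_, ?_, ?_, ?_, ?_⟩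
      · intro i j hi hj
        interval_cases i <;> interval_cases j <;> simp [h1, h2, h3, h4]
      · intro i hi
        obtain rfl : i = 0 := by omega
        simpa using hr
      · intro i hi
        obtain rfl : i = 0 := by omega
        simpa using hc
      · intro i hi
        omega
      · intro i hi
        omega
    | succ k ih =>
      obtain ⟨r, c, hz⟩ := ih
      obtain ⟨r', c', he, hz'⟩ := hz.extend hcol hrow
      refine ⟨r', c', hz' ?_⟩
      by_contra hlast
      refine hcyc ⟨k, cycle_of_closed_zigzag (r := r') (c := c') fun i j hi hj => ?_⟩
      by_cases hij : i = k + 2 ∧ j = k + 2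
      · rw [hij.1, hij.2]
        simpa using hlast
      · rw [he i j hi hj hij]
        omega
  obtain ⟨r, c, hz⟩ := hex p
  have hval : ∀ i, i < p + 2 → i ≤ (r i : ℕ) := by
    intro i
    induction i with
    | zero => simp
    | succ i ih =>
      intro hi
      have h5 := ih (by omega)
      have h6 : (r i : ℕ) < r (i + 1) := hz.row_lt i hi
      omega
  have := hval p (by omega)
  have := (r p).2
  omega

end Matrix

/-- `x` is a nest point of the hypergraph with the edges `E` and the vertices `R`: the edges that
contain it are pairwise comparable. -/
def IsNest {V : Type} (E : Finset (Finset V)) (R : Finset V) (x : V) : Prop :=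
  ∀ e ∈ E, ∀ f ∈ E, x ∈ e → x ∈ f → (∀ z ∈ R, z ∈ e → z ∈ f) ∨ (∀ z ∈ R, z ∈ f → z ∈ e)

/-- The matrix has the edges as rows and only the vertices in `R` as columns, so its cycles are
cycles of `E`. In a doubly lexical order, the edges through the vertex of the first column increase,
on `R`, with their row. -/
theorem BetaAcyclic.exists_isNest {V : Type} [DecidableEq V] {E : Finset (Finset V)}
    (hE : BetaAcyclic E) {R : Finset V} (hR : R.Nonempty) : ∃ x ∈ R, IsNest E R x := by
  let A (i : Fin E.card) (j : Fin R.card) : Bool :=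
    decide ((R.equivFin.symm j : V) ∈ (E.equivFin.symm i : Finset V))
  obtain ⟨σ, τ, hcol, hrow⟩ := exists_doubly_lexical A
  have hcyc : ¬ ∃ (m : ℕ) (S : Fin (m + 3) → Fin E.card) (x : Fin (m + 3) → Fin R.card),
      ∀ i j, A (σ (S j)) (τ (x i)) = true ↔ (j = i ∨ j = i + 1) := by
    rintro ⟨m, S, x, h⟩
    refine hE ⟨m, fun j => E.equivFin.symm (σ (S j)), fun i => R.equivFin.symm (τ (x i)),
      fun i => (E.equivFin.symm _).2, fun i j => ?_⟩
    rw [← h i j]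
    simp [A]
  have h0 : 0 < R.card := hR.card_pos
  let x : V := R.equivFin.symm (τ ⟨0, h0⟩)
  refine ⟨x, (R.equivFin.symm _).2, fun e he f hf hxe hxf => ?_⟩
  have key : ∀ e (he : e ∈ E) f (hf : f ∈ E), x ∈ e → x ∈ f →
      σ.symm (E.equivFin ⟨e, he⟩) < σ.symm (E.equivFin ⟨f, hf⟩) → ∀ z ∈ R, z ∈ e → z ∈ f := by
    intro e he f hf hxe hxf hlt z hz hze
    rcases Nat.eq_zero_or_pos (τ.symm (R.equivFin ⟨z, hz⟩)).1 with h | h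
    · have hz0 : τ ⟨0, h0⟩ = R.equivFin ⟨z, hz⟩ := by
        rw [← Equiv.apply_symm_apply τ (R.equivFin ⟨z, hz⟩)]
        congr 1
        exact Fin.ext h.symm
      have : x = z := by simp [x, hz0]
      exact this ▸ hxf
    · have hlt' : (⟨0, h0⟩ : Fin R.card) < τ.symm (R.equivFin ⟨z, hz⟩) := h
      have := row_subset_of_lexical hcol hrow hcyc hlt hlt'
        (by simpa [A] using hxe) (by simpa [A] using hxf) (by simpa [A] using hze)
      simpa [A] using this
  rcases lt_trichotomy (σ.symm (E.equivFin ⟨e, he⟩)) (σ.symm (E.equivFin ⟨f, hf⟩)) with h | h | h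
  · exact Or.inl (key e he f hf hxe hxf h)
  · left
    have : e = f := by simpa using h
    subst this
    exact fun _ _ h => h
  · exact Or.inr (key f hf e he hxf hxe h)

/-! ## Substitution in positive CNFs -/

namespace Form

section Subst

variable {V W : Type}

theorem isPosClause_disj {ι : Type} (x : ι → V) (L : List ι) :
    (disj (L.map fun i => var (x i))).IsPosClause := by
  induction L with
  | nil => exact .empty
  | cons a L ih =>
    cases L with
    | nil => exact .var _
    | cons b L => exact .or (.var _) ih

theorem IsPosClause.subst {θ : V → Form W} (hθ : ∀ x, (θ x).IsPosClause) {A : Form V}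
    (h : A.IsPosClause) : (A.subst θ).IsPosClause := by
  induction h with
  | empty => exact .empty
  | var x => exact hθ x
  | or _ _ ihA ihB => exact .or ihA ihB

theorem IsPosCNF.subst {θ : V → Form W} (hθ : ∀ x, (θ x).IsPosClause) {A : Form V}
    (h : A.IsPosCNF) : (A.subst θ).IsPosCNF := by
  induction h with
  | empty => exact .empty
  | clause h => exact .clause (h.subst hθ)
  | and _ _ ihA ihB => exact .and ihA ihB

variable [DecidableEq V] [DecidableEq W]

theorem IsPosClause.edges_eq {A : Form V} (h : A.IsPosClause) : A.edges = {A.vars} := by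
  cases h <;> rfl

theorem mem_vars_disj {ι : Type} (x : ι → V) (L : List ι) (z : V) :
    z ∈ (disj (L.map fun i => var (x i))).vars ↔ ∃ i ∈ L, x i = z := by
  induction L with
  | nil => simp [disj, vars]
  | cons a L ih =>
    cases L with
    | nil => simp [disj, vars, eq_comm]
    | cons b L =>
      simp only [List.map_cons, disj, vars, Finset.mem_union, Finset.mem_singleton] at ih ⊢
      rw [ih]
      simp [eq_comm]

theorem vars_subst (θ : V → Form W) (A : Form V) :
    (A.subst θ).vars = A.vars.biUnion fun x => (θ x).vars := by
  induction A with
  | const b => rfl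
  | var x => simp [subst, vars]
  | neg A ih => exact ih
  | and A B ihA ihB => simp only [subst, vars, ihA, ihB, Finset.union_biUnion]
  | or A B ihA ihB => simp only [subst, vars, ihA, ihB, Finset.union_biUnion]

theorem IsPosCNF.edges_subst {θ : V → Form W} (hθ : ∀ x, (θ x).IsPosClause) {A : Form V}
    (h : A.IsPosCNF) :
    (A.subst θ).edges = A.edges.image fun e => e.biUnion fun x => (θ x).vars := by
  induction h with
  | empty => rfl
  | clause h => rw [(h.subst hθ).edges_eq, h.edges_eq, vars_subst, Finset.image_singleton]
  | and _ _ ihA ihB =>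
    simp only [Form.subst, edges, ihA, ihB, Finset.image_union]

/-- Substituting the variables by clauses without common variables preserves β-acyclicity. -/
theorem IsPosCNF.betaAcyclic_subst {θ : V → Form W} (hθ : ∀ x, (θ x).IsPosClause)
    (hdisj : ∀ x y z, z ∈ (θ x).vars → z ∈ (θ y).vars → x = y) {A : Form V}
    (h : A.IsPosCNF) (hA : BetaAcyclic A.edges) : BetaAcyclic (A.subst θ).edges := by
  rintro ⟨m, S, z, hS, hz⟩
  rw [h.edges_subst hθ] at hS
  choose S' hS' hSS' using fun i => Finset.mem_image.1 (hS i)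
  have hmem : ∀ i, ∃ x, z i ∈ (θ x).vars := by
    intro i
    have h1 := (hz i i).2 (Or.inl rfl)
    rw [← hSS'] at h1
    obtain ⟨x, -, hx⟩ := Finset.mem_biUnion.1 h1
    exact ⟨x, hx⟩
  choose x hx using hmem
  refine hA ⟨m, S', x, hS', fun i j => ?_⟩
  rw [← hz, ← hSS', Finset.mem_biUnion]
  constructor
  · exact fun h => ⟨x i, h, hx i⟩
  · rintro ⟨y, hy, hzy⟩
    rwa [hdisj _ _ _ (hx i) hzy]

end Subst

end Form

theorem posBetaAcyclicCNF_eq_orClosure : posBetaAcyclicCNF = orClosure posBetaAcyclicCNF := by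
  ext G
  constructor
  · intro hG
    -- A disjunction of one variable is this variable itself, so the substitution is the identity on
    -- formulas.
    refine ⟨G, hG, fun _ => 1, Equiv.sigmaUnique _ _, ?_⟩
    exact (Form.subst_var G.form).symm
  · rintro ⟨F, ⟨hF, hacyc⟩, m, e, hG⟩
    have hG' : G.form = F.form.subst fun i =>
        Form.disj ((List.finRange (m i)).map fun j => Form.var (e ⟨i, j⟩)) := by
      simp only [hG, List.ofFn_eq_map]
    have hθ : ∀ i, (Form.disj ((List.finRange (m i)).map
        fun j => Form.var (e ⟨i, j⟩))).IsPosClause := fun i => Form.isPosClause_disj _ _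
    change G.form.IsPosCNF ∧ BetaAcyclic G.form.edges
    rw [hG']
    refine ⟨hF.subst hθ, hF.betaAcyclic_subst hθ (fun i i' z hz hz' => ?_) hacyc⟩
    obtain ⟨j, -, rfl⟩ := (Form.mem_vars_disj _ _ _).1 hz
    obtain ⟨j', -, h⟩ := (Form.mem_vars_disj _ _ _).1 hz'
    exact (congrArg Sigma.fst (e.injective h)).symm

/-! ## The clauses of a positive CNF -/

namespace Form

/-- The list of the clauses of a positive CNF. -/
def clauses (A : Form ℕ) : List (List ℕ) :=
  A.fold (fun b => bif b then [] else [[]]) (fun x => [[x]]) (fun c => c) (fun c d => c ++ d)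
    fun c d => [c.headD [] ++ d.headD []]

theorem IsPosClause.exists_clauses {A : Form ℕ} (h : A.IsPosClause) :
    ∃ c, A.clauses = [c] ∧ c.toFinset = A.vars ∧ ∀ v, A.eval v = c.any v := by
  induction h with
  | empty => exact ⟨[], rfl, rfl, fun _ => rfl⟩
  | var x => exact ⟨[x], rfl, by simp [vars], fun v => by simp [eval]⟩
  | @or A B _ _ ihA ihB =>
    obtain ⟨c, hc, hc2, hc3⟩ := ihA
    obtain ⟨d, hd, hd2, hd3⟩ := ihB
    refine ⟨c ++ d, ?_, ?_, fun v => ?_⟩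
    · change [A.clauses.headD [] ++ B.clauses.headD []] = _
      rw [hc, hd]
      rfl
    · rw [List.toFinset_append, hc2, hd2, vars]
    · rw [eval, hc3, hd3, List.any_append]

/-- One inclusion between clauses and edges suffices, since β-acyclicity passes to subsets of the
edges. -/
theorem IsPosCNF.clauses_spec {A : Form ℕ} (h : A.IsPosCNF) :
    (∀ c ∈ A.clauses, c.toFinset ∈ A.edges) ∧
      ∀ v, A.eval v = A.clauses.all fun c => c.any v := by
  induction h with
  | empty => exact ⟨by simp [clauses, fold], fun _ => rfl⟩
  | clause h =>
    obtain ⟨c, hc, hc2, hc3⟩ := h.exists_clauses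
    rw [hc, h.edges_eq]
    exact ⟨by simp [hc2], fun v => by simp [hc3]⟩
  | @and A B _ _ ihA ihB =>
    have hcl : (A.and B).clauses = A.clauses ++ B.clauses := rfl
    rw [hcl]
    refine ⟨fun c hc => ?_, fun v => by rw [eval, ihA.2, ihB.2, List.all_append]⟩
    rw [edges, Finset.mem_union]
    exact (List.mem_append.1 hc).imp (ihA.1 c) (ihB.1 c)

theorem sz_clauses_le (A : Form ℕ) : sz A.clauses ≤ 2 * sz A := by
  have hhead : ∀ c : List (List ℕ), sz (c.headD []) ≤ sz c := by
    intro c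
    cases c with
    | nil => exact le_rfl
    | cons a c => rw [List.headD_cons, sz_cons]; omega
  induction A with
  | const b =>
    have h1 : sz (const b : Form ℕ) = 1 + 1 + sz b := rfl
    cases b
    · change 3 ≤ _
      omega
    · change 1 ≤ _
      omega
  | var x =>
    have h1 : sz (var x) = 1 + 2 + sz x := rfl
    change 1 + (1 + sz x + 1) + 1 ≤ _
    omega
  | neg A ih =>
    have h1 : sz A.neg = 1 + 3 + sz A := rfl
    change sz A.clauses ≤ _
    omega
  | and A B ihA ihB =>
    have h1 : sz (A.and B) = 1 + 3 + (1 + sz A + sz B) := rfl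
    have h2 := sz_append A.clauses B.clauses
    change sz (A.clauses ++ B.clauses) ≤ _
    omega
  | or A B ihA ihB =>
    have h1 : sz (A.or B) = 1 + 4 + (1 + sz A + sz B) := rfl
    have h2 := sz_append (A.clauses.headD []) (B.clauses.headD [])
    have h3 := hhead A.clauses
    have h4 := hhead B.clauses
    change 1 + sz (A.clauses.headD [] ++ B.clauses.headD []) + 1 ≤ _
    omega

end Form

@[fun_prop]
theorem PolyTime.clauses {α : Type} [Enc α] {A : α → Form ℕ} (hA : PolyTime A) :
    PolyTime fun a => (A a).clauses := by
  refine PolyTime.formFold (d := []) hA (by fun_prop) (by fun_prop) (by fun_prop) (by fun_prop)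
    (by fun_prop) ?_
  obtain ⟨R, hR⟩ := hA.polySize
  refine ⟨2 * R, fun a B hB => (Form.sz_clauses_le B).trans ?_⟩
  have := hB.trans (hR a)
  simp only [Polynomial.eval_mul, Polynomial.eval_ofNat]
  omega

/-! ## Counting by elimination of nest points

For a sequence `e` of clauses, the variables of a list are eliminated one after the other. The list
is in reverse order: its head is eliminated last. Each clause carries a weight, which counts if the
clause contains none of the remaining variables that are set to 1. -/

section Weights

open Finset

variable (e : ℕ → List ℕ)

/-- The product of the weights of the first `a` clauses, as far as they contain `x`. -/
def edgeProd (x : ℕ) (w : ℕ → ℚ) (a : ℕ) : ℚ := ∏ b ∈ range a with x ∈ e b, w b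

/-- The weights after the elimination of `x`. -/
def elimStep (x : ℕ) (w : ℕ → ℚ) (a : ℕ) : ℚ :=
  if x ∈ e a then (1 + edgeProd e x w (a + 1)) / (1 + edgeProd e x w a) else w a

/-- The weights after the elimination of a list of variables. -/
def weight : List ℕ → ℕ → ℚ
  | [] => fun _ => 0
  | x :: l => elimStep e x (weight l)

/-- The number of sets of variables in `l` that meet all clauses with indices in `U`. -/
def hitCount : List ℕ → Finset ℕ → ℕ
  | [], U => if U = ∅ then 1 else 0
  | x :: l, U => hitCount l U + hitCount l (U.filter fun b => x ∉ e b)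

/-- Among the clauses that contain `y`, those that contain `x` are the last ones. -/
def Follows (x y : ℕ) : Prop := ∀ a b, a < b → y ∈ e a → y ∈ e b → x ∈ e a → x ∈ e b

/-- For each variable in `l`, the indices in `U` of clauses that contain it are the first ones. -/
def InitialIn (l : List ℕ) (U : Finset ℕ) : Prop :=
  ∀ y ∈ l, ∀ a b, a < b → y ∈ e a → y ∈ e b → b ∈ U → a ∈ U

theorem edgeProd_nonneg (x : ℕ) {w : ℕ → ℚ} (hw : ∀ b, 0 ≤ w b) (a : ℕ) : 0 ≤ edgeProd e x w a :=
  prod_nonneg fun b _ => hw b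

theorem weight_nonneg (l : List ℕ) (b : ℕ) : 0 ≤ weight e l b := by
  induction l generalizing b with
  | nil => exact le_rfl
  | cons x l ih =>
    rw [weight, elimStep]
    have h1 := edgeProd_nonneg e x ih
    split_ifs
    · have := h1 b
      have := h1 (b + 1)
      positivity
    · exact ih b

/-- The quotients telescope. The factor 2 is the first denominator, 1 plus the empty product. -/
theorem prod_elimStep_range (x : ℕ) {w : ℕ → ℚ} (hw : ∀ b, 0 ≤ w b) (m : ℕ) :
    2 * ∏ b ∈ range m with x ∈ e b, elimStep e x w b = 1 + edgeProd e x w m := by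
  induction m with
  | zero => norm_num [edgeProd]
  | succ m ih =>
    by_cases hx : x ∈ e m
    · rw [range_add_one, filter_insert, if_pos hx, prod_insert (by simp), elimStep, if_pos hx,
        mul_left_comm, ih]
      have : 1 + edgeProd e x w m ≠ 0 := by
        have := edgeProd_nonneg e x hw m
        positivity
      field_simp
    · have h : (range (m + 1)).filter (fun b => x ∈ e b) = (range m).filter fun b => x ∈ e b := by
        rw [range_add_one, filter_insert, if_neg hx]
      rw [h, ih, edgeProd, edgeProd, h]

/-- The two terms are the cases `x = 0`, where all clauses in `U` are still to be met, and `x = 1`,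
where those that contain `x` drop out. By `hU` the clauses in `U` with `x` are all those below some
index, so their product telescopes. -/
theorem prod_elimStep {x : ℕ} {w : ℕ → ℚ} (hw : ∀ b, 0 ≤ w b) {U : Finset ℕ}
    (hU : ∀ a b, a < b → x ∈ e a → x ∈ e b → b ∈ U → a ∈ U) :
    2 * ∏ b ∈ U, elimStep e x w b = ∏ b ∈ U, w b + ∏ b ∈ U with x ∉ e b, w b := by
  have hrest : ∏ b ∈ U with x ∉ e b, elimStep e x w b = ∏ b ∈ U with x ∉ e b, w b :=
    prod_congr rfl fun b hb => by rw [elimStep, if_neg (mem_filter.1 hb).2]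
  obtain ⟨m, hm⟩ : ∃ m, U.filter (fun b => x ∈ e b) = (range m).filter fun b => x ∈ e b := by
    rcases (U.filter fun b => x ∈ e b).eq_empty_or_nonempty with h | h
    · exact ⟨0, by rw [h]; rfl⟩
    · obtain ⟨t, ht, hmax⟩ := exists_max_image _ (fun i => i) h
      refine ⟨t + 1, ?_⟩
      ext b
      simp only [mem_filter, mem_range] at ht hmax ⊢
      constructor
      · exact fun hb => ⟨Nat.lt_succ_iff.2 (hmax b hb), hb.2⟩
      · rintro ⟨hb, hxb⟩
        refine ⟨?_, hxb⟩
        rcases Nat.lt_or_ge b t with hbt | hbt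
        · exact hU b t hbt hxb ht.2 ht.1
        · obtain rfl : b = t := by omega
          exact ht.1
  rw [← prod_filter_mul_prod_filter_not U (fun b => x ∈ e b) (fun b => elimStep e x w b),
    ← prod_filter_mul_prod_filter_not U (fun b => x ∈ e b) w, hrest, hm, ← mul_assoc,
    prod_elimStep_range e x hw, edgeProd]
  ring

variable {e}

theorem InitialIn.filter_notMem {x : ℕ} {l : List ℕ} {U : Finset ℕ} (h : InitialIn e l U)
    (hx : ∀ y ∈ l, Follows e x y) : InitialIn e l (U.filter fun b => x ∉ e b) := by
  intro y hy a b hab hya hyb hb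
  rw [mem_filter] at hb ⊢
  exact ⟨h y hy a b hab hya hyb hb.1, fun hxa => hb.2 (hx y hy a b hab hya hyb hxa)⟩

/-- Both sides satisfy the same recursion on the last eliminated variable, by `prod_elimStep`.
Dropping the clauses with `x` keeps `U` initial for the other variables because, by `Follows`, these
clauses come last. With no variables, the weights 0 leave a nonzero product only for `U = ∅`. -/
theorem two_pow_mul_prod_weight {l : List ℕ} (hl : l.Pairwise (Follows e)) {U : Finset ℕ}
    (hU : InitialIn e l U) : 2 ^ l.length * ∏ b ∈ U, weight e l b = hitCount e l U := by
  induction l generalizing U with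
  | nil =>
    rcases U.eq_empty_or_nonempty with rfl | h
    · simp [hitCount]
    · obtain ⟨b, hb⟩ := h
      rw [prod_eq_zero hb rfl, hitCount, if_neg (ne_empty_of_mem hb)]
      simp
  | cons x l ih =>
    obtain ⟨hx, hl⟩ := List.pairwise_cons.1 hl
    have hU' : InitialIn e l U := fun y hy => hU y (List.mem_cons_of_mem x hy)
    rw [hitCount, Nat.cast_add, ← ih hl hU', ← ih hl (hU'.filter_notMem hx), ← mul_add,
      ← prod_elimStep e (weight_nonneg e l) (hU x List.mem_cons_self), List.length_cons, pow_succ]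
    simp only [weight]
    ring

theorem hitCount_le (l : List ℕ) (U : Finset ℕ) : hitCount e l U ≤ 2 ^ l.length := by
  induction l generalizing U with
  | nil => rw [hitCount]; split_ifs <;> simp
  | cons x l ih =>
    rw [hitCount, List.length_cons, pow_succ]
    have := ih U
    have := ih (U.filter fun b => x ∉ e b)
    omega

theorem hitCount_ne_zero {l : List ℕ} {U : Finset ℕ} (h : ∀ b ∈ U, ∃ y ∈ l, y ∈ e b) :
    hitCount e l U ≠ 0 := by
  induction l generalizing U with
  | nil =>
    have : U = ∅ := eq_empty_of_forall_notMem fun b hb => by simpa using h b hb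
    simp [hitCount, this]
  | cons x l ih =>
    have := ih (U := U.filter fun b => x ∉ e b) fun b hb => by
      rw [mem_filter] at hb
      obtain ⟨y, hy, hyb⟩ := h b hb.1
      rcases List.mem_cons.1 hy with rfl | hy
      · exact absurd hyb hb.2
      · exact ⟨y, hy, hyb⟩
    rw [hitCount]
    omega

theorem hitCount_eq_sum {l : List ℕ} (hl : l.Nodup) (U : Finset ℕ) :
    hitCount e l U = ∑ T ∈ l.toFinset.powerset, if ∀ b ∈ U, ∃ x ∈ e b, x ∈ T then 1 else 0 := by
  induction l generalizing U with
  | nil =>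
    rw [hitCount, List.toFinset_nil, powerset_empty, sum_singleton]
    simp [eq_empty_iff_forall_notMem]
  | cons x l ih =>
    obtain ⟨hx, hl⟩ := List.nodup_cons.1 hl
    rw [List.toFinset_cons, sum_powerset_insert (by simpa using hx), hitCount, ih hl, ih hl]
    congr 1
    refine sum_congr rfl fun T _ => ?_
    congr 1
    rw [eq_iff_iff]
    constructor
    · intro h b hb
      by_cases hxb : x ∈ e b
      · exact ⟨x, hxb, mem_insert_self _ _⟩
      · obtain ⟨z, hz, hzT⟩ := h b (mem_filter.2 ⟨hb, hxb⟩)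
        exact ⟨z, hz, mem_insert_of_mem hzT⟩
    · intro h b hb
      rw [mem_filter] at hb
      obtain ⟨z, hz, hzT⟩ := h b hb.1
      rcases mem_insert.1 hzT with rfl | hzT
      · exact absurd hz hb.2
      · exact ⟨z, hz, hzT⟩

/-- The product over the clauses with `x` is the product over `U` divided by that over the clauses
in `U` without `x`, and both are hit counts up to the same power of 2. -/
theorem exists_edgeProd_weight_eq {x : ℕ} {l : List ℕ} (hl : (x :: l).Pairwise (Follows e))
    (a : ℕ) : ∃ A B : ℕ, A ≤ 2 ^ l.length ∧ B ≤ 2 ^ l.length ∧ B ≠ 0 ∧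
      edgeProd e x (weight e l) a = (A : ℚ) / B := by
  obtain ⟨hx, hl⟩ := List.pairwise_cons.1 hl
  -- Clauses that meet none of the variables are left out, so that the denominator is not zero:
  -- setting all variables in `l` to 1 meets every clause in `U` without `x`.
  let U : Finset ℕ := (range a).filter fun b => ∃ y ∈ x :: l, y ∈ e b
  have hU : InitialIn e l U := by
    intro y hy a' b hab hya hyb hb
    simp only [U, mem_filter, mem_range] at hb ⊢
    exact ⟨hab.trans hb.1, y, List.mem_cons_of_mem x hy, hya⟩
  have hne : hitCount e l (U.filter fun b => x ∉ e b) ≠ 0 := by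
    refine hitCount_ne_zero fun b hb => ?_
    simp only [U, mem_filter] at hb
    obtain ⟨⟨-, y, hy, hyb⟩, hxb⟩ := hb
    rcases List.mem_cons.1 hy with rfl | hy
    · exact absurd hyb hxb
    · exact ⟨y, hy, hyb⟩
  refine ⟨hitCount e l U, _, hitCount_le l U, hitCount_le l (U.filter fun b => x ∉ e b), hne, ?_⟩
  rw [eq_div_iff (by exact_mod_cast hne), ← two_pow_mul_prod_weight hl hU,
    ← two_pow_mul_prod_weight hl (hU.filter_notMem hx),
    ← prod_filter_mul_prod_filter_not U (fun b => x ∈ e b), edgeProd]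
  have : U.filter (fun b => x ∈ e b) = (range a).filter fun b => x ∈ e b := by
    ext b
    simp only [U, mem_filter]
    exact ⟨fun h => ⟨h.1.1, h.2⟩, fun h => ⟨⟨h.1, x, List.mem_cons_self, h.2⟩, h.2⟩⟩
  rw [this]
  ring

/-- A new weight is `(1 + A / B) / (1 + A' / B')` with hit counts, whatever the history of the
weights, so its bit length does not accumulate over the rounds. -/
theorem exists_weight_eq {l : List ℕ} (hl : l.Pairwise (Follows e)) (b : ℕ) :
    ∃ A B : ℕ, A ≤ 2 ^ (2 * l.length) ∧ B ≤ 2 ^ (2 * l.length) ∧ B ≠ 0 ∧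
      weight e l b = (A : ℚ) / B := by
  induction l with
  | nil => exact ⟨0, 1, by simp, by simp, by simp, by simp [weight]⟩
  | cons x l ih =>
    rw [weight, elimStep]
    split_ifs with hx
    · obtain ⟨A, B, hA, hB, hB0, h⟩ := exists_edgeProd_weight_eq hl (b + 1)
      obtain ⟨A', B', hA', hB', hB0', h'⟩ := exists_edgeProd_weight_eq hl b
      have hmul : ∀ c d : ℕ, c ≤ 2 * 2 ^ l.length → d ≤ 2 ^ l.length →
          c * d ≤ 2 ^ (2 * (x :: l).length) := by
        intro c d hc hd
        refine (Nat.mul_le_mul hc hd).trans ?_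
        rw [List.length_cons, mul_assoc, ← pow_add, ← pow_succ']
        exact Nat.pow_le_pow_right (by omega) (by omega)
      refine ⟨(B + A) * B', (B' + A') * B, hmul _ _ (by omega) hB', hmul _ _ (by omega) hB,
        by positivity, ?_⟩
      rw [h, h']
      have h1 : (B : ℚ) ≠ 0 := by exact_mod_cast hB0
      have h2 : (B' : ℚ) ≠ 0 := by exact_mod_cast hB0'
      have h3 : (B' : ℚ) + A' ≠ 0 := by
        have : (0 : ℚ) < B' := by positivity
        positivity
      push_cast
      field_simp
    · obtain ⟨A, B, hA, hB, hB0, h⟩ := ih (List.pairwise_cons.1 hl).2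
      have hle : 2 ^ (2 * l.length) ≤ 2 ^ (2 * (x :: l).length) :=
        Nat.pow_le_pow_right (by omega) (by rw [List.length_cons]; omega)
      exact ⟨A, B, hA.trans hle, hB.trans hle, hB0, h⟩

end Weights

/-! ### The order of the clauses -/

/-- Comparison of two clauses by the first variable of the list that belongs to only one of
them. -/
def LexLe : List ℕ → List ℕ → List ℕ → Prop
  | [], _, _ => True
  | x :: l, c, d => (x ∉ c ∧ x ∈ d) ∨ ((x ∈ c ↔ x ∈ d) ∧ LexLe l c d)

/-- The clauses, sorted by `LexLe`. -/
def radixSort (l : List ℕ) (S : List (List ℕ)) : List (List ℕ) :=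
  l.foldr (fun x S => S.filter (fun c => !decide (x ∈ c)) ++ S.filter fun c => decide (x ∈ c)) S

theorem radixSort_perm (l : List ℕ) (S : List (List ℕ)) : (radixSort l S).Perm S := by
  induction l with
  | nil => exact List.Perm.refl _
  | cons x l ih =>
    refine List.Perm.trans ?_ ih
    refine List.perm_append_comm.trans ?_
    exact List.filter_append_perm _ _

/-- Each pass is stable, and the head of `l` is processed last, so it is the most significant
variable. -/
theorem radixSort_pairwise (l : List ℕ) (S : List (List ℕ)) :
    (radixSort l S).Pairwise (LexLe l) := by
  induction l with
  | nil => exact List.pairwise_of_forall fun _ _ => trivial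
  | cons x l ih =>
    have key : ∀ p : List ℕ → Bool, (∀ c d, p c = true → p d = true → (x ∈ c ↔ x ∈ d)) →
        ((radixSort l S).filter p).Pairwise (LexLe (x :: l)) := by
      intro p hp
      refine List.Pairwise.imp_of_mem ?_ (ih.sublist List.filter_sublist)
      intro c d hc hd h
      exact Or.inr ⟨hp c d (List.mem_filter.1 hc).2 (List.mem_filter.1 hd).2, h⟩
    refine List.pairwise_append.2 ⟨key _ fun c d hc hd => ?_, key _ fun c d hc hd => ?_,
      fun c hc d hd => Or.inl ⟨?_, ?_⟩⟩
    · simp only [Bool.not_eq_true', decide_eq_false_iff_not] at hc hd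
      exact ⟨fun h => absurd h hc, fun h => absurd h hd⟩
    · simp only [decide_eq_true_eq] at hc hd
      exact ⟨fun _ => hd, fun _ => hc⟩
    · simpa using (List.mem_filter.1 hc).2
    · simpa using (List.mem_filter.1 hd).2

/-- At a first difference within `l` the variable would belong to `d` and not to `c`, against `hdc`.
So `c` and `d` agree on `l`. -/
theorem LexLe.subset {l l' : List ℕ} {c d : List ℕ} (h : LexLe (l ++ l') c d)
    (hdc : ∀ x ∈ l, x ∈ d → x ∈ c) : ∀ x ∈ l, x ∈ c → x ∈ d := by
  induction l with
  | nil => simp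
  | cons x l ih =>
    rcases h with h | h
    · exact absurd (hdc x List.mem_cons_self h.2) h.1
    · intro y hy hyc
      rcases List.mem_cons.1 hy with rfl | hy
      · exact h.1.1 hyc
      · exact ih h.2 (fun z hz => hdc z (List.mem_cons_of_mem x hz)) y hy hyc

/-- Each variable in `l` is a nest point with respect to itself, the variables before it in `l`, and
those in `R`. -/
def ElimOrder (E : Finset (Finset ℕ)) : Finset ℕ → List ℕ → Prop
  | _, [] => True
  | R, x :: l => IsNest E (insert x R) x ∧ ElimOrder E (insert x R) l

/-- Let `y` belong to two clauses. As a nest point it makes them comparable on the variables before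
it, and the sorting excludes that the later clause is strictly smaller there. The list `r` collects
the variables already passed by the induction. -/
theorem ElimOrder.follows {E : Finset (Finset ℕ)} {S : List (List ℕ)}
    (hS : ∀ c ∈ S, c.toFinset ∈ E) {l r : List ℕ} (hl : ElimOrder E r.toFinset l)
    (hsort : S.Pairwise (LexLe (r ++ l))) :
    (∀ y ∈ l, ∀ x ∈ r, Follows (fun b => S.getD b []) x y) ∧
      l.Pairwise (Follows fun b => S.getD b []) := by
  induction l generalizing r with
  | nil => simp
  | cons y l ih =>
    obtain ⟨hnest, hl⟩ := hl
    have hr : insert y r.toFinset = (r ++ [y]).toFinset := by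
      ext
      simp
    rw [hr] at hl hnest
    have happ : r ++ y :: l = (r ++ [y]) ++ l := by simp
    rw [happ] at hsort
    obtain ⟨h1, h2⟩ := ih hl hsort
    have hy : ∀ x ∈ r, Follows (fun b => S.getD b []) x y := by
      intro x hx a b hab hya hyb hxa
      have hlt : ∀ {z a : ℕ}, z ∈ S.getD a [] → a < S.length := by
        intro z a hz
        by_contra ha
        rw [List.getD_eq_default _ _ (not_lt.1 ha)] at hz
        simp at hz
      have ha := hlt hya
      have hb := hlt hyb
      simp only [List.getD_eq_getElem _ _ ha, List.getD_eq_getElem _ _ hb] at hya hyb hxa ⊢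
      have hle := List.pairwise_iff_getElem.1 hsort a b ha hb hab
      have hx' : x ∈ r ++ [y] := List.mem_append_left _ hx
      rcases hnest _ (hS _ (List.getElem_mem ha)) _ (hS _ (List.getElem_mem hb))
        (by simpa using hya) (by simpa using hyb) with h | h
      · simpa using h x (List.mem_toFinset.2 hx') (by simpa using hxa)
      · refine hle.subset (fun z hz hzd => ?_) x hx' hxa
        simpa using h z (List.mem_toFinset.2 hz) (by simpa using hzd)
    refine ⟨fun y' hy' x hx => ?_, List.pairwise_cons.2 ⟨fun y' hy' => ?_, h2⟩⟩
    · rcases List.mem_cons.1 hy' with rfl | hy'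
      · exact hy x hx
      · exact h1 y' hy' x (List.mem_append_left _ hx)
    · exact h1 y' hy' y (by simp)

/-! ### The programs -/

theorem sz_perm {α : Type} [Enc α] {l l' : List α} (h : l.Perm l') : sz l = sz l' := by
  induction h with
  | nil => rfl
  | cons a _ ih => rw [sz_cons, sz_cons, ih]
  | swap a b l => simp only [sz_cons]; omega
  | trans _ _ ih₁ ih₂ => exact ih₁.trans ih₂

theorem sz_filter_add_sz_filter_not {α : Type} [Enc α] (p : α → Bool) (l : List α) :
    sz (l.filter p) + sz (l.filter fun a => !p a) = sz l + 1 := by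
  rw [← sz_append, sz_perm (List.filter_append_perm p l)]

theorem sz_add_two_le_of_mem {α : Type} [Enc α] {a : α} {l : List α} (h : a ∈ l) :
    sz a + 2 ≤ sz l := by
  have h1 : sz [a] ≤ sz l := sz_sublist (List.singleton_sublist.2 h)
  rw [sz_cons, sz_nil] at h1
  omega

/-- The test whether `x` is a nest point. -/
def isNestTest (S : List (List ℕ)) (R : List ℕ) (x : ℕ) : Bool :=
  S.all fun c => S.all fun d => !(decide (x ∈ c)) || (!(decide (x ∈ d)) ||
    ((R.all fun z => !(decide (z ∈ c)) || decide (z ∈ d)) ||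
      (R.all fun z => !(decide (z ∈ d)) || decide (z ∈ c))))

theorem isNestTest_iff (S : List (List ℕ)) (R : List ℕ) (x : ℕ) :
    isNestTest S R x = true ↔ IsNest (S.map List.toFinset).toFinset R.toFinset x := by
  simp only [isNestTest, IsNest, List.all_eq_true, Bool.or_eq_true, Bool.not_eq_true',
    decide_eq_false_iff_not, decide_eq_true_eq, List.mem_toFinset, List.mem_map,
    forall_exists_index, and_imp, forall_apply_eq_imp_iff₂]
  refine forall₂_congr fun c _ => forall₂_congr fun d _ => ?_
  simp only [imp_iff_not_or]

/-- The first nest point. -/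
def nestPoint (S : List (List ℕ)) (R : List ℕ) : ℕ := (R.filter fun x => isNestTest S R x).headD 0

/-- One round of the computation of an elimination order: the first nest point is moved from the
remaining to the eliminated variables. -/
def orderStep (S : List (List ℕ)) (s : List ℕ × List ℕ) : List ℕ × List ℕ :=
  (s.1.filter fun z => !decide (z = nestPoint S s.1), nestPoint S s.1 :: s.2)

/-- An elimination order for the variables in `V`. -/
def elimOrder (V : List ℕ) (S : List (List ℕ)) : List ℕ :=
  (V.foldl (fun s _ => orderStep S s) (V, [])).2

/-- `edgeProd`, for lists of clauses and weights. -/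
def listEdgeProd (S : List (List ℕ)) (x : ℕ) (w : List ℚ) (a : ℕ) : ℚ :=
  (((List.range S.length).filter fun b => decide (b < a)).map fun b =>
    if x ∈ S.getD b [] then w.getD b 0 else (1 : ℚ)).prod

/-- `elimStep`, for lists of clauses and weights. -/
def listElimStep (S : List (List ℕ)) (x : ℕ) (w : List ℚ) : List ℚ :=
  (List.range S.length).map fun a => if x ∈ S.getD a [] then
    ((1 : ℚ) + listEdgeProd S x w (a + 1)) / ((1 : ℚ) + listEdgeProd S x w a) else w.getD a 0

/-- `weight`, for lists of clauses and weights. -/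
def listWeight (S : List (List ℕ)) (l : List ℕ) : List ℚ :=
  l.foldr (listElimStep S) (S.map fun _ => (0 : ℚ))

theorem listElimStep_eq (S : List (List ℕ)) (x : ℕ) (w : ℕ → ℚ) :
    listElimStep S x ((List.range S.length).map w) =
      (List.range S.length).map (elimStep (fun b => S.getD b []) x w) := by
  have hprod : ∀ a ≤ S.length, listEdgeProd S x ((List.range S.length).map w) a =
      edgeProd (fun b => S.getD b []) x w a := by
    intro a ha
    rw [listEdgeProd, filter_lt_range ha, prod_map_range, edgeProd, Finset.prod_filter]
    refine Finset.prod_congr rfl fun b hb => ?_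
    rw [getD_map_range _ _ _ _ ((Finset.mem_range.1 hb).trans_le ha)]
  refine List.map_congr_left fun a ha => ?_
  have ha := List.mem_range.1 ha
  rw [hprod _ ha, hprod _ ha.le, getD_map_range _ _ _ _ ha]
  rfl

theorem listWeight_eq (S : List (List ℕ)) (l : List ℕ) :
    listWeight S l = (List.range S.length).map (weight (fun b => S.getD b []) l) := by
  induction l with
  | nil =>
    change S.map _ = (List.range S.length).map fun _ => (0 : ℚ)
    rw [List.map_const', List.map_const', List.length_range]
  | cons x l ih =>
    change listElimStep S x (listWeight S l) = _
    rw [ih, listElimStep_eq]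
    rfl

/-- The number of sets of variables in `V` that meet all clauses in `S`, computed by elimination of
nest points. -/
def nestCount (V : List ℕ) (S : List (List ℕ)) : ℕ :=
  (((listPow V 2 V.length : ℕ) : ℚ) * ((listWeight (radixSort (elimOrder V S) S)
    (elimOrder V S)).map fun w => w).prod).num.natAbs

section Programs

variable {α : Type} [Enc α]

@[fun_prop]
theorem PolyTime.isNestTest {S : α → List (List ℕ)} {R : α → List ℕ} {x : α → ℕ}
    (hS : PolyTime S) (hR : PolyTime R) (hx : PolyTime x) :
    PolyTime fun a => isNestTest (S a) (R a) (x a) := by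
  unfold ShapMC.isNestTest
  fun_prop

@[fun_prop]
theorem PolyTime.nestPoint {S : α → List (List ℕ)} {R : α → List ℕ} (hS : PolyTime S)
    (hR : PolyTime R) : PolyTime fun a => nestPoint (S a) (R a) := by
  unfold ShapMC.nestPoint
  fun_prop

/-- A nest point is only moved from one list to the other. If there is none, the default value 0 is
added, which has size 1. -/
theorem sz_orderStep_le (S : List (List ℕ)) (s : List ℕ × List ℕ) :
    sz (orderStep S s) ≤ sz s + 2 := by
  rw [orderStep, sz_prod, sz_cons, sz_prod]
  have h := sz_filter_add_sz_filter_not (fun z => decide (z = nestPoint S s.1)) s.1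
  by_cases hx : nestPoint S s.1 ∈ s.1
  · have h1 : sz (nestPoint S s.1) + 2 ≤ sz (s.1.filter fun z => decide (z = nestPoint S s.1)) :=
      sz_add_two_le_of_mem (List.mem_filter.2 ⟨hx, by simp⟩)
    simp only at h h1 ⊢
    omega
  · have h0 : nestPoint S s.1 = 0 := by
      rw [nestPoint] at hx ⊢
      cases hf : s.1.filter fun x => isNestTest S s.1 x with
      | nil => rfl
      | cons y t =>
        rw [hf] at hx
        exact absurd (List.mem_of_mem_filter (hf ▸ List.mem_cons_self)) hx
    have h1 := sz_pos (s.1.filter fun z => decide (z = nestPoint S s.1))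
    have h2 : sz (nestPoint S s.1) = 1 := by rw [h0]; rfl
    simp only at h h1 ⊢
    omega

@[fun_prop]
theorem PolyTime.elimOrder {V : α → List ℕ} {S : α → List (List ℕ)} (hV : PolyTime V)
    (hS : PolyTime S) : PolyTime fun a => elimOrder (V a) (S a) := by
  refine PolyTime.snd (PolyTime.foldl (step := fun a s _ => orderStep (S a) s) hV (by fun_prop) ?_
    ⟨2, fun a s _ => (sz_orderStep_le _ s).trans (by simp)⟩)
  unfold orderStep
  fun_prop

@[fun_prop]
theorem PolyTime.radixSort {l : α → List ℕ} {S : α → List (List ℕ)} (hl : PolyTime l)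
    (hS : PolyTime S) : PolyTime fun a => radixSort (l a) (S a) := by
  have h := PolyTime.foldl (step := fun (_ : α) (S : List (List ℕ)) (x : ℕ) =>
    S.filter (fun c => !decide (x ∈ c)) ++ S.filter fun c => decide (x ∈ c)) hl.reverse hS
    (by fun_prop) ⟨0, fun a S x => by
      rw [sz_perm (List.perm_append_comm.trans (List.filter_append_perm _ _))]
      simp⟩
  exact h.congr fun a => by rw [List.foldl_reverse, ShapMC.radixSort]

@[fun_prop]
theorem PolyTime.listEdgeProd {S : α → List (List ℕ)} {x : α → ℕ} {w : α → List ℚ} {i : α → ℕ}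
    (hS : PolyTime S) (hx : PolyTime x) (hw : PolyTime w) (hi : PolyTime i) :
    PolyTime fun a => listEdgeProd (S a) (x a) (w a) (i a) := by
  unfold ShapMC.listEdgeProd
  fun_prop

@[fun_prop]
theorem PolyTime.listElimStep {S : α → List (List ℕ)} {x : α → ℕ} {w : α → List ℚ}
    (hS : PolyTime S) (hx : PolyTime x) (hw : PolyTime w) :
    PolyTime fun a => listElimStep (S a) (x a) (w a) := by
  unfold ShapMC.listElimStep
  fun_prop

/-- The weights can be computed in polynomial time since they are quotients of numbers of sets of
variables. -/
theorem PolyTime.listWeight {S : α → List (List ℕ)} {l : α → List ℕ} (hS : PolyTime S)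
    (hl : PolyTime l) (h : ∀ a, (l a).Pairwise (Follows fun b => (S a).getD b [])) :
    PolyTime fun a => listWeight (S a) (l a) := by
  have key := PolyTime.foldl_of_bound (step := fun (a : α) (w : List ℚ) (x : ℕ) =>
    ShapMC.listElimStep (S a) x w) (init := fun a => (S a).map fun _ => (0 : ℚ)) hl.reverse
    (by fun_prop) (by fun_prop) ?_
  · exact key.congr fun a => by rw [List.foldl_reverse, ShapMC.listWeight]
  obtain ⟨P, hP⟩ := hS.polySize
  obtain ⟨Q, hQ⟩ := hl.polySize
  refine ⟨1 + P * (1 + (8 + 2 * (2 * Q))), fun a k hk => ?_⟩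
  have hk' : k.foldl (fun (w : List ℚ) (x : ℕ) => ShapMC.listElimStep (S a) x w)
      ((S a).map fun _ => (0 : ℚ)) = ShapMC.listWeight (S a) k.reverse := by
    rw [ShapMC.listWeight, List.foldr_reverse]
  -- The intermediate results are the weights for the suffixes of `l a`, to which `exists_weight_eq`
  -- applies as well.
  have hsuf : k.reverse <:+ l a := by
    rw [← List.reverse_reverse (l a)]
    exact List.reverse_suffix.2 hk
  have hlenS : (S a).length ≤ P.eval (sz a) := (length_lt_sz _).le.trans (hP a)
  have hlenk : k.reverse.length ≤ Q.eval (sz a) :=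
    hsuf.length_le.trans ((length_lt_sz _).le.trans (hQ a))
  rw [hk', listWeight_eq]
  refine (sz_list_le (B := 8 + 2 * (2 * Q.eval (sz a))) fun q hq => ?_).trans ?_
  · obtain ⟨b, -, rfl⟩ := List.mem_map.1 hq
    obtain ⟨A, B, hA, hB, hB0, heq⟩ := exists_weight_eq ((h a).sublist hsuf.sublist) b
    rw [heq]
    have := sz_div_le (z := (A : ℤ)) (by simpa using hA) hB0 hB
    simp only [Int.cast_natCast] at this
    omega
  · simp only [List.length_map, List.length_range, Polynomial.eval_add, Polynomial.eval_mul,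
      Polynomial.eval_one, Polynomial.eval_ofNat]
    gcongr

theorem PolyTime.nestCount {V : α → List ℕ} {S : α → List (List ℕ)} (hV : PolyTime V)
    (hS : PolyTime S) (h : ∀ a, (ShapMC.elimOrder (V a) (S a)).Pairwise
      (Follows fun b => (ShapMC.radixSort (ShapMC.elimOrder (V a) (S a)) (S a)).getD b [])) :
    PolyTime fun a => nestCount (V a) (S a) := by
  have := PolyTime.listWeight (by fun_prop) (by fun_prop) h
  unfold ShapMC.nestCount
  fun_prop

end Programs

/-! ### Correctness -/

/-- Loop invariant: remaining and eliminated variables partition `V`, and the eliminated ones form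
an elimination order relative to the remaining ones. By β-acyclicity a nest point exists as long as
variables remain. The list of the fold only counts the rounds. -/
theorem elimOrder_spec {V : List ℕ} {S : List (List ℕ)}
    (hS : BetaAcyclic (S.map List.toFinset).toFinset) (hV : V.Nodup) :
    (elimOrder V S).Nodup ∧ (elimOrder V S).toFinset = V.toFinset ∧
      ElimOrder (S.map List.toFinset).toFinset ∅ (elimOrder V S) := by
  have key : ∀ L : List ℕ, L.length ≤ V.length →
      (L.foldl (fun s _ => orderStep S s) (V, [])).2.Nodup ∧
      Disjoint (L.foldl (fun s _ => orderStep S s) (V, [])).1.toFinset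
        (L.foldl (fun s _ => orderStep S s) (V, [])).2.toFinset ∧
      (L.foldl (fun s _ => orderStep S s) (V, [])).1.toFinset ∪
        (L.foldl (fun s _ => orderStep S s) (V, [])).2.toFinset = V.toFinset ∧
      (L.foldl (fun s _ => orderStep S s) (V, [])).1.toFinset.card + L.length = V.length ∧
      ElimOrder (S.map List.toFinset).toFinset
        (L.foldl (fun s _ => orderStep S s) (V, [])).1.toFinset
        (L.foldl (fun s _ => orderStep S s) (V, [])).2 := by
    intro L
    induction L using List.reverseRecOn with
    | nil =>
      intro _
      simp [ElimOrder, List.toFinset_card_of_nodup hV]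
    | append_singleton L y ih =>
      intro hL
      rw [List.length_append, List.length_singleton] at hL
      rw [List.foldl_append, List.foldl_cons, List.foldl_nil]
      obtain ⟨h1, h2, h3, h4, h5⟩ := ih (by omega)
      set s := L.foldl (fun s _ => orderStep S s) (V, []) with hs
      obtain ⟨x, hx, hnest⟩ := hS.exists_isNest (R := s.1.toFinset)
        (Finset.card_pos.1 (by omega))
      have hmem : nestPoint S s.1 ∈ s.1.filter fun x => isNestTest S s.1 x := by
        have hx' : x ∈ s.1.filter fun x => isNestTest S s.1 x :=
          List.mem_filter.2 ⟨List.mem_toFinset.1 hx, (isNestTest_iff _ _ _).2 hnest⟩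
        rw [nestPoint]
        cases hf : s.1.filter fun x => isNestTest S s.1 x with
        | nil => simp [hf] at hx'
        | cons z t => simp
      rw [List.mem_filter, isNestTest_iff] at hmem
      obtain ⟨hmem, hnest⟩ := hmem
      have hfin : (orderStep S s).1.toFinset = s.1.toFinset.erase (nestPoint S s.1) := by
        ext z
        simp [orderStep, and_comm]
      have hx1 : nestPoint S s.1 ∈ s.1.toFinset := List.mem_toFinset.2 hmem
      have hx2 : nestPoint S s.1 ∉ s.2.toFinset := Finset.disjoint_left.1 h2 hx1
      rw [hfin]
      simp only [orderStep, List.toFinset_cons]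
      refine ⟨List.nodup_cons.2 ⟨fun h => hx2 (List.mem_toFinset.2 h), h1⟩, ?_, ?_, ?_, ?_⟩
      · rw [Finset.disjoint_insert_right]
        exact ⟨by simp, h2.mono_left (Finset.erase_subset _ _)⟩
      · rw [Finset.union_insert, ← Finset.insert_union, Finset.insert_erase hx1, h3]
      · rw [List.length_append, List.length_singleton, Finset.card_erase_of_mem hx1]
        have := Finset.card_pos.2 ⟨_, hx1⟩
        omega
      · rw [ElimOrder, Finset.insert_erase hx1]
        exact ⟨hnest, h5⟩
  obtain ⟨h1, -, h3, h4, h5⟩ := key V le_rfl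
  have h6 : (V.foldl (fun s _ => orderStep S s) (V, [])).1.toFinset = ∅ :=
    Finset.card_eq_zero.1 (by omega)
  rw [h6] at h3 h5
  rw [Finset.empty_union] at h3
  exact ⟨h1, h3, h5⟩

theorem pairwise_follows_elimOrder {V : List ℕ} {S : List (List ℕ)}
    (hS : BetaAcyclic (S.map List.toFinset).toFinset) (hV : V.Nodup) :
    (elimOrder V S).Pairwise (Follows fun b => (radixSort (elimOrder V S) S).getD b []) := by
  refine (ElimOrder.follows (E := (S.map List.toFinset).toFinset) (r := []) (fun c hc => ?_)
    (elimOrder_spec hS hV).2.2 (radixSort_pairwise _ _)).2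
  exact List.mem_toFinset.2 (List.mem_map_of_mem ((radixSort_perm _ _).mem_iff.1 hc))

theorem nestCount_eq_sum {V : List ℕ} {S : List (List ℕ)}
    (hS : BetaAcyclic (S.map List.toFinset).toFinset) {n : ℕ} (hV : V = List.range n) :
    nestCount V S = ∑ T ∈ (Finset.range n).powerset,
      if ∀ c ∈ S, ∃ x ∈ c, x ∈ T then 1 else 0 := by
  have hnodup : V.Nodup := hV ▸ List.nodup_range
  obtain ⟨h1, h2, -⟩ := elimOrder_spec hS hnodup
  have h3 := pairwise_follows_elimOrder hS hnodup
  set l := elimOrder V S with hl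
  set S' := radixSort l S with hS'
  have hlen : l.length = n := by
    rw [← List.toFinset_card_of_nodup h1, h2, List.toFinset_card_of_nodup hnodup, hV,
      List.length_range]
  -- The set of all clause indices is closed downwards, hence initial for every variable.
  have hmain := two_pow_mul_prod_weight h3 (U := Finset.range S'.length)
    fun y _ a b hab _ _ hb => Finset.mem_range.2 (hab.trans (Finset.mem_range.1 hb))
  rw [nestCount, ← hl, ← hS', List.map_id', listWeight_eq, prod_map_range, hV, List.length_range,
    listPow_range _ le_rfl]
  rw [hlen] at hmain
  push_cast
  rw [hmain, Rat.num_natCast, Int.natAbs_natCast, hitCount_eq_sum h1, h2, hV]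
  refine Finset.sum_congr (by rw [List.toFinset_range]) fun T _ => ?_
  congr 1
  rw [eq_iff_iff]
  constructor
  · intro h c hc
    obtain ⟨b, hb, rfl⟩ := List.mem_iff_getElem.1 ((radixSort_perm l S).mem_iff.2 hc)
    have := h b (Finset.mem_range.2 hb)
    rwa [List.getD_eq_getElem _ _ hb] at this
  · intro h b hb
    have hb := Finset.mem_range.1 hb
    rw [List.getD_eq_getElem _ _ hb]
    exact h _ ((radixSort_perm l S).mem_iff.1 (List.getElem_mem hb))

theorem BoolFun.count_eq_sum_range (F : BoolFun) :
    F.count = ∑ T ∈ (Finset.range F.n).powerset,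
      (F.form.toNat.eval fun x => decide (x ∈ T)).toNat := by
  rw [BoolFun.count]
  refine Finset.sum_bij (fun T _ => T.map Fin.valEmbedding) (fun T _ => ?_)
    (fun T _ T' _ h => Finset.map_injective _ h) (fun T hT => ?_) fun T _ => ?_
  · refine Finset.mem_powerset.2 fun x hx => ?_
    obtain ⟨i, -, rfl⟩ := Finset.mem_map.1 hx
    exact Finset.mem_range.2 i.2
  · refine ⟨Finset.univ.filter fun i : Fin F.n => i.val ∈ T, Finset.mem_univ _, ?_⟩
    ext x
    simp only [Finset.mem_map, Finset.mem_filter, Finset.mem_univ, true_and,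
      Fin.valEmbedding_apply]
    constructor
    · rintro ⟨i, hi, rfl⟩
      exact hi
    · intro hx
      exact ⟨⟨x, Finset.mem_range.1 (Finset.mem_powerset.1 hT hx)⟩, hx, rfl⟩
  · rw [BoolFun.val, Form.toNat, Form.eval_subst]
    congr 2
    funext i
    simp [Form.eval, Fin.val_inj]

theorem betaAcyclic_clauses {F : BoolFun} (hF : F ∈ posBetaAcyclicCNF) :
    F.form.toNat.IsPosCNF ∧
      BetaAcyclic (F.form.toNat.clauses.map List.toFinset).toFinset := by
  have hθ : ∀ i : Fin F.n, (Form.var i.val).IsPosClause := fun i => .var _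
  have h1 : F.form.toNat.IsPosCNF := hF.1.subst hθ
  have h2 : BetaAcyclic F.form.toNat.edges := by
    refine hF.1.betaAcyclic_subst hθ (fun i j z hi hj => ?_) hF.2
    simp only [Form.vars, Finset.mem_singleton] at hi hj
    exact Fin.ext (hi.symm.trans hj)
  refine ⟨h1, ?_⟩
  rintro ⟨m, S, x, hS, hx⟩
  refine h2 ⟨m, S, x, fun i => ?_, hx⟩
  obtain ⟨c, hc, hcS⟩ := List.mem_map.1 (List.mem_toFinset.1 (hS i))
  exact hcS ▸ h1.clauses_spec.1 c hc

theorem count_eq_nestCount {F : BoolFun} (hF : F ∈ posBetaAcyclicCNF) :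
    F.count = nestCount (List.range F.n) F.form.toNat.clauses := by
  obtain ⟨h1, h2⟩ := betaAcyclic_clauses hF
  rw [nestCount_eq_sum h2 rfl, F.count_eq_sum_range]
  refine Finset.sum_congr rfl fun T _ => ?_
  rw [h1.clauses_spec.2]
  split_ifs with h
  · rw [Bool.toNat_eq_one]
    simpa [List.all_eq_true, List.any_eq_true] using h
  · rw [Bool.toNat_eq_zero, Bool.eq_false_iff]
    simpa [List.all_eq_true, List.any_eq_true] using h

theorem inFP_countProblem_posBetaAcyclicCNF : InFP (countProblem posBetaAcyclicCNF) := by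
  have h : PolyTime fun F : posBetaAcyclicCNF =>
      nestCount (List.range F.1.n) F.1.form.toNat.clauses :=
    PolyTime.nestCount (by fun_prop) (by fun_prop) fun F =>
      pairwise_follows_elimOrder (betaAcyclic_clauses F.2).2 List.nodup_range
  exact InFP.of_polyTime (A := countProblem posBetaAcyclicCNF) h
    fun F => congrArg Val.nat (count_eq_nestCount F.2)

/-- Transfers preserve oracle-freeness, so the counting algorithm is plugged in where part (1) asks
the oracle. -/
theorem inFP_shapleyProblem_posBetaAcyclicCNF : InFP (shapleyProblem posBetaAcyclicCNF) :=
  ((shapley_transfers posBetaAcyclicCNF_eq_orClosure).trans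
    (fixedSizeCount_transfers posBetaAcyclicCNF_eq_orClosure)).inFP
      inFP_countProblem_posBetaAcyclicCNF

end ShapMC

theorem mainTheorem2 :
    (∀ C : Set ShapMC.BoolFun, C = ShapMC.orClosure C →
      ShapMC.PolyEquiv (ShapMC.shapleyProblem C) (ShapMC.fixedSizeCountProblem C) ∧
      ShapMC.PolyEquiv (ShapMC.fixedSizeCountProblem C) (ShapMC.countProblem C) ∧
      ShapMC.PolyEquiv (ShapMC.shapleyProblem C) (ShapMC.countProblem C)) ∧
    ShapMC.InFP (ShapMC.shapleyProblem ShapMC.posBetaAcyclicCNF) := by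
  exact ⟨fun _ hC => ShapMC.polyEquiv_of_eq_orClosure hC,
    ShapMC.inFP_shapleyProblem_posBetaAcyclicCNF⟩
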